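/- Let $N\ge 1$, $\alpha>\frac2N$ and $\lambda\in\mathbb C$. Let $k,n,m$ be integers with $$k>\tfrac N2,\qquad m>\max\Bigl\{\tfrac N2+1,\tfrac N{2\alpha}\Bigr\},\qquad 2n\ge k+m+1,$$ and put $J=2n+2+k+m$ and $\langle x\rangle=(1+|x|^2)^{1/2}$. Let $\mathcal X$ be the space of all $u\in H^J(\mathbb R^N)$ (complex valued) such that $\langle x\rangle^mD^\beta u\in L^\infty(\mathbb R^N)$ for $0\le|\beta|\le 2n$, $\langle x\rangle^mD^\beta u\in L^2(\mathbb R^N)$ for $2n+1\le|\beta|\le 2n+2+k$, and $\langle x\rangle^{J-|\beta|}D^\beta u\in L^2(\mathbb R^N)$ for $2n+2+k<|\beta|\le J$. Let $\Sigma=H^1(\mathbb R^N)\cap L^2(\mathbb R^N,|x|^2dx)$, and let $(e^{it\Delta})_{t\in\mathbb R}$ be the Schrödinger group. Let $\varphi\in\mathcal X$ satisfy $\inf_{x\in\mathbb R^N}\langle x\rangle^m|\varphi(x)|>0$. Then there is $b_0>0$ such that for every $b\ge b_0$, with $u_0(x)=e^{ib|x|^2/4}\varphi(x)$, the following holds.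 There exists a unique global solution $u\in C([0,\infty),\Sigma)\cap L^\infty((0,\infty)\times\mathbb R^N)$ of $$u(t)=e^{it\Delta}u_0+i\lambda\int_0^te^{i(t-s)\Delta}|u(s)|^\alpha u(s)\,ds,\qquad t\ge0.$$ Moreover $u$ scatters, i.e. there exists $u^+\in\Sigma$ such that $e^{-it\Delta}u(t)\to u^+$ in $\Sigma$ as $t\to\infty$. In addition, $\sup_{t\ge0}(1+t)^{N/2}\|u(t)\|_{L^\infty}<\infty$. -/

import Mathlib

open MeasureTheory Filter Topology
open scoped ENNReal

noncomputable section

namespace NLS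

/-- The Euclidean space `ℝ^N`. -/
abbrev Space (N : ℕ) : Type := EuclideanSpace ℝ (Fin N)

/-- The space `L²(ℝ^N)` of complex valued functions (Lebesgue measure). -/
abbrev L2 (N : ℕ) : Type := Lp (α := Space N) ℂ 2 (volume : Measure (Space N))

/-- `⟨x⟩ = (1 + |x|²)^{1/2}`. -/
def bracket {N : ℕ} (x : Space N) : ℝ := Real.sqrt (1 + ‖x‖ ^ 2)

/-- `v ∈ L²` is the weak (distributional) derivative `∂_{i 0} ∂_{i 1} ⋯ ∂_{i (j-1)} u` of `u ∈ L²`.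
A multi-index `β` of length `|β| = j` is given as a list `i` of `j` coordinate directions, that is
`D^β = ∂_{i 0} ⋯ ∂_{i (j-1)}`; every multi-index of length `j` arises in this way. -/
def IsWeakDeriv {N j : ℕ} (i : Fin j → Fin N) (u v : L2 N) : Prop :=
  LineDeriv.iteratedLineDerivOp (fun l => (EuclideanSpace.single (i l) (1 : ℝ) : Space N))
      (Lp.toTemperedDistribution u) =
    Lp.toTemperedDistribution v

/-- The space `𝒳`, with `J = 2n + 2 + k + m`: the functions `u` with `D^β u ∈ L²` for `|β| ≤ J`
(that is, `u ∈ H^J`) and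
* `⟨x⟩^m D^β u ∈ L^∞` for `0 ≤ |β| ≤ 2n`,
* `⟨x⟩^m D^β u ∈ L²` for `2n + 1 ≤ |β| ≤ 2n + 2 + k`,
* `⟨x⟩^(J - |β|) D^β u ∈ L²` for `2n + 2 + k < |β| ≤ J`. -/
def MemX {N : ℕ} (k n m : ℕ) (u : L2 N) : Prop :=
  ∀ j ≤ 2 * n + 2 + k + m, ∀ i : Fin j → Fin N, ∃ v : L2 N, IsWeakDeriv i u v ∧
    (j ≤ 2 * n → MemLp (fun x => ((bracket x ^ m : ℝ) : ℂ) * v x) ∞ volume) ∧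
    (2 * n + 1 ≤ j → j ≤ 2 * n + 2 + k →
      MemLp (fun x => ((bracket x ^ m : ℝ) : ℂ) * v x) 2 volume) ∧
    (2 * n + 2 + k < j →
      MemLp (fun x => ((bracket x ^ (2 * n + 2 + k + m - j) : ℝ) : ℂ) * v x) 2 volume)

/-- The `L²` norm of `∂_l f`, equal to `∞` if `∂_l f ∉ L²`. -/
def derivENorm {N : ℕ} (l : Fin N) (f : L2 N) : ℝ≥0∞ :=
  ⨅ (g : L2 N) (_ : IsWeakDeriv (fun _ : Fin 1 => l) f g), ‖g‖ₑ

/-- The norm `‖f‖_{L²} + ∑_l ‖∂_l f‖_{L²} + ‖ |x| f ‖_{L²}` of `Σ = H¹ ∩ L²(|x|² dx)`, equal to `∞`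
outside `Σ`. -/
def sigmaENorm {N : ℕ} (f : L2 N) : ℝ≥0∞ :=
  ‖f‖ₑ + ∑ l : Fin N, derivENorm l f + eLpNorm (fun x => ((‖x‖ : ℝ) : ℂ) * f x) 2 volume

/-- `f ∈ Σ = H¹(ℝ^N) ∩ L²(ℝ^N, |x|² dx)`. -/
def MemSigma {N : ℕ} (f : L2 N) : Prop := sigmaENorm f < ∞

/-- `u ∈ C([0,∞), Σ)`. -/
def ContinuousSigma {N : ℕ} (u : ℝ → L2 N) : Prop :=
  (∀ t ≥ 0, MemSigma (u t)) ∧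
    ∀ t ≥ 0, Tendsto (fun s => sigmaENorm (u s - u t)) (𝓝[Set.Ici 0] t) (𝓝 0)

/-- `u ∈ L^∞((0,∞) × ℝ^N)`. -/
def BoundedSpaceTime {N : ℕ} (u : ℝ → L2 N) : Prop :=
  ∃ M : ℝ, ∀ᵐ t ∂(volume.restrict (Set.Ioi (0 : ℝ))), ∀ᵐ x ∂(volume : Measure (Space N)),
    ‖u t x‖ ≤ M

theorem memLp_phase {N : ℕ} {θ : Space N → ℝ} (hθ : Continuous θ) (f : L2 N) :
    MemLp (fun x => Complex.exp ((θ x : ℂ) * Complex.I) * f x) 2 volume := by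
  refine (Lp.memLp f).of_le ?_ ?_
  · exact (by fun_prop : Continuous fun x => Complex.exp ((θ x : ℂ) * Complex.I))
      |>.aestronglyMeasurable.mul (Lp.aestronglyMeasurable f)
  · exact Eventually.of_forall fun x => by simp [Complex.norm_exp_ofReal_mul_I]

/-- The function `e^{iθ(x)} f(x)`, for a continuous real valued phase `θ`. -/
def phaseMul {N : ℕ} (θ : Space N → ℝ) (hθ : Continuous θ) (f : L2 N) : L2 N :=
  (memLp_phase hθ f).toLp (fun x => Complex.exp ((θ x : ℂ) * Complex.I) * f x)

/-- The Schrödinger group `e^{itΔ}` on `L²(ℝ^N)`: multiplication by `e^{-4π²it|ξ|²}` on the Fourier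
side, for the Fourier transform `∫ e^{-2πi x·ξ} f(x) dx`. -/
def schrodingerGroup {N : ℕ} (t : ℝ) (f : L2 N) : L2 N :=
  FourierTransformInv.fourierInv
    (phaseMul (fun ξ => -(4 * Real.pi ^ 2 * t * ‖ξ‖ ^ 2)) (by fun_prop)
      (FourierTransform.fourier f : L2 N))

open Classical in
/-- The nonlinearity `|f|^α f`, as an element of `L²`. It is in `L²` whenever `f ∈ L² ∩ L^∞` and
`α > 0`; the value `0` is used where it is not in `L²`. -/
def nonlinearity {N : ℕ} (α : ℝ) (f : L2 N) : L2 N :=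
  if h : MemLp (fun x => ((‖f x‖ ^ α : ℝ) : ℂ) * f x) 2 volume then h.toLp _ else 0

/-- `u` satisfies `u(t) = e^{itΔ} u₀ + iλ ∫₀ᵗ e^{i(t-s)Δ} |u(s)|^α u(s) ds` for all `t ≥ 0`. The
integral is a Bochner integral in `L²`. -/
def SatisfiesDuhamel {N : ℕ} (α : ℝ) (lam : ℂ) (u₀ : L2 N) (u : ℝ → L2 N) : Prop :=
  ∀ t ≥ 0,
    IntervalIntegrable (fun s => schrodingerGroup (t - s) (nonlinearity α (u s))) volume 0 t ∧
    u t = schrodingerGroup t u₀ +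
      (Complex.I * lam) • ∫ s in (0 : ℝ)..t, schrodingerGroup (t - s) (nonlinearity α (u s))

/-- `u ∈ C([0,∞), Σ) ∩ L^∞((0,∞) × ℝ^N)` is a global solution of the Duhamel equation with initial
value `u₀`. -/
def IsGlobalSolution {N : ℕ} (α : ℝ) (lam : ℂ) (u₀ : L2 N) (u : ℝ → L2 N) : Prop :=
  ContinuousSigma u ∧ BoundedSpaceTime u ∧ SatisfiesDuhamel α lam u₀ u

/-- `u` scatters as `t → ∞`: there is `u⁺ ∈ Σ` with `e^{-itΔ} u(t) → u⁺` in `Σ`. -/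
def Scatters {N : ℕ} (u : ℝ → L2 N) : Prop :=
  ∃ uplus : L2 N, MemSigma uplus ∧
    Tendsto (fun t => sigmaENorm (schrodingerGroup (-t) (u t) - uplus)) atTop (𝓝 0)

end NLS

end

noncomputable section

namespace NLS

open scoped SchwartzMap FourierTransform LineDeriv ContDiff Convolution

variable {N : ℕ}

/-! The quadratic phase is removed by the pseudo-conformal transformation. Put `s(t) = t/(1+bt)`,
which stays in `[0, 1/b)`. Completing the square in the Schrödinger kernel gives `e^{itΔ}
e^{ib|x|²/4} e^{-isΔ} f = (1+bt)^{-N/2} e^{ib|x|²/(4(1+bt))} f(x/(1+bt))` (`PL_phaseL_PL_ae`). Seek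
`u(t) = e^{itΔ}(e^{ib|x|²/4} g(t))` and set `V(t) = e^{is(t)Δ} g(t)`. The Duhamel equation for `u`
becomes `g(t) = φ + iλ ∫₀ᵗ (1+bσ)^{-Nα/2} e^{-is(σ)Δ} |V|^α V dσ`. Since `Nα/2 > 1`, the weight has
integral `O(1/b)` over `[0,∞)`, so for large `b` the global problem is a small perturbation of `V =
φ`.

The map `z ↦ |z|^α z` is not smooth at `0`, so derivatives of `|V|^α V` are controlled only as long
as `⟨x⟩^m |V|` is bounded below. This lower bound holds for `φ` and persists because `V` stays close
to `φ` in the `⟨x⟩^m`-weighted `L^∞` norm. Two estimates carry the argument. By `exists_PL_bound`,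
`e^{zΔ}` with `Re z ≥ 0`, `|z| ≤ 1` preserves the bounds defining `𝒳` up to a constant, and moves a
function by `O(|z|)` in weighted `L^∞`. By `exists_nonlinearity_bound`, the nonlinearity preserves
the same bounds on functions satisfying the lower bound.

All bounds are expressed by duality: `‖x^γ D^β f‖` is read off from `∫ f D^β(x^γ ψ)` with `ψ`
Schwartz, measured against `‖ψ‖_{L²}` or `‖ψ‖_{L¹}`. Such bounds are closed under `L²` limits and
pass through `L²`-valued integrals. The fixed point can therefore be found by a contraction in the
`L²` norm alone, on an `L²`-closed set of functions with all the required bounds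
(`exists_profile_solution`).

The rest follows from the form of `u`. The identity above gives the decay rate from boundedness of
`V`. Moreover `e^{-itΔ}u(t) = e^{ib|x|²/4} g(t)`, and the increments of `g` in `Σ` are dominated by
the integrable weight, which gives continuity and scattering (`sigma_of_increments`). Uniqueness is
Gronwall's inequality in `L²`. -/

/-- Complex valued Schwartz functions on `ℝ^N`. -/
abbrev Test (N : ℕ) : Type := 𝓢(Space N, ℂ)

/-! ### Duality between `L²` functions and Schwartz functions. -/

/-- The bilinear pairing `∫ f ψ` of an `L²` function with a Schwartz function. -/
def pair {N : ℕ} (f : L2 N) (ψ : Test N) : ℂ := Lp.toTemperedDistribution f ψ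

theorem pair_eq {N : ℕ} (f : L2 N) (ψ : Test N) : pair f ψ = ∫ x, ψ x * f x := by
  simp [pair]

/-- The `L²` norm of a Schwartz function. -/
def n2 {N : ℕ} (ψ : Test N) : ℝ := ‖ψ.toLp 2 (volume : Measure (Space N))‖

/-- The `L¹` norm of a Schwartz function. -/
def n1 {N : ℕ} (ψ : Test N) : ℝ := ∫ x, ‖ψ x‖

theorem n2_nonneg {N : ℕ} (ψ : Test N) : 0 ≤ n2 ψ := norm_nonneg _

theorem n1_nonneg {N : ℕ} (ψ : Test N) : 0 ≤ n1 ψ := integral_nonneg fun _ => norm_nonneg _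

theorem norm_star_eq (f : L2 N) : ‖star f‖ = ‖f‖ := by
  rw [Lp.norm_def, Lp.norm_def]
  congr 1
  refine eLpNorm_congr_norm_ae ?_
  filter_upwards [Lp.coeFn_star f] with x h
  rw [h, Pi.star_apply, norm_star]

theorem pair_add_left (f g : L2 N) (ψ : Test N) : pair (f + g) ψ = pair f ψ + pair g ψ :=
  congrArg (fun T => T ψ) (map_add (Lp.toTemperedDistributionCLM ℂ (volume : Measure (Space N)) 2) f g)

theorem pair_smul_left (c : ℂ) (f : L2 N) (ψ : Test N) : pair (c • f) ψ = c * pair f ψ :=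
  congrArg (fun T => T ψ) (map_smul (Lp.toTemperedDistributionCLM ℂ (volume : Measure (Space N)) 2) c f)

theorem pair_sub_left (f g : L2 N) (ψ : Test N) : pair (f - g) ψ = pair f ψ - pair g ψ :=
  congrArg (fun T => T ψ) (map_sub (Lp.toTemperedDistributionCLM ℂ (volume : Measure (Space N)) 2) f g)

theorem pair_add (f : L2 N) (ψ χ : Test N) : pair f (ψ + χ) = pair f ψ + pair f χ :=
  map_add (Lp.toTemperedDistribution f) ψ χ

theorem pair_sub (f : L2 N) (ψ χ : Test N) : pair f (ψ - χ) = pair f ψ - pair f χ :=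
  map_sub (Lp.toTemperedDistribution f) ψ χ

theorem pair_smul (f : L2 N) (c : ℂ) (ψ : Test N) : pair f (c • ψ) = c * pair f ψ :=
  map_smul (Lp.toTemperedDistribution f) c ψ

theorem pair_sum {ι : Type*} (s : Finset ι) (f : L2 N) (ψ : ι → Test N) :
    pair f (∑ i ∈ s, ψ i) = ∑ i ∈ s, pair f (ψ i) :=
  map_sum (Lp.toTemperedDistribution f) ψ s

theorem pair_eq_inner (f : L2 N) (ψ : Test N) :
    pair f ψ = inner ℂ (star (ψ.toLp 2 (volume : Measure (Space N)))) f := by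
  rw [pair_eq, L2.inner_def]
  refine integral_congr_ae ?_
  filter_upwards [Lp.coeFn_star (ψ.toLp 2 (volume : Measure (Space N))),
    ψ.coeFn_toLp 2 (volume : Measure (Space N))] with x h1 h2
  rw [h1, Pi.star_apply, h2]
  simp [mul_comm]

theorem norm_pair_le (f : L2 N) (ψ : Test N) : ‖pair f ψ‖ ≤ ‖f‖ * n2 ψ := by
  rw [pair_eq_inner]
  refine (norm_inner_le_norm _ _).trans_eq ?_
  rw [norm_star_eq, mul_comm]
  rfl

theorem pair_ext {f g : L2 N} (h : ∀ ψ, pair f ψ = pair g ψ) : f = g := by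
  have := Lp.ker_toTemperedDistributionCLM_eq_bot (F := ℂ) (μ := (volume : Measure (Space N))) (p := 2)
  refine LinearMap.ker_eq_bot.mp this ?_
  ext ψ
  exact h ψ

theorem continuous_pair_left (ψ : Test N) : Continuous fun f : L2 N => pair f ψ := by
  simp_rw [pair_eq_inner]
  fun_prop

/-- Riesz representation: a linear functional on Schwartz functions bounded by the `L²` norm is
given by an `L²` function. -/
theorem exists_pair_eq (ℓ : Test N →ₗ[ℂ] ℂ) {C : ℝ} (hC : 0 ≤ C) (h : ∀ ψ, ‖ℓ ψ‖ ≤ C * n2 ψ) :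
    ∃ f : L2 N, ‖f‖ ≤ C ∧ ∀ ψ, pair f ψ = ℓ ψ := by
  let e : Test N →ₗ[ℂ] L2 N := (SchwartzMap.toLpCLM ℂ ℂ 2 (volume : Measure (Space N))).toLinearMap
  have he : DenseRange e := SchwartzMap.denseRange_toLpCLM (by norm_num)
  let T : L2 N →L[ℂ] ℂ := LinearMap.extendOfNorm ℓ e
  have hT : ∀ ψ, T (e ψ) = ℓ ψ := fun ψ =>
    LinearMap.extendOfNorm_eq he ⟨C, h⟩ ψ
  have hTn : ‖T‖ ≤ C := LinearMap.opNorm_extendOfNorm_le he hC h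
  let r : L2 N := (InnerProductSpace.toDual ℂ (L2 N)).symm T
  -- The pairing is bilinear while the inner product is conjugate linear in its first argument, so
  -- the Riesz vector is conjugated.
  refine ⟨star r, ?_, fun ψ => ?_⟩
  · rw [norm_star_eq]
    simpa [r] using hTn
  · rw [← hT, pair_eq]
    have : T (e ψ) = inner ℂ r (e ψ) := by simp [r]
    rw [this, L2.inner_def]
    refine integral_congr_ae ?_
    filter_upwards [Lp.coeFn_star r,
      ψ.coeFn_toLp 2 (volume : Measure (Space N))] with x h1 h2
    rw [h1, Pi.star_apply]
    change _ = inner ℂ (r x) ((ψ.toLp 2 (volume : Measure (Space N))) x)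
    rw [h2]
    simp

theorem norm_le_of_pair_le {f : L2 N} {C : ℝ} (hC : 0 ≤ C) (h : ∀ ψ, ‖pair f ψ‖ ≤ C * n2 ψ) :
    ‖f‖ ≤ C := by
  obtain ⟨g, hg, hg'⟩ := exists_pair_eq (Lp.toTemperedDistribution f).toLinearMap hC h
  rwa [pair_ext (f := f) (g := g) fun ψ => (hg' ψ).symm]

/-! ### Temperate growth of the symbol of `e^{zΔ}`. -/

theorem norm_iteratedFDeriv_cexp_le (n : ℕ) (w : ℂ) :
    ‖iteratedFDeriv ℝ n Complex.exp w‖ ≤ ‖Complex.exp w‖ := by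
  induction n generalizing w with
  | zero => simp
  | succ n ih =>
    rw [← norm_iteratedFDeriv_fderiv]
    have : fderiv ℝ Complex.exp = (ContinuousLinearMap.mul ℝ ℂ) ∘ Complex.exp := by
      funext w
      have h := (Complex.hasDerivAt_exp w).hasFDerivAt.restrictScalars ℝ
      rw [h.fderiv]
      ext
      simp [mul_comm]
    rw [this]
    refine (ContinuousLinearMap.norm_iteratedFDeriv_comp_left (n := n) _
      ((Complex.contDiff_exp (n := n)).contDiffAt) le_rfl).trans ?_
    calc _ ≤ 1 * ‖Complex.exp w‖ := by
          gcongr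
          · exact ContinuousLinearMap.opNorm_mul_le ℝ ℂ
          · exact ih w
      _ = _ := one_mul _

/-- Where `Re f ≤ 0`, every derivative of the exponential at `f x` has norm at most `1`. The chain
rule of order `n` then only produces products of derivatives of `f`, which grow polynomially. -/
theorem hasTemperateGrowth_cexp {E : Type*} [NormedAddCommGroup E] [NormedSpace ℝ E] {f : E → ℂ}
    (hf : f.HasTemperateGrowth) (hre : ∀ x, (f x).re ≤ 0) :
    (fun x => Complex.exp (f x)).HasTemperateGrowth := by
  refine ⟨Complex.contDiff_exp.comp hf.1, fun n => ?_⟩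
  obtain ⟨k, C, hC, h⟩ := hf.norm_iteratedFDeriv_le_uniform n
  refine ⟨k * n, n.factorial * 1 * (1 + C) ^ n, fun x => ?_⟩
  have key := norm_iteratedFDeriv_comp_le (g := Complex.exp) (f := f) (n := n) (N := ∞) (𝕜 := ℝ)
    Complex.contDiff_exp hf.1 (mod_cast le_top) x (C := 1) (D := (1 + C) * (1 + ‖x‖) ^ k) ?_ ?_
  · refine key.trans_eq ?_
    rw [mul_pow, ← pow_mul]
    ring
  · intro i _
    refine (norm_iteratedFDeriv_cexp_le i _).trans ?_
    rw [Complex.norm_exp]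
    exact Real.exp_le_one_iff.mpr (hre x)
  · intro i hi hi'
    calc _ ≤ C * (1 + ‖x‖) ^ k := h i hi' x
      _ ≤ (1 + C) * (1 + ‖x‖) ^ k := by gcongr; simp
      _ ≤ _ := by
        apply le_self_pow₀ (one_le_mul_of_one_le_of_one_le (by simp [hC]) (by simp [one_le_pow₀]))
        lia


/-- The projection of `z` to the closed right half plane. -/
def rightHalf (z : ℂ) : ℂ := ⟨max z.re 0, z.im⟩

theorem rightHalf_of_nonneg {z : ℂ} (hz : 0 ≤ z.re) : rightHalf z = z := by
  apply Complex.ext <;> simp [rightHalf, hz]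

/-- The symbol `e^{-4π²z|ξ|²}` of `e^{zΔ}`, `Re z ≥ 0`. -/
def symb (z : ℂ) (ξ : Space N) : ℂ :=
  Complex.exp (-(4 * Real.pi ^ 2 * rightHalf z) * ((‖ξ‖ ^ 2 : ℝ) : ℂ))

theorem symb_exponent_re (z : ℂ) (ξ : Space N) :
    (-(4 * Real.pi ^ 2 * rightHalf z) * ((‖ξ‖ ^ 2 : ℝ) : ℂ)).re = -(4 * Real.pi ^ 2 * max z.re 0 * ‖ξ‖ ^ 2) := by
  have : (-(4 * Real.pi ^ 2 * rightHalf z) * ((‖ξ‖ ^ 2 : ℝ) : ℂ)) =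
    ((-(4 * Real.pi ^ 2 * ‖ξ‖ ^ 2) : ℝ) : ℂ) * rightHalf z := by push_cast; ring
  rw [this, Complex.re_ofReal_mul]
  simp [rightHalf]; ring

theorem norm_symb (z : ℂ) (ξ : Space N) : ‖symb z ξ‖ = Real.exp (-(4 * Real.pi ^ 2 * max z.re 0 * ‖ξ‖ ^ 2)) := by
  rw [symb, Complex.norm_exp, symb_exponent_re]

theorem norm_symb_le (z : ℂ) (ξ : Space N) : ‖symb z ξ‖ ≤ 1 := by
  rw [norm_symb]
  exact Real.exp_le_one_iff.mpr (by simp; positivity)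

@[fun_prop]
-- Valid for every `z`, because `rightHalf` clips the real part. The operators `PS` and `PL` are
-- thus defined without a condition on `z`, and `0 ≤ z.re` is needed only for algebraic identities.
theorem hasTemperateGrowth_symb (z : ℂ) : (symb (N := N) z).HasTemperateGrowth := by
  have h : (fun ξ : Space N => ((‖ξ‖ ^ 2 : ℝ) : ℂ)).HasTemperateGrowth := by
    exact (Function.RCLike.hasTemperateGrowth_ofReal ℂ).comp
      (Function.hasTemperateGrowth_norm_sq (Space N))
  refine hasTemperateGrowth_cexp ?_ fun ξ => ?_
  · exact (Function.HasTemperateGrowth.const _).mul h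
  · rw [symb_exponent_re]
    simp; positivity

theorem memLp_symb (z : ℂ) : MemLp (symb (N := N) z) ∞ volume :=
  memLp_top_of_bound (hasTemperateGrowth_symb z).1.continuous.aestronglyMeasurable 1
    (Eventually.of_forall (norm_symb_le z))

/-! ### The operators `x_i`, `∂_i` and `e^{zΔ}` on Schwartz functions and on `L²`. -/

/-- The coordinate function `x_i`, complex valued. -/
def coord (i : Fin N) (x : Space N) : ℂ := ((x i : ℝ) : ℂ)

@[fun_prop]
theorem hasTemperateGrowth_coord (i : Fin N) : (coord i).HasTemperateGrowth :=
  (Complex.ofRealCLM.comp (EuclideanSpace.proj (𝕜 := ℝ) i)).hasTemperateGrowth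

/-- The basis vector `e_i`. -/
abbrev bvec (i : Fin N) : Space N := EuclideanSpace.single i (1 : ℝ)

/-- `∂_i` on Schwartz functions. -/
def Dop (i : Fin N) : Test N →L[ℂ] Test N := LineDeriv.lineDerivOpCLM ℂ (Test N) (bvec i)

/-- Multiplication by `x_i` on Schwartz functions. -/
def Xop (i : Fin N) : Test N →L[ℂ] Test N := SchwartzMap.smulLeftCLM ℂ (coord i)

/-- `D^β` on Schwartz functions. -/
def Dl : List (Fin N) → Test N →L[ℂ] Test N
  | [] => ContinuousLinearMap.id ℂ _
  | i :: β => (Dop i).comp (Dl β)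

/-- Multiplication by `x^γ` on Schwartz functions. -/
def Xl : List (Fin N) → Test N →L[ℂ] Test N
  | [] => ContinuousLinearMap.id ℂ _
  | i :: β => (Xop i).comp (Xl β)

@[simp] theorem Dl_nil (ψ : Test N) : Dl [] ψ = ψ := rfl
@[simp] theorem Dl_cons (i : Fin N) (β) (ψ : Test N) : Dl (i :: β) ψ = Dop i (Dl β ψ) := rfl
@[simp] theorem Xl_nil (ψ : Test N) : Xl [] ψ = ψ := rfl
@[simp] theorem Xl_cons (i : Fin N) (β) (ψ : Test N) : Xl (i :: β) ψ = Xop i (Xl β ψ) := rfl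

theorem Dl_append (β γ : List (Fin N)) (ψ : Test N) : Dl (β ++ γ) ψ = Dl β (Dl γ ψ) := by
  induction β with
  | nil => rfl
  | cons i β ih => simp [ih]

theorem Xl_append (β γ : List (Fin N)) (ψ : Test N) : Xl (β ++ γ) ψ = Xl β (Xl γ ψ) := by
  induction β with
  | nil => rfl
  | cons i β ih => simp [ih]

theorem Dop_eq (i : Fin N) (ψ : Test N) : Dop i ψ = ∂_{bvec i} ψ := rfl

theorem Xop_apply (i : Fin N) (ψ : Test N) (x : Space N) : Xop i ψ x = coord i x * ψ x := by
  rw [Xop, SchwartzMap.smulLeftCLM_apply_apply (by fun_prop)]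
  rfl

theorem Dop_apply (i : Fin N) (ψ : Test N) (x : Space N) :
    Dop i ψ x = fderiv ℝ ψ x (bvec i) := by
  rw [Dop_eq, SchwartzMap.lineDerivOp_apply_eq_fderiv]

theorem fderiv_coord (i j : Fin N) (x : Space N) :
    fderiv ℝ (coord j) x (bvec i) = if i = j then 1 else 0 := by
  have : coord j = (Complex.ofRealCLM.comp (EuclideanSpace.proj (𝕜 := ℝ) j)) := rfl
  rw [this, ContinuousLinearMap.fderiv]
  simp [eq_comm, apply_ite Complex.ofReal]

theorem Dop_Xop (i j : Fin N) (ψ : Test N) :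
    Dop i (Xop j ψ) = Xop j (Dop i ψ) + if i = j then ψ else 0 := by
  ext x
  rw [Dop_apply]
  have : (Xop j ψ : Space N → ℂ) = fun x => coord j x * ψ x := funext (Xop_apply j ψ)
  rw [this, fderiv_fun_mul ((hasTemperateGrowth_coord j).1.contDiffAt.differentiableAt (by simp))
    (ψ.hasFDerivAt x).differentiableAt]
  simp only [add_apply, Xop_apply, Dop_apply, smul_apply,
    fderiv_coord]
  split_ifs <;> simp

/-- `e^{zΔ}` on Schwartz functions. -/
def PS (z : ℂ) : Test N →L[ℂ] Test N := SchwartzMap.fourierMultiplierCLM ℂ (symb z)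

/-- `e^{zΔ}` on `L²`. -/
def PL (z : ℂ) (f : L2 N) : L2 N := 𝓕⁻ (((memLp_symb z).toLp (symb z) : Lp (α := Space N) ℂ ∞ volume) • (𝓕 f : L2 N) : L2 N)

/-- The symbol is even in `ξ`, so the multiplier is its own transpose for the bilinear pairing.
Every property of `e^{zΔ}` on `L²` is derived from Schwartz functions through this identity. -/
theorem pair_PL (z : ℂ) (f : L2 N) (ψ : Test N) : pair (PL z f) ψ = pair f (PS z ψ) := by
  have hsymm : 𝓕 (SchwartzMap.smulLeftCLM ℂ (symb z) (𝓕⁻ ψ)) = PS z ψ := by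
    rw [PS, SchwartzMap.fourierMultiplierCLM_apply]
    ext x
    rw [SchwartzMap.fourierInv_coe, SchwartzMap.fourier_coe, Real.fourierInv_eq_fourier_comp_neg]
    refine congrArg (fun h : Space N → ℂ => 𝓕 h x) (funext fun y => ?_)
    rw [SchwartzMap.smulLeftCLM_apply_apply (by fun_prop),
      SchwartzMap.smulLeftCLM_apply_apply (by fun_prop), SchwartzMap.fourierInv_coe,
      SchwartzMap.fourier_coe, Real.fourierInv_eq_fourier_neg]
    simp [symb]
  rw [pair, PL, ← Lp.fourierInv_toTemperedDistribution_eq,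
    Lp.toTemperedDistribution_smul_eq (hasTemperateGrowth_symb z),
    ← Lp.fourier_toTemperedDistribution_eq, TemperedDistribution.fourierInv_apply,
    TemperedDistribution.smulLeftCLM_apply_apply, TemperedDistribution.fourier_apply, hsymm, pair]

theorem coord_eq_inner (i : Fin N) (x : Space N) : coord i x = ((inner ℝ x (bvec i) : ℝ) : ℂ) := by
  simp [coord, EuclideanSpace.inner_single_right]

theorem Dop_eq_fourierMultiplier (i : Fin N) (ψ : Test N) :
    Dop i ψ = (2 * Real.pi * Complex.I) • SchwartzMap.fourierMultiplierCLM ℂ (coord i) ψ := by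
  rw [Dop_eq, SchwartzMap.lineDeriv_eq_fourierMultiplierCLM,
    ← SchwartzMap.fourierMultiplierCLM_ofReal ℂ (Function.hasTemperateGrowth_inner_left (bvec i))]
  congr 3
  funext ξ
  rw [coord_eq_inner]
  rfl

theorem PS_Dop (z : ℂ) (i : Fin N) (ψ : Test N) : PS z (Dop i ψ) = Dop i (PS z ψ) := by
  rw [Dop_eq_fourierMultiplier, Dop_eq_fourierMultiplier, map_smul, PS,
    SchwartzMap.fourierMultiplierCLM_fourierMultiplierCLM_apply (by fun_prop) (by fun_prop),
    SchwartzMap.fourierMultiplierCLM_fourierMultiplierCLM_apply (by fun_prop) (by fun_prop), mul_comm (symb z)]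

theorem PS_Dl (z : ℂ) (β : List (Fin N)) (ψ : Test N) : PS z (Dl β ψ) = Dl β (PS z ψ) := by
  induction β with
  | nil => rfl
  | cons i β ih => simp [PS_Dop, ih]

theorem Xop_eq (i : Fin N) (ψ : Test N) : Xop i ψ = SchwartzMap.smulLeftCLM ℂ (inner ℝ · (bvec i)) ψ := by
  ext x
  rw [Xop_apply, SchwartzMap.smulLeftCLM_apply_apply (by fun_prop), coord_eq_inner]
  simp

theorem fderiv_symb {z : ℂ} (ξ : Space N) (i : Fin N) :
    fderiv ℝ (symb z) ξ (bvec i) = -(8 * Real.pi ^ 2 * rightHalf z) * coord i ξ * symb z ξ := by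
  have h1 : HasFDerivAt (fun ξ : Space N => ((‖ξ‖ ^ 2 : ℝ) : ℂ))
      (Complex.ofRealCLM.comp (2 • (innerSL ℝ ξ))) ξ :=
    Complex.ofRealCLM.hasFDerivAt.comp ξ (hasStrictFDerivAt_norm_sq ξ).hasFDerivAt
  have h2 := (h1.const_mul (-(4 * Real.pi ^ 2 * rightHalf z))).cexp
  have h3 : fderiv ℝ (symb z) ξ = _ := h2.fderiv
  rw [h3, coord_eq_inner]
  simp [symb, mul_comm]
  ring

/-- On the Fourier side `x_i` is a derivative in `ξ_i`, and the extra term is that derivative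
falling on the Gaussian symbol. A power of `x` carried through the propagator is thus kept or
exchanged for one derivative, so derivatives plus weights never exceed their initial total. This is
the reason for the exponents `J - |β|` in `𝒳`. -/
theorem PS_Xop {z : ℂ} (hz : 0 ≤ z.re) (i : Fin N) (ψ : Test N) :
    PS z (Xop i ψ) = Xop i (PS z ψ) + (2 * z) • Dop i (PS z ψ) := by
  have hpi : (2 * Real.pi * Complex.I : ℂ) ≠ 0 := by simp [Real.pi_ne_zero]
  set g : Test N := 𝓕 ψ with hg
  set S : Test N →L[ℂ] Test N := SchwartzMap.smulLeftCLM ℂ (symb z) with hS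
  have hSa : ∀ χ : Test N, ∀ ξ, S χ ξ = symb z ξ * χ ξ := fun χ ξ => by
    rw [hS, SchwartzMap.smulLeftCLM_apply_apply (by fun_prop)]; rfl
  have h1 : 𝓕 (Xop i ψ) = (-(2 * Real.pi * Complex.I))⁻¹ • Dop i g := by
    rw [Dop_eq, hg, SchwartzMap.lineDerivOp_fourier_eq, FourierTransform.fourier_smul, ← Xop_eq,
      smul_smul, inv_mul_cancel₀ (neg_ne_zero.mpr hpi), one_smul]
  have h2 : S (Dop i g) = Dop i (S g) + (8 * Real.pi ^ 2 * z) • Xop i (S g) := by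
    ext ξ
    have hSg : (S g : Space N → ℂ) = fun x => symb z x * g x := funext (hSa g)
    simp only [add_apply, smul_apply, Xop_apply, hSa, Dop_apply]
    rw [hSg, fderiv_fun_mul ((hasTemperateGrowth_symb z).1.contDiffAt.differentiableAt (by simp))
      (g.hasFDerivAt ξ).differentiableAt]
    simp only [add_apply, smul_apply, fderiv_symb, rightHalf_of_nonneg hz]
    simp only [smul_eq_mul]
    ring
  have h3 : PS z ψ = 𝓕⁻ (S g) := rfl
  have h4 : PS z (Xop i ψ) = 𝓕⁻ (S (𝓕 (Xop i ψ))) := rfl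
  have h5 : 𝓕⁻ (Dop i (S g)) = -(2 * Real.pi * Complex.I) • Xop i (PS z ψ) := by
    rw [Dop_eq, SchwartzMap.fourierInv_lineDerivOp_eq, ← Xop_eq, h3]
  have h6 : 𝓕⁻ (Xop i (S g)) = (2 * Real.pi * Complex.I)⁻¹ • Dop i (PS z ψ) := by
    rw [Dop_eq, h3, SchwartzMap.lineDerivOp_fourierInv_eq, FourierTransform.fourierInv_smul, ← Xop_eq,
      smul_smul, inv_mul_cancel₀ hpi, one_smul]
  rw [h4, h1, map_smul, h2, smul_add, FourierTransform.fourierInv_add, FourierTransform.fourierInv_smul,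
    FourierTransform.fourierInv_smul, FourierTransform.fourierInv_smul, h5, h6, smul_smul, smul_smul, smul_smul,
    inv_mul_cancel₀ (neg_ne_zero.mpr hpi), one_smul]
  congr 2
  have : (Real.pi : ℂ) ≠ 0 := by simp [Real.pi_ne_zero]
  field_simp
  ring_nf
  simp

theorem n2_le_of_norm_le {ψ χ : Test N} {C : ℝ} (h : ∀ x, ‖ψ x‖ ≤ C * ‖χ x‖) : n2 ψ ≤ C * n2 χ := by
  refine Lp.norm_le_mul_norm_of_ae_le_mul ?_
  filter_upwards [ψ.coeFn_toLp 2 (volume : Measure (Space N)),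
    χ.coeFn_toLp 2 (volume : Measure (Space N))] with x h1 h2
  rw [h1, h2]
  exact h x

theorem n2_fourierInv (ψ : Test N) : n2 (𝓕⁻ ψ) = n2 ψ := by
  rw [n2, ← SchwartzMap.toLp_fourierInv_eq, ← Lp.norm_fourier_eq, FourierTransform.fourier_fourierInv_eq]
  rfl

theorem n2_fourier (ψ : Test N) : n2 (𝓕 ψ) = n2 ψ := by
  rw [n2, ← SchwartzMap.toLp_fourier_eq, Lp.norm_fourier_eq]
  rfl

theorem n2_PS (z : ℂ) (ψ : Test N) : n2 (PS z ψ) ≤ n2 ψ := by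
  rw [PS, SchwartzMap.fourierMultiplierCLM_apply, n2_fourierInv, ← n2_fourier ψ]
  refine (n2_le_of_norm_le (C := 1) fun x => ?_).trans_eq (one_mul _)
  rw [SchwartzMap.smulLeftCLM_apply_apply (by fun_prop), norm_smul]
  gcongr
  exact norm_symb_le z x

theorem norm_PL_le (z : ℂ) (f : L2 N) : ‖PL z f‖ ≤ ‖f‖ := by
  refine norm_le_of_pair_le (norm_nonneg _) fun ψ => ?_
  rw [pair_PL]
  refine (norm_pair_le _ _).trans ?_
  gcongr
  exact n2_PS z ψ

theorem PL_add (z : ℂ) (f g : L2 N) : PL z (f + g) = PL z f + PL z g :=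
  pair_ext fun ψ => by simp [pair_PL, pair_add_left]

theorem PL_sub (z : ℂ) (f g : L2 N) : PL z (f - g) = PL z f - PL z g :=
  pair_ext fun ψ => by simp [pair_PL, pair_sub_left]

theorem PL_smul (z c : ℂ) (f : L2 N) : PL z (c • f) = c • PL z f :=
  pair_ext fun ψ => by simp [pair_PL, pair_smul_left]

/-- `e^{zΔ}` as a bounded operator on `L²`. -/
def PLC (z : ℂ) : L2 N →L[ℂ] L2 N :=
  LinearMap.mkContinuous ⟨⟨PL z, PL_add z⟩, PL_smul z⟩ 1 fun f => by
    simpa using norm_PL_le z f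

@[simp] theorem PLC_apply (z : ℂ) (f : L2 N) : PLC z f = PL z f := rfl

theorem PS_PS {z w : ℂ} (hz : 0 ≤ z.re) (hw : 0 ≤ w.re) (ψ : Test N) : PS z (PS w ψ) = PS (z + w) ψ := by
  rw [PS, PS, SchwartzMap.fourierMultiplierCLM_fourierMultiplierCLM_apply (by fun_prop) (by fun_prop), PS]
  congr 1
  congr 1
  funext ξ
  rw [Pi.mul_apply, symb, symb, symb, ← Complex.exp_add, rightHalf_of_nonneg hz, rightHalf_of_nonneg hw,
    rightHalf_of_nonneg (by simpa using add_nonneg hz hw)]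
  congr 1
  ring

theorem PL_PL {z w : ℂ} (hz : 0 ≤ z.re) (hw : 0 ≤ w.re) (f : L2 N) : PL z (PL w f) = PL (z + w) f :=
  pair_ext fun ψ => by rw [pair_PL, pair_PL, PS_PS hw hz, pair_PL, add_comm]

theorem PS_zero (ψ : Test N) : PS 0 ψ = ψ := by
  have : symb (N := N) 0 = fun _ => 1 := by
    funext ξ
    simp [symb, rightHalf_of_nonneg]
  rw [PS, this]
  simp

theorem PL_zero (f : L2 N) : PL 0 f = f :=
  pair_ext fun ψ => by rw [pair_PL, PS_zero]

theorem schrodingerGroup_eq (t : ℝ) (f : L2 N) : schrodingerGroup t f = PL (t * Complex.I) f := by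
  rw [schrodingerGroup, PL]
  congr 1
  apply Lp.ext
  refine (MemLp.coeFn_toLp _).trans ?_
  filter_upwards [Lp.coeFn_lpSMul (r := 2) ((memLp_symb (t * Complex.I)).toLp _) (𝓕 f : L2 N),
    (memLp_symb (N := N) (t * Complex.I)).coeFn_toLp] with x h1 h2
  rw [h1, Pi.smul_apply', h2, symb, rightHalf_of_nonneg (by simp)]
  simp only [smul_eq_mul]
  congr 2
  push_cast
  ring

/-! ### Words in `x_i` and `∂_i` and their normal ordering -/

/-- The operator on Schwartz functions given by a word in the letters `x_i` (`Sum.inl i`) and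
`∂_i` (`Sum.inr i`). -/
def Wl : List (Fin N ⊕ Fin N) → Test N →L[ℂ] Test N
  | [] => ContinuousLinearMap.id ℂ _
  | Sum.inl i :: W => (Xop i).comp (Wl W)
  | Sum.inr i :: W => (Dop i).comp (Wl W)

@[simp] theorem Wl_nil (ψ : Test N) : Wl [] ψ = ψ := rfl
@[simp] theorem Wl_inl (i : Fin N) (W) (ψ : Test N) : Wl (Sum.inl i :: W) ψ = Xop i (Wl W ψ) := rfl
@[simp] theorem Wl_inr (i : Fin N) (W) (ψ : Test N) : Wl (Sum.inr i :: W) ψ = Dop i (Wl W ψ) := rfl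

theorem Wl_append (V W : List (Fin N ⊕ Fin N)) (ψ : Test N) : Wl (V ++ W) ψ = Wl V (Wl W ψ) := by
  induction V with
  | nil => rfl
  | cons a V ih => rcases a with i | i <;> simp [ih]

theorem Wl_map_inr (β : List (Fin N)) (ψ : Test N) : Wl (β.map Sum.inr) ψ = Dl β ψ := by
  induction β with
  | nil => rfl
  | cons i β ih => simp [ih]

theorem Dop_Xl (i : Fin N) (γ : List (Fin N)) (ψ : Test N) :
    Dop i (Xl γ ψ) = Xl γ (Dop i ψ) +
      ∑ r ∈ Finset.range γ.length, if γ[r]? = some i then Xl (γ.eraseIdx r) ψ else 0 := by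
  induction γ with
  | nil => simp
  | cons j γ ih =>
    rw [Xl_cons, Dop_Xop, ih, map_add, map_sum, List.length_cons, Finset.sum_range_succ', Xl_cons,
      add_assoc]
    congr 2
    · refine Finset.sum_congr rfl fun r _ => ?_
      simp [apply_ite (Xop j)]
    · simp [eq_comm]

/-- The number of letters `x_i` in a word. -/
def numX (W : List (Fin N ⊕ Fin N)) : ℕ := W.countP Sum.isLeft

@[simp] theorem numX_nil : numX ([] : List (Fin N ⊕ Fin N)) = 0 := rfl

@[simp] theorem numX_inl (i : Fin N) (W) : numX (Sum.inl i :: W) = numX W + 1 := by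
  rw [numX, numX, List.countP_cons_of_pos rfl]

@[simp] theorem numX_inr (i : Fin N) (W : List (Fin N ⊕ Fin N)) : numX (Sum.inr i :: W) = numX W := by
  simp [numX]

@[simp] theorem numX_map_inr (β : List (Fin N)) : numX (β.map Sum.inr) = 0 := by
  induction β with
  | nil => rfl
  | cons i β ih => simp [ih]

/-- `f` satisfies the weighted `L²` bounds `‖x^γ D^β f‖ ≤ M` (in the dual sense) for
`2n + 1 ≤ |β|`, `|γ| ≤ m`, `|β| + |γ| ≤ 2n + 2 + k + m`. -/
def BoundTwo (k n m : ℕ) (M : ℝ) (f : L2 N) : Prop :=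
  ∀ β γ : List (Fin N), 2 * n + 1 ≤ β.length → γ.length ≤ m →
    β.length + γ.length ≤ 2 * n + 2 + k + m → ∀ ψ, ‖pair f (Dl β (Xl γ ψ))‖ ≤ M * n2 ψ

/-- The letters of `W` are absorbed from the left. A letter `x_i` joins `γ`; a letter `∂_i` is moved
across `x^γ` to join `β`, each commutator deleting one letter of `γ`. As `γ` has at most `m`
letters, each step costs a factor at most `1 + m`. -/
theorem BoundTwo.word {k n m : ℕ} {M : ℝ} {f : L2 N} (hM : 0 ≤ M) (hf : BoundTwo k n m M f)
    (W : List (Fin N ⊕ Fin N)) (β γ : List (Fin N)) (h1 : 2 * n + 1 ≤ β.length)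
    (h2 : γ.length + numX W ≤ m) (h3 : β.length + γ.length + W.length ≤ 2 * n + 2 + k + m)
    (ψ : Test N) :
    ‖pair f (Dl β (Xl γ (Wl W ψ)))‖ ≤ (1 + m) ^ W.length * M * n2 ψ := by
  induction W generalizing β γ with
  | nil => simpa using hf β γ h1 (by simpa using h2) (by simpa using h3) ψ
  | cons a W ih =>
    have hpos : 0 ≤ ((1 : ℝ) + m) ^ W.length * M * n2 ψ := by have := n2_nonneg ψ; positivity
    rcases a with i | i
    · have := ih β (γ ++ [i]) h1 (by simp at h2 ⊢; lia) (by simp at h3 ⊢; lia)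
      rw [Xl_append] at this
      refine (this : ‖pair f (Dl β (Xl γ (Wl (Sum.inl i :: W) ψ)))‖ ≤ _).trans ?_
      rw [List.length_cons, pow_succ]
      nlinarith [(Nat.cast_nonneg m : (0:ℝ) ≤ m)]
    · rw [Wl_inr]
      have hX : Xl γ (Dop i (Wl W ψ)) = Dop i (Xl γ (Wl W ψ)) -
        ∑ r ∈ Finset.range γ.length, if γ[r]? = some i then Xl (γ.eraseIdx r) (Wl W ψ) else 0 := by
        rw [Dop_Xl]; simp
      rw [hX, map_sub, pair_sub, map_sum, pair_sum]
      rw [numX_inr] at h2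
      have e1 : ‖pair f (Dl β (Dop i (Xl γ (Wl W ψ))))‖ ≤ (1 + m) ^ W.length * M * n2 ψ := by
        have := ih (β ++ [i]) γ (by simp; lia) h2 (by simp at h3 ⊢; lia)
        rwa [Dl_append] at this
      have e2 : ∀ r ∈ Finset.range γ.length,
          ‖pair f (Dl β (if γ[r]? = some i then Xl (γ.eraseIdx r) (Wl W ψ) else 0))‖ ≤
            (1 + m) ^ W.length * M * n2 ψ := by
        intro r hr
        split_ifs
        · have hl := List.length_eraseIdx_of_lt (Finset.mem_range.mp hr)
          exact ih β (γ.eraseIdx r) h1 (by lia) (by simp at h3; lia)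
        · have : pair f (Dl β (0 : Test N)) = 0 := by
            rw [map_zero]; exact map_zero (Lp.toTemperedDistribution f)
          rw [this, norm_zero]
          exact hpos
      refine (norm_sub_le _ _).trans ((add_le_add e1 ((norm_sum_le _ _).trans
        (Finset.sum_le_sum e2))).trans ?_)
      rw [Finset.sum_const, Finset.card_range, nsmul_eq_mul, List.length_cons, pow_succ]
      have : (γ.length : ℝ) ≤ m := by exact_mod_cast (by lia : γ.length ≤ m)
      nlinarith

/-- Each `x_i` in `γ` crosses `e^{zΔ}` by `PS_Xop` and becomes `x_i + 2z∂_i`, acting after the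
propagator; `W` collects the letters obtained. With `‖z‖ ≤ 1` the two terms cost at most `1 + 2 = 3`
per letter, and `|γ| + |W|` is preserved. -/
theorem BoundTwo.word_PS {k n m : ℕ} {M : ℝ} {f : L2 N} (hM : 0 ≤ M) (hf : BoundTwo k n m M f)
    {z : ℂ} (hz : 0 ≤ z.re) (hz1 : ‖z‖ ≤ 1) (γ : List (Fin N))
    (W : List (Fin N ⊕ Fin N)) (β : List (Fin N)) (h1 : 2 * n + 1 ≤ β.length)
    (h2 : γ.length + W.length ≤ m) (h3 : β.length + γ.length + W.length ≤ 2 * n + 2 + k + m)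
    (ψ : Test N) :
    ‖pair f (Dl β (Wl W (PS z (Xl γ ψ))))‖ ≤ 3 ^ γ.length * (1 + m) ^ m * M * n2 ψ := by
  induction γ generalizing W with
  | nil =>
    have hW : numX W ≤ W.length := List.countP_le_length
    have := hf.word hM W β [] h1 (by simp at h2 ⊢; lia) (by simpa using h3) (PS z ψ)
    refine this.trans ?_
    have h4 := n2_PS z ψ
    have : ((1 : ℝ) + m) ^ W.length ≤ (1 + m) ^ m :=
      pow_le_pow_right₀ (by simp) (by simpa using h2)
    simp only [List.length_nil, pow_zero, one_mul]
    gcongr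
    exact n2_nonneg _
  | cons i γ ih =>
    rw [Xl_cons, PS_Xop hz, map_add, map_add, pair_add, map_smul, map_smul, pair_smul]
    have e1 := ih (W ++ [Sum.inl i]) (by simp at h2 ⊢; lia) (by simp at h3 ⊢; lia)
    have e2 := ih (W ++ [Sum.inr i]) (by simp at h2 ⊢; lia) (by simp at h3 ⊢; lia)
    rw [Wl_append] at e1 e2
    simp only [Wl_inl, Wl_inr, Wl_nil] at e1 e2
    have h2z : ‖2 * z‖ ≤ 2 := by rw [norm_mul]; simp; linarith
    refine (norm_add_le _ _).trans ?_
    rw [norm_mul, List.length_cons, pow_succ]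
    have := mul_le_mul h2z e2 (norm_nonneg _) (by norm_num)
    linarith

theorem BoundTwo.PL {k n m : ℕ} {M : ℝ} {f : L2 N} (hM : 0 ≤ M) (hf : BoundTwo k n m M f)
    {z : ℂ} (hz : 0 ≤ z.re) (hz1 : ‖z‖ ≤ 1) :
    BoundTwo k n m (3 ^ m * (1 + m) ^ m * M) (PL z f) := by
  intro β γ h1 h2 h3 ψ
  rw [pair_PL, PS_Dl]
  refine (hf.word_PS hM hz hz1 γ [] β h1 (by simpa using h2) (by simpa using h3) ψ).trans ?_
  have : (3 : ℝ) ^ γ.length ≤ 3 ^ m := pow_le_pow_right₀ (by norm_num) h2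
  have := n2_nonneg ψ
  gcongr

/-! ### Weights -/

theorem one_le_bracket (x : Space N) : 1 ≤ bracket x := by
  rw [bracket, Real.one_le_sqrt]
  nlinarith [sq_nonneg ‖x‖]

theorem bracket_pos (x : Space N) : 0 < bracket x := one_pos.trans_le (one_le_bracket x)

theorem bracket_sq (x : Space N) : bracket x ^ 2 = 1 + ‖x‖ ^ 2 := Real.sq_sqrt (by positivity)

theorem norm_le_bracket (x : Space N) : ‖x‖ ≤ bracket x :=
  Real.le_sqrt_of_sq_le (by linarith)

@[fun_prop]
theorem continuous_bracket : Continuous (bracket : Space N → ℝ) := by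
  unfold bracket; fun_prop

theorem abs_coord_le (i : Fin N) (x : Space N) : ‖coord i x‖ ≤ ‖x‖ := by
  rw [coord, Complex.norm_real]
  exact PiLp.norm_apply_le x i

theorem memLp_bracket_rpow {r : ℝ} (hr : (N : ℝ) / 2 < r) :
    MemLp (fun x : Space N => bracket x ^ (-r)) 2 volume := by
  have hc : Continuous fun x : Space N => bracket x ^ (-r) :=
    continuous_bracket.rpow_const fun x => Or.inl (bracket_pos x).ne'
  rw [memLp_two_iff_integrable_sq hc.aestronglyMeasurable]
  have := integrable_rpow_neg_one_add_norm_sq (E := Space N) (μ := volume) (r := 2 * r)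
    (by simp; linarith)
  refine this.congr (Eventually.of_forall fun x => ?_)
  simp only
  rw [← bracket_sq, ← Real.rpow_natCast (bracket x) 2, ← Real.rpow_mul (bracket_pos x).le,
    ← Real.rpow_natCast, ← Real.rpow_mul (bracket_pos x).le]
  congr 1
  push_cast
  ring

theorem n2_le_of_norm_le_memLp {G : Space N → ℝ} (hG : MemLp G 2 volume) {ψ : Test N} {C : ℝ}
    (hC : 0 ≤ C) (h : ∀ x, ‖ψ x‖ ≤ C * G x) : n2 ψ ≤ C * ‖hG.toLp G‖ := by
  have : ‖ψ.toLp 2 (volume : Measure (Space N))‖ ≤ C * ‖hG.toLp G‖ := by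
    refine Lp.norm_le_mul_norm_of_ae_le_mul ?_
    filter_upwards [ψ.coeFn_toLp 2 (volume : Measure (Space N)), hG.coeFn_toLp] with x h1 h2
    rw [h1, h2]
    refine (h x).trans ?_
    gcongr
    exact le_abs_self _
  exact this

/-! ### The Sobolev embedding, in dual form -/

/-- The Fourier multiplier `(1 + |ξ|²)^r`. -/
def bessel (r : ℝ) : Test N →L[ℂ] Test N :=
  SchwartzMap.fourierMultiplierCLM ℂ (fun ξ => (((1 + ‖ξ‖ ^ 2) ^ r : ℝ) : ℂ))

@[fun_prop]
theorem hasTemperateGrowth_bessel (r : ℝ) :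
    (fun ξ : Space N => (((1 + ‖ξ‖ ^ 2) ^ r : ℝ) : ℂ)).HasTemperateGrowth :=
  (Function.RCLike.hasTemperateGrowth_ofReal ℂ).comp
    (Function.hasTemperateGrowth_one_add_norm_sq_rpow (Space N) r)

theorem bessel_bessel (r s : ℝ) (ψ : Test N) : bessel r (bessel s ψ) = bessel (r + s) ψ := by
  rw [bessel, bessel, SchwartzMap.fourierMultiplierCLM_fourierMultiplierCLM_apply (by fun_prop) (by fun_prop), bessel]
  congr 2
  funext ξ
  rw [Pi.mul_apply, Real.rpow_add (by positivity)]
  push_cast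
  rfl

theorem bessel_zero (ψ : Test N) : bessel 0 ψ = ψ := by
  simp [bessel]

theorem fourier_Dop (i : Fin N) (ψ : Test N) (ξ : Space N) :
    (𝓕 (Dop i ψ)) ξ = (2 * Real.pi * Complex.I) * coord i ξ * (𝓕 ψ) ξ := by
  rw [Dop_eq_fourierMultiplier, FourierTransform.fourier_smul, SchwartzMap.fourierMultiplierCLM_apply,
    FourierTransform.fourier_fourierInv_eq, smul_apply,
    SchwartzMap.smulLeftCLM_apply_apply (by fun_prop)]
  simp [mul_assoc]

theorem fourier_bessel (r : ℝ) (ψ : Test N) (ξ : Space N) :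
    (𝓕 (bessel r ψ)) ξ = (((1 + ‖ξ‖ ^ 2) ^ r : ℝ) : ℂ) * (𝓕 ψ) ξ := by
  rw [bessel, SchwartzMap.fourierMultiplierCLM_apply,
    FourierTransform.fourier_fourierInv_eq,
    SchwartzMap.smulLeftCLM_apply_apply (by fun_prop)]
  simp

theorem norm_fourier_Dl_le (β : List (Fin N)) (ψ : Test N) (ξ : Space N) :
    ‖(𝓕 (Dl β ψ)) ξ‖ ≤ (2 * Real.pi * ‖ξ‖) ^ β.length * ‖(𝓕 ψ) ξ‖ := by
  induction β with
  | nil => simp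
  | cons i β ih =>
    rw [Dl_cons, fourier_Dop, norm_mul, norm_mul, List.length_cons, pow_succ']
    have h1 : ‖(2 * Real.pi * Complex.I : ℂ)‖ = 2 * Real.pi := by
      simp [abs_of_pos Real.pi_pos]
    rw [h1, mul_assoc (2 * Real.pi * ‖ξ‖)]
    have := Real.pi_pos
    gcongr
    exact abs_coord_le i ξ

theorem fourier_ext {ψ χ : Test N} (h : ∀ ξ, (𝓕 ψ) ξ = (𝓕 χ) ξ) : ψ = χ := by
  have h' : (𝓕 ψ : Test N) = 𝓕 χ := SchwartzMap.ext h
  rw [← FourierTransform.fourierInv_fourier_eq (F := Test N) ψ,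
    ← FourierTransform.fourierInv_fourier_eq (F := Test N) χ, h']

theorem bessel_add_one (r : ℝ) (ψ : Test N) : bessel (r + 1) ψ = bessel r ψ +
    ∑ j : Fin N, ((2 * Real.pi * Complex.I) ^ 2)⁻¹ • Dop j (bessel r (Dop j ψ)) := by
  refine fourier_ext fun ξ => ?_
  rw [← FourierTransform.fourierCLM_apply (R := ℂ) (f := bessel r ψ + _), map_add, map_sum]
  simp only [map_smul, FourierTransform.fourierCLM_apply, add_apply, sum_apply, smul_apply,
    fourier_Dop, fourier_bessel]
  have hpi : (2 * Real.pi * Complex.I : ℂ) ≠ 0 := by simp [Real.pi_ne_zero]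
  rw [Real.rpow_add (by positivity), Real.rpow_one]
  have hsum : ((‖ξ‖ ^ 2 : ℝ) : ℂ) = ∑ j, coord j ξ ^ 2 := by
    rw [EuclideanSpace.real_norm_sq_eq]
    simp [coord]
  have : ∀ j : Fin N, ((2 * Real.pi * Complex.I : ℂ) ^ 2)⁻¹ • ((2 * Real.pi * Complex.I) * coord j ξ *
      ((((1 + ‖ξ‖ ^ 2) ^ r : ℝ) : ℂ) * ((2 * Real.pi * Complex.I) * coord j ξ * (𝓕 ψ) ξ))) =
      coord j ξ ^ 2 * ((((1 + ‖ξ‖ ^ 2) ^ r : ℝ) : ℂ) * (𝓕 ψ) ξ) := by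
    intro j
    rw [smul_eq_mul]
    field_simp
  simp_rw [this]
  rw [← Finset.sum_mul, ← hsum]
  push_cast
  ring

/-- The multiplier `(1+|ξ|²)^k` has order `2k`. Expanding it factor by factor, one derivative of
each second order term is given to `ℓ` and the other to `χ`, so neither receives more than `k`. Each
factor contributes at most `1 + N` terms with coefficients of modulus at most `1`. -/
theorem norm_functional_bessel_le (k : ℕ) (ℓ : Test N →ₗ[ℂ] ℂ) {A T : ℝ} (hA : 0 ≤ A) (χ : Test N)
    (h : ∀ β : List (Fin N), β.length ≤ k → ∀ χ, ‖ℓ (Dl β χ)‖ ≤ A * n2 χ)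
    (hT : ∀ β : List (Fin N), β.length ≤ k → n2 (Dl β χ) ≤ T) :
    ‖ℓ (bessel k χ)‖ ≤ (1 + N) ^ k * (A * T) := by
  have hT0 : 0 ≤ T := (n2_nonneg _).trans (hT [] (by simp))
  induction k generalizing ℓ χ with
  | zero =>
    rw [Nat.cast_zero, bessel_zero]
    refine (h [] le_rfl χ).trans ?_
    simp only [pow_zero, one_mul]
    gcongr
    exact hT [] le_rfl
  | succ k ih =>
    rw [Nat.cast_succ, bessel_add_one, map_add, map_sum]
    have e1 := ih ℓ χ (fun β hβ => h β (by lia)) (fun β hβ => hT β (by lia))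
    have e2 : ∀ j : Fin N, ‖ℓ (((2 * Real.pi * Complex.I) ^ 2 : ℂ)⁻¹ • Dop j (bessel k (Dop j χ)))‖ ≤
        (1 + N) ^ k * (A * T) := by
      intro j
      have e3 := ih (ℓ.comp (Dop j).toLinearMap) (Dop j χ)
        (fun β hβ χ => h (j :: β) (by simpa using hβ) χ)
        (fun β hβ => by
          have := hT (β ++ [j]) (by simpa using hβ)
          rwa [Dl_append] at this)
      rw [map_smul, norm_smul]
      have hc : ‖((2 * Real.pi * Complex.I) ^ 2 : ℂ)⁻¹‖ ≤ 1 := by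
        rw [norm_inv, norm_pow]
        have h1 : ‖(2 * Real.pi * Complex.I : ℂ)‖ = 2 * Real.pi := by
          simp [abs_of_pos Real.pi_pos]
        rw [h1]
        refine inv_le_one_of_one_le₀ (one_le_pow₀ ?_)
        linarith [Real.pi_gt_three]
      calc _ ≤ 1 * _ := mul_le_mul hc e3 (norm_nonneg _) zero_le_one
        _ = _ := one_mul _
    refine (norm_add_le _ _).trans ((add_le_add e1 ((norm_sum_le _ _).trans
        (Finset.sum_le_sum fun j _ => e2 j))).trans_eq ?_)
    rw [Finset.sum_const, Finset.card_univ, Fintype.card_fin, nsmul_eq_mul, pow_succ]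
    ring

theorem norm_fourier_le_n1 (ψ : Test N) (ξ : Space N) : ‖(𝓕 ψ) ξ‖ ≤ n1 ψ := by
  rw [SchwartzMap.fourier_coe]
  exact VectorFourier.norm_fourierIntegral_le_integral_norm _ _ _ _ _

/-- The embedding `H^k ⊂ L^∞` for functionals: `k` derivatives bounded in `L²` yield a bound by the
`L¹` norm of the test function. Write `ψ` as `(1+|ξ|²)^k` applied to `(1+|ξ|²)^{-k} ψ`. Up to `k`
derivatives of the latter are bounded in `L²` by `sup |𝓕ψ| ≤ ‖ψ‖_{L¹}` times the `L²` norm of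
`⟨ξ⟩^{-k}`, finite since `k > N/2`. -/
theorem exists_sobolev_const {k : ℕ} (hk : (N : ℝ) / 2 < k) : ∃ K : ℝ, 0 ≤ K ∧
    ∀ (ℓ : Test N →ₗ[ℂ] ℂ) (A : ℝ), 0 ≤ A →
      (∀ β : List (Fin N), β.length ≤ k → ∀ χ, ‖ℓ (Dl β χ)‖ ≤ A * n2 χ) →
      ∀ ψ, ‖ℓ ψ‖ ≤ K * A * n1 ψ := by
  have hG := memLp_bracket_rpow hk
  refine ⟨(1 + N) ^ k * ((2 * Real.pi) ^ k * ‖hG.toLp _‖), by have := Real.pi_pos; positivity, fun ℓ A hA h ψ => ?_⟩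
  have hψ : ψ = bessel k (bessel (-k) ψ) := by
    rw [bessel_bessel, add_neg_cancel, bessel_zero]
  have hT : ∀ β : List (Fin N), β.length ≤ k → n2 (Dl β (bessel (-k) ψ)) ≤ ((2 * Real.pi) ^ k * n1 ψ) * ‖hG.toLp _‖ := by
    intro β hβ
    have hpi := Real.pi_pos
    have h0 := n1_nonneg ψ
    rw [← n2_fourier]
    refine n2_le_of_norm_le_memLp hG (by positivity) fun ξ => ?_
    refine (norm_fourier_Dl_le _ _ _).trans ?_
    rw [fourier_bessel, norm_mul, Complex.norm_real, Real.norm_of_nonneg (by positivity), mul_pow]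
    have hb := one_le_bracket ξ
    have hb0 := bracket_pos ξ
    have h1 : ‖ξ‖ ^ β.length ≤ bracket ξ ^ k :=
      (pow_le_pow_left₀ (norm_nonneg _) (norm_le_bracket ξ) _).trans (pow_le_pow_right₀ hb hβ)
    have h2 : (2 * Real.pi) ^ β.length ≤ (2 * Real.pi) ^ k :=
      pow_le_pow_right₀ (by linarith [Real.pi_gt_three]) hβ
    have h3 := norm_fourier_le_n1 ψ ξ
    have h4 : bracket ξ ^ k * (1 + ‖ξ‖ ^ 2) ^ (-k : ℝ) = bracket ξ ^ (-k : ℝ) := by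
      rw [← bracket_sq, ← Real.rpow_natCast, ← Real.rpow_natCast, ← Real.rpow_mul hb0.le,
        ← Real.rpow_add hb0]
      congr 1
      push_cast
      ring
    calc (2 * Real.pi) ^ β.length * ‖ξ‖ ^ β.length * ((1 + ‖ξ‖ ^ 2) ^ (-k : ℝ) * ‖(𝓕 ψ) ξ‖)
        ≤ (2 * Real.pi) ^ k * bracket ξ ^ k * ((1 + ‖ξ‖ ^ 2) ^ (-k : ℝ) * n1 ψ) := by gcongr
      _ = (2 * Real.pi) ^ k * n1 ψ * (bracket ξ ^ k * (1 + ‖ξ‖ ^ 2) ^ (-k : ℝ)) := by ring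
      _ = _ := by rw [h4]
  have := norm_functional_bessel_le k ℓ hA (bessel (-k) ψ) h hT
  rw [← hψ] at this
  refine this.trans_eq ?_
  ring

/-- The functional `χ ↦ ∫ f D^β x^γ χ`. -/
def functional (f : L2 N) (β γ : List (Fin N)) : Test N →ₗ[ℂ] ℂ :=
  (Lp.toTemperedDistribution f).toLinearMap ∘ₗ (Dl β).toLinearMap ∘ₗ (Xl γ).toLinearMap

/-- Adding `k` derivatives to an order at most `2n + 2` stays within `2n + 2 + k`, the range in
which the full weight `⟨x⟩^m` is available in `L²`. -/
theorem BoundTwo.exists_sobolev (k n m : ℕ) (hk : (N : ℝ) / 2 < k) : ∃ K : ℝ, 0 ≤ K ∧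
    ∀ (f : L2 N) (M : ℝ), 0 ≤ M → BoundTwo k n m M f →
      ∀ β γ : List (Fin N), 2 * n + 1 ≤ β.length → β.length ≤ 2 * n + 2 → γ.length ≤ m →
        ∀ ψ, ‖pair f (Dl β (Xl γ ψ))‖ ≤ K * M * n1 ψ := by
  obtain ⟨K, hK, h⟩ := exists_sobolev_const hk
  refine ⟨K * (1 + m) ^ k, by positivity, fun f M hM hf β γ h1 h2 h3 ψ => ?_⟩
  refine (h (functional f β γ) ((1 + m) ^ k * M) (by positivity) (fun δ hδ χ => ?_) ψ).trans_eq
    (by ring)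
  have := hf.word hM (δ.map Sum.inr) β γ h1 (by simpa using h3)
    (by simp; lia) χ
  rw [Wl_map_inr] at this
  refine this.trans ?_
  have : ((1 : ℝ) + m) ^ (δ.map (Sum.inr (α := Fin N))).length ≤ (1 + m) ^ k :=
    pow_le_pow_right₀ (by simp) (by simpa using hδ)
  have := n2_nonneg χ
  gcongr

/-! ### Dependence of `e^{zΔ}` on `z` -/

theorem norm_sq_eq_integral (f : L2 N) : ‖f‖ ^ 2 = ∫ x, ‖f x‖ ^ 2 := by
  have h := L2.inner_def (𝕜 := ℂ) f f
  rw [inner_self_eq_norm_sq_to_K] at h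
  have : ∫ x, inner ℂ (f x) (f x) = ((∫ x, ‖f x‖ ^ 2 : ℝ) : ℂ) := by
    rw [← integral_complex_ofReal]
    refine integral_congr_ae (Eventually.of_forall fun x => ?_)
    simp only [inner_self_eq_norm_sq_to_K]
    push_cast
    rfl
  rw [this] at h
  exact Complex.ofReal_injective (by rw [← h]; push_cast; rfl)

theorem integrable_norm_sq (f : L2 N) : Integrable (fun x => ‖f x‖ ^ 2) volume :=
  (memLp_two_iff_integrable_sq_norm (Lp.aestronglyMeasurable f)).mp (Lp.memLp f)

theorem integrable_mul_test (f : L2 N) (ψ : Test N) : Integrable (fun x => f x * ψ x) volume :=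
  (Lp.memLp f).integrable_mul (ψ.memLp 2 volume)

theorem symbLp_smul_ae (z : ℂ) (f : L2 N) :
    (((memLp_symb z).toLp (symb z) : Lp (α := Space N) ℂ ∞ volume) • f : L2 N) =ᵐ[volume]
      fun ξ => symb z ξ * f ξ := by
  filter_upwards [Lp.coeFn_lpSMul (r := 2) ((memLp_symb z).toLp (symb z)) f,
    (memLp_symb (N := N) z).coeFn_toLp] with x h1 h2
  rw [h1, Pi.smul_apply', h2, smul_eq_mul]

theorem continuous_rightHalf : Continuous rightHalf := by
  have : rightHalf = fun z : ℂ => ((max z.re 0 : ℝ) : ℂ) + (z.im : ℂ) * Complex.I := by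
    funext z
    apply Complex.ext <;> simp [rightHalf]
  rw [this]
  fun_prop

theorem continuous_symb_left (ξ : Space N) : Continuous fun z => symb z ξ := by
  unfold symb
  have := continuous_rightHalf
  fun_prop

theorem continuous_PL (f : L2 N) : Continuous fun z => PL z f := by
  rw [continuous_iff_continuousAt]
  intro w
  set F : L2 N := 𝓕 f with hF
  have hnorm : ∀ z, ‖PL z f - PL w f‖ ^ 2 = ∫ ξ, ‖symb z ξ - symb w ξ‖ ^ 2 * ‖F ξ‖ ^ 2 := by
    intro z
    have : PL z f - PL w f = 𝓕⁻ ((((memLp_symb z).toLp (symb z) : Lp (α := Space N) ℂ ∞ volume) • F : L2 N)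
      - (((memLp_symb w).toLp (symb w) : Lp (α := Space N) ℂ ∞ volume) • F : L2 N) : L2 N) :=
      ((FourierTransform.fourierInvCLM ℂ (L2 N)).map_sub _ _).symm
    rw [this, ← Lp.norm_fourier_eq, FourierTransform.fourier_fourierInv_eq, norm_sq_eq_integral]
    refine integral_congr_ae ?_
    filter_upwards [Lp.coeFn_sub (((memLp_symb z).toLp (symb z) : Lp (α := Space N) ℂ ∞ volume) • F : L2 N)
      (((memLp_symb w).toLp (symb w) : Lp (α := Space N) ℂ ∞ volume) • F : L2 N),
      symbLp_smul_ae z F, symbLp_smul_ae w F] with ξ h1 h2 h3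
    rw [h1, Pi.sub_apply, h2, h3, ← sub_mul, norm_mul, mul_pow]
  have hcont : Continuous fun z => ∫ ξ, ‖symb z ξ - symb w ξ‖ ^ 2 * ‖F ξ‖ ^ 2 := by
    refine continuous_of_dominated (bound := fun ξ => 4 * ‖F ξ‖ ^ 2) (fun z => ?_) (fun z => ?_)
      ((integrable_norm_sq F).const_mul 4) ?_
    · refine AEStronglyMeasurable.mul ?_ (integrable_norm_sq F).aestronglyMeasurable
      have h1 := (hasTemperateGrowth_symb (N := N) z).1.continuous
      have h2 := (hasTemperateGrowth_symb (N := N) w).1.continuous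
      exact (by fun_prop : Continuous fun ξ : Space N => ‖symb z ξ - symb w ξ‖ ^ 2).aestronglyMeasurable
    · refine Eventually.of_forall fun ξ => ?_
      rw [Real.norm_of_nonneg (by positivity)]
      have : ‖symb z ξ - symb w ξ‖ ≤ 2 := by
        refine (norm_sub_le _ _).trans ?_
        linarith [norm_symb_le z ξ, norm_symb_le w ξ]
      gcongr
      nlinarith [norm_nonneg (symb z ξ - symb w ξ)]
    · refine Eventually.of_forall fun ξ => ?_
      have := continuous_symb_left ξ
      fun_prop
  have h0 := hcont.tendsto w
  simp only [sub_self, norm_zero, ne_eq, OfNat.ofNat_ne_zero, not_false_eq_true, zero_pow, zero_mul,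
    integral_zero] at h0
  simp_rw [← hnorm] at h0
  have h1 := h0.sqrt
  simp only [Real.sqrt_sq (norm_nonneg _), Real.sqrt_zero] at h1
  exact tendsto_iff_norm_sub_tendsto_zero.mpr h1

theorem continuous_PL_comp {X : Type*} [TopologicalSpace X] {c : X → ℂ} {f : X → L2 N}
    (hc : Continuous c) (hf : Continuous f) : Continuous fun x => PL (c x) (f x) := by
  rw [continuous_iff_continuousAt]
  intro x
  rw [ContinuousAt, tendsto_iff_norm_sub_tendsto_zero]
  have h1 : Tendsto (fun y => ‖f y - f x‖ + ‖PL (c y) (f x) - PL (c x) (f x)‖) (𝓝 x) (𝓝 (0 + 0)) :=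
    (tendsto_iff_norm_sub_tendsto_zero.mp (hf.tendsto x)).add
      (tendsto_iff_norm_sub_tendsto_zero.mp (((continuous_PL (f x)).comp hc).tendsto x))
  rw [add_zero] at h1
  refine squeeze_zero (fun _ => norm_nonneg _) (fun y => ?_) h1
  have : PL (c y) (f y) - PL (c x) (f x) = PL (c y) (f y - f x) + (PL (c y) (f x) - PL (c x) (f x)) := by
    rw [PL_sub]; abel
  rw [this]
  refine (norm_add_le _ _).trans ?_
  gcongr
  exact norm_PL_le _ _

theorem pair_PL_eq_integral (z : ℂ) (f : L2 N) (χ : Test N) :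
    pair (PL z f) χ = ∫ ξ, symb z ξ * ((𝓕 f : L2 N) ξ * (𝓕⁻ χ) ξ) := by
  rw [pair, PL, ← Lp.fourierInv_toTemperedDistribution_eq, TemperedDistribution.fourierInv_apply,
    Lp.toTemperedDistribution_apply]
  refine integral_congr_ae ?_
  filter_upwards [symbLp_smul_ae z (𝓕 f : L2 N)] with ξ h
  rw [h, smul_eq_mul]
  ring

/-- The Laplacian on Schwartz functions. -/
def Lap (χ : Test N) : Test N := ∑ j : Fin N, Dop j (Dop j χ)

theorem fourierInv_Dop (i : Fin N) (ψ : Test N) (ξ : Space N) :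
    (𝓕⁻ (Dop i ψ)) ξ = -(2 * Real.pi * Complex.I) * coord i ξ * (𝓕⁻ ψ) ξ := by
  rw [Dop_eq, SchwartzMap.fourierInv_lineDerivOp_eq, ← Xop_eq, smul_apply, Xop_apply, smul_eq_mul]
  ring

theorem sum_coord_sq (ξ : Space N) : ((‖ξ‖ ^ 2 : ℝ) : ℂ) = ∑ j, coord j ξ ^ 2 := by
  rw [EuclideanSpace.real_norm_sq_eq]
  simp [coord]

theorem fourierInv_Lap (χ : Test N) (ξ : Space N) :
    (𝓕⁻ (Lap χ)) ξ = -(4 * Real.pi ^ 2) * ((‖ξ‖ ^ 2 : ℝ) : ℂ) * (𝓕⁻ χ) ξ := by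
  rw [Lap, ← FourierTransform.fourierInvCLM_apply (R := ℂ), map_sum]
  simp only [FourierTransform.fourierInvCLM_apply, sum_apply, fourierInv_Dop]
  rw [sum_coord_sq, Finset.mul_sum, Finset.sum_mul]
  refine Finset.sum_congr rfl fun j _ => ?_
  linear_combination (4 * Real.pi ^ 2 * coord j ξ ^ 2 * (𝓕⁻ χ) ξ) * Complex.I_sq

/-- Testing against a Schwartz function places the Laplacian on `χ`, so no regularity of `f` is
required for differentiation under the Fourier integral. -/
theorem hasDerivAt_pair_PL {z : ℂ} (hz : 0 ≤ z.re) (f : L2 N) (χ : Test N) {τ : ℝ} (hτ : 0 < τ) :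
    HasDerivAt (fun τ : ℝ => pair (PL (τ * z) f) χ) (z * pair (PL (τ * z) f) (Lap χ)) τ := by
  simp_rw [pair_PL_eq_integral]
  set F : L2 N := 𝓕 f
  have hd := (hasDerivAt_integral_of_dominated_loc_of_deriv_le (μ := (volume : Measure (Space N)))
    (F := fun (τ : ℝ) ξ => symb (τ * z) ξ * (F ξ * (𝓕⁻ χ) ξ))
    (F' := fun (τ : ℝ) ξ => z * (symb (τ * z) ξ * (F ξ * (𝓕⁻ (Lap χ)) ξ)))
    (x₀ := τ) (s := Set.Ioi 0) (bound := fun ξ => ‖z‖ * ‖F ξ * (𝓕⁻ (Lap χ)) ξ‖)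
    (Ioi_mem_nhds hτ) ?_ ?_ ?_ ?_ ?_ ?_).2
  · rwa [integral_const_mul] at hd
  · exact Eventually.of_forall fun τ => (hasTemperateGrowth_symb (N := N) _).1.continuous.aestronglyMeasurable.mul
      (integrable_mul_test F _).aestronglyMeasurable
  · exact (integrable_mul_test F _).bdd_mul (c := 1) (hasTemperateGrowth_symb (N := N) _).1.continuous.aestronglyMeasurable
      (Eventually.of_forall fun ξ => norm_symb_le _ ξ)
  · exact ((hasTemperateGrowth_symb (N := N) _).1.continuous.aestronglyMeasurable.mul
      (integrable_mul_test F _).aestronglyMeasurable).const_mul _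
  · refine Eventually.of_forall fun ξ τ _ => ?_
    rw [norm_mul, norm_mul]
    gcongr
    exact mul_le_of_le_one_left (norm_nonneg _) (norm_symb_le _ _)
  · exact (integrable_mul_test F _).norm.const_mul _
  · refine Eventually.of_forall fun ξ τ hτ => ?_
    have h1 : HasDerivAt (fun τ : ℝ => symb (τ * z) ξ)
        (symb (τ * z) ξ * (-(4 * Real.pi ^ 2 * z) * ((‖ξ‖ ^ 2 : ℝ) : ℂ))) τ := by
      have h2 : HasDerivAt (fun τ : ℝ => Complex.exp (-(4 * Real.pi ^ 2 * (τ * z)) * ((‖ξ‖ ^ 2 : ℝ) : ℂ)))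
          (Complex.exp (-(4 * Real.pi ^ 2 * (τ * z)) * ((‖ξ‖ ^ 2 : ℝ) : ℂ)) *
            (-(4 * Real.pi ^ 2 * z) * ((‖ξ‖ ^ 2 : ℝ) : ℂ))) τ := by
        refine HasDerivAt.cexp ?_
        have := (((Complex.ofRealCLM.hasDerivAt (x := τ)).mul_const z).const_mul
          (-(4 * Real.pi ^ 2 : ℂ))).mul_const ((‖ξ‖ ^ 2 : ℝ) : ℂ)
        convert! this using 1
        · funext t; simp only [Complex.ofRealCLM_apply]; ring
        · simp only [Complex.ofRealCLM_apply, Complex.ofReal_one]; ring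
      have hpos : ∀ t : ℝ, 0 < t → symb (t * z) ξ =
          Complex.exp (-(4 * Real.pi ^ 2 * (t * z)) * ((‖ξ‖ ^ 2 : ℝ) : ℂ)) := fun t ht => by
        rw [symb, rightHalf_of_nonneg (by rw [Complex.re_ofReal_mul]; positivity)]
      rw [hpos τ hτ]
      exact h2.congr_of_eventuallyEq
        (eventually_of_mem (Ioi_mem_nhds (Set.mem_Ioi.mp hτ)) fun t ht => hpos t ht)
    refine (h1.mul_const (F ξ * (𝓕⁻ χ) ξ)).congr_deriv ?_
    rw [fourierInv_Lap]
    ring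

theorem norm_pair_PL_sub_le {z : ℂ} (hz : 0 ≤ z.re) (f : L2 N) (χ : Test N) {B : ℝ}
    (hB : ∀ τ : ℝ, 0 < τ → τ < 1 → ‖pair (PL (τ * z) f) (Lap χ)‖ ≤ B) :
    ‖pair (PL z f - f) χ‖ ≤ ‖z‖ * B := by
  set h : ℝ → ℂ := fun τ : ℝ => pair (PL (τ * z) f) χ with hh
  have hc : Continuous h :=
    (continuous_pair_left χ).comp ((continuous_PL f).comp (by fun_prop : Continuous fun τ : ℝ => (τ : ℂ) * z))
  -- The derivative formula and the bound `hB` concern the open interval only, hence the mean value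
  -- inequality between `δ` and `1 - δ`, followed by `δ → 0`.
  have key : ∀ δ ∈ Set.Ioo (0 : ℝ) (1 / 2), ‖h (1 - δ) - h δ‖ ≤ ‖z‖ * B := by
    intro δ hδ
    have hB0 : 0 ≤ B := (norm_nonneg _).trans (hB δ hδ.1 (by linarith [hδ.2]))
    have := (convex_Ioo (0 : ℝ) 1).norm_image_sub_le_of_norm_hasDerivWithin_le (f := h)
      (f' := fun τ : ℝ => z * pair (PL (τ * z) f) (Lap χ)) (C := ‖z‖ * B) (x := δ) (y := 1 - δ)
      (fun τ hτ => (hasDerivAt_pair_PL hz f χ hτ.1).hasDerivWithinAt)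
      (fun τ hτ => by rw [norm_mul]; gcongr; exact hB τ hτ.1 hτ.2)
      ⟨hδ.1, by linarith [hδ.2]⟩ ⟨by linarith [hδ.2], by linarith [hδ.1]⟩
    refine this.trans (mul_le_of_le_one_right (by positivity) ?_)
    rw [Real.norm_eq_abs, abs_le]
    constructor <;> linarith [hδ.1, hδ.2]
  have hlim : Tendsto (fun δ : ℝ => ‖h (1 - δ) - h δ‖) (𝓝[>] 0) (𝓝 ‖h (1 - 0) - h 0‖) :=
    ((by fun_prop : Continuous fun δ : ℝ => ‖h (1 - δ) - h δ‖).tendsto 0).mono_left nhdsWithin_le_nhds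
  have h01 : pair (PL z f - f) χ = h (1 - 0) - h 0 := by
    simp [hh, pair_sub_left, PL_zero]
  rw [h01]
  exact le_of_tendsto hlim (eventually_of_mem (Ioo_mem_nhdsGT (by norm_num)) key)

/-! ### The weighted `L^∞` bounds -/

/-- `f` satisfies the weighted `L^∞` bounds `‖x^γ D^β f‖ ≤ M` (in the dual sense) for
`|β| ≤ 2n`, `|γ| ≤ m`. -/
def BoundInf (n m : ℕ) (M : ℝ) (f : L2 N) : Prop :=
  ∀ β γ : List (Fin N), β.length ≤ 2 * n → γ.length ≤ m → ∀ ψ, ‖pair f (Dl β (Xl γ ψ))‖ ≤ M * n1 ψ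

theorem BoundTwo.mono {k n m : ℕ} {M M' : ℝ} {f : L2 N} (hf : BoundTwo k n m M f) (h : M ≤ M') :
    BoundTwo k n m M' f := fun β γ h1 h2 h3 ψ =>
  (hf β γ h1 h2 h3 ψ).trans (mul_le_mul_of_nonneg_right h (n2_nonneg ψ))

theorem BoundInf.mono {n m : ℕ} {M M' : ℝ} {f : L2 N} (hf : BoundInf n m M f) (h : M ≤ M') :
    BoundInf n m M' f := fun β γ h1 h2 ψ =>
  (hf β γ h1 h2 ψ).trans (mul_le_mul_of_nonneg_right h (n1_nonneg ψ))

/-- The Schrödinger group is not bounded on `L^∞`, so regularity is spent instead. Orders `2n+1` and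
`2n+2` come from the `L²` bounds by Sobolev. Below that, `e^{zΔ}f` differs from `f` by an average of
`zΔ e^{τzΔ} f`, whose bound has order higher by two, and `f` itself is bounded by assumption. The
number `d` counts the descents by two. -/
theorem exists_PL_bound_aux (k n m : ℕ) (hk : (N : ℝ) / 2 < k) (d : ℕ) : ∃ K : ℝ, 0 ≤ K ∧
    ∀ (f : L2 N) (M : ℝ), 0 ≤ M → BoundTwo k n m M f → BoundInf n m M f →
      ∀ z : ℂ, 0 ≤ z.re → ‖z‖ ≤ 1 → ∀ β γ : List (Fin N), β.length ≤ 2 * n + 2 →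
        2 * n + 1 ≤ β.length + 2 * d → γ.length ≤ m →
          ∀ ψ, ‖pair (PL z f) (Dl β (Xl γ ψ))‖ ≤ K * M * n1 ψ := by
  obtain ⟨K₀, hK₀, h₀⟩ := BoundTwo.exists_sobolev (N := N) k n m hk
  have base : ∀ (f : L2 N) (M : ℝ), 0 ≤ M → BoundTwo k n m M f →
      ∀ z : ℂ, 0 ≤ z.re → ‖z‖ ≤ 1 → ∀ β γ : List (Fin N), β.length ≤ 2 * n + 2 →
        2 * n + 1 ≤ β.length → γ.length ≤ m →
          ∀ ψ, ‖pair (PL z f) (Dl β (Xl γ ψ))‖ ≤ K₀ * (3 ^ m * (1 + m) ^ m) * M * n1 ψ := by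
    intro f M hM hf z hz hz1 β γ h1 h2 h3 ψ
    refine (h₀ (PL z f) _ (by positivity) (hf.PL hM hz hz1) β γ h2 h1 h3 ψ).trans_eq (by ring)
  induction d with
  | zero =>
    exact ⟨K₀ * (3 ^ m * (1 + m) ^ m), by positivity, fun f M hM hf _ z hz hz1 β γ h1 h2 h3 ψ =>
      base f M hM hf z hz hz1 β γ h1 (by simpa using h2) h3 ψ⟩
  | succ d ih =>
    obtain ⟨K, hK, hd⟩ := ih
    refine ⟨K₀ * (3 ^ m * (1 + m) ^ m) + (1 + N * K), by positivity, ?_⟩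
    intro f M hM hf hf' z hz hz1 β γ h1 h2 h3 ψ
    have hn1 := n1_nonneg ψ
    by_cases hβ : 2 * n + 1 ≤ β.length
    · refine (base f M hM hf z hz hz1 β γ h1 hβ h3 ψ).trans ?_
      have : 0 ≤ (1 + N * K) * M * n1 ψ := by positivity
      linarith
    · have e1 := hf' β γ (by lia) h3 ψ
      have e2 : ‖pair (PL z f - f) (Dl β (Xl γ ψ))‖ ≤ ‖z‖ * (N * (K * M * n1 ψ)) := by
        refine norm_pair_PL_sub_le hz f _ fun τ hτ0 hτ1 => ?_
        rw [Lap, pair_sum]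
        refine (norm_sum_le _ _).trans ((Finset.sum_le_sum fun j _ =>
          hd f M hM hf hf' (τ * z) ?_ ?_ (j :: j :: β) γ ?_ ?_ h3 ψ).trans_eq ?_)
        · rw [Complex.re_ofReal_mul]; positivity
        · rw [norm_mul, Complex.norm_real, Real.norm_of_nonneg hτ0.le]
          exact mul_le_one₀ hτ1.le (norm_nonneg _) hz1
        · simp; lia
        · simp; lia
        · simp
      rw [pair_sub_left] at e2
      have e3 : ‖z‖ * (N * (K * M * n1 ψ)) ≤ N * (K * M * n1 ψ) :=
        mul_le_of_le_one_left (by positivity) hz1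
      have e4 := norm_le_norm_add_norm_sub' (pair (PL z f) (Dl β (Xl γ ψ))) (pair f (Dl β (Xl γ ψ)))
      have : 0 ≤ K₀ * (3 ^ m * (1 + m) ^ m) * M * n1 ψ := by positivity
      linarith

/-- The last conclusion, with its factor `‖z‖`, keeps `e^{zΔ}f` close to `f` in weighted `L^∞` for
small `z`. It is used both for the heat regularization and for the persistence of the lower bound
along the fixed point. -/
theorem exists_PL_bound (k n m : ℕ) (hk : (N : ℝ) / 2 < k) : ∃ K : ℝ, 1 ≤ K ∧
    ∀ (f : L2 N) (M : ℝ), 0 ≤ M → BoundTwo k n m M f → BoundInf n m M f →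
      ∀ z : ℂ, 0 ≤ z.re → ‖z‖ ≤ 1 →
        BoundTwo k n m (K * M) (PL z f) ∧ BoundInf n m (K * M) (PL z f) ∧
        ∀ γ : List (Fin N), γ.length ≤ m →
          ∀ ψ, ‖pair (PL z f - f) (Xl γ ψ)‖ ≤ K * M * ‖z‖ * n1 ψ := by
  -- Depth `n + 1` reaches `|β| = 0`, because `2n + 1 ≤ 2(n + 1)`.
  obtain ⟨K, hK, h⟩ := exists_PL_bound_aux (N := N) k n m hk (n + 1)
  refine ⟨1 + 3 ^ m * (1 + m) ^ m + K + N * K, by have : (0 : ℝ) ≤ 3 ^ m * (1 + m) ^ m := by positivity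
                                                  nlinarith [(Nat.cast_nonneg N : (0:ℝ) ≤ N)], ?_⟩
  intro f M hM hf hf' z hz hz1
  have hNK : 0 ≤ N * K := by positivity
  have h3 : (0 : ℝ) ≤ 3 ^ m * (1 + m) ^ m := by positivity
  refine ⟨(hf.PL hM hz hz1).mono ?_, fun β γ h1 h2 ψ => ?_, fun γ hγ ψ => ?_⟩
  · gcongr
    linarith
  · refine (h f M hM hf hf' z hz hz1 β γ (by lia) (by lia) h2 ψ).trans ?_
    have := n1_nonneg ψ
    gcongr
    linarith
  · have e2 : ‖pair (PL z f - f) (Xl γ ψ)‖ ≤ ‖z‖ * (N * (K * M * n1 ψ)) := by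
      refine norm_pair_PL_sub_le hz f _ fun τ hτ0 hτ1 => ?_
      rw [Lap, pair_sum]
      refine (norm_sum_le _ _).trans ((Finset.sum_le_sum fun j _ =>
        h f M hM hf hf' (τ * z) ?_ ?_ [j, j] γ ?_ ?_ hγ ψ).trans_eq ?_)
      · rw [Complex.re_ofReal_mul]; positivity
      · rw [norm_mul, Complex.norm_real, Real.norm_of_nonneg hτ0.le]
        exact mul_le_one₀ hτ1.le (norm_nonneg _) hz1
      · simp
      · simp; lia
      · simp
    refine e2.trans ?_
    have := n1_nonneg ψ
    calc _ = (N * K) * M * ‖z‖ * n1 ψ := by ring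
      _ ≤ _ := by gcongr; linarith

/-! ### Identifying and bounding functions by testing -/

/-- A smooth compactly supported real function as a complex valued Schwartz function. -/
theorem exists_test_eq {g : Space N → ℝ} (hg : ContDiff ℝ ∞ g) (hc : HasCompactSupport g) :
    ∃ ψ : Test N, ∀ x, ψ x = (g x : ℂ) := by
  have hg₁ : HasCompactSupport (Complex.ofRealCLM ∘ g) := hc.comp_left rfl
  have hg₂ : ContDiff ℝ ∞ (Complex.ofRealCLM ∘ g) := by fun_prop
  exact ⟨hg₁.toSchwartzMap hg₂, fun x => rfl⟩

theorem ae_eq_of_test {F G : Space N → ℂ} (hF : LocallyIntegrable F volume)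
    (hG : LocallyIntegrable G volume) (h : ∀ ψ : Test N, ∫ x, ψ x * F x = ∫ x, ψ x * G x) :
    F =ᵐ[volume] G := by
  have : ∀ᵐ x ∂(volume : Measure (Space N)), (F - G) x = 0 := by
    refine ae_eq_zero_of_integral_contDiff_smul_eq_zero (hF.sub hG) fun g hg hc => ?_
    obtain ⟨ψ, hψ⟩ := exists_test_eq hg hc
    have e : ∀ x, g x • (F - G) x = g x • F x - g x • G x := fun x => by
      rw [Pi.sub_apply, smul_sub]
    simp_rw [e]
    rw [integral_sub (hF.integrable_smul_left_of_hasCompactSupport hg.continuous hc)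
      (hG.integrable_smul_left_of_hasCompactSupport hg.continuous hc), sub_eq_zero]
    have := h ψ
    simpa only [hψ, Complex.real_smul] using this
  filter_upwards [this] with x hx
  exact sub_eq_zero.mp hx

/-- Testing against normalized bumps centred at `x` gives averages of `F` bounded by `C`, since each
bump has `L¹` norm `1`. These averages converge to `F x` almost everywhere. -/
theorem ae_norm_le_of_test {F : Space N → ℂ} (hF : LocallyIntegrable F volume) {C : ℝ}
    (h : ∀ ψ : Test N, ‖∫ x, ψ x * F x‖ ≤ C * n1 ψ) : ∀ᵐ x ∂volume, ‖F x‖ ≤ C := by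
  let φ : ℕ → ContDiffBump (0 : Space N) := fun i =>
    ⟨1 / ((i : ℝ) + 1), 2 / ((i : ℝ) + 1), by positivity, by
      rw [div_lt_div_iff_of_pos_right (by positivity)]; norm_num⟩
  have hφ : Tendsto (fun i => (φ i).rOut) atTop (𝓝 0) :=
    tendsto_const_div_atTop_nhds_zero_nat 2 |>.comp (tendsto_add_atTop_nat 1) |>.congr fun i => by
      simp [φ]
  have h'φ : ∀ᶠ i in atTop, (φ i).rOut ≤ 2 * (φ i).rIn :=
    Eventually.of_forall fun i => by simp only [φ]; exact le_of_eq (by ring)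
  filter_upwards [ContDiffBump.ae_convolution_tendsto_right_of_locallyIntegrable hφ h'φ hF] with x hx
  refine le_of_tendsto hx.norm (Eventually.of_forall fun i => ?_)
  have hs : ContDiff ℝ ∞ fun y => (φ i).normed volume (x - y) :=
    ((φ i).contDiff_normed).comp (contDiff_const.sub contDiff_id)
  have hc : HasCompactSupport fun y => (φ i).normed volume (x - y) :=
    (φ i).hasCompactSupport_normed.comp_homeomorph (Homeomorph.subLeft x)
  obtain ⟨ψ, hψ⟩ := exists_test_eq hs hc
  have h1 := h ψ
  have h2 : n1 ψ = 1 := by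
    simp only [n1, hψ, Complex.norm_real]
    rw [← (φ i).integral_normed (μ := (volume : Measure (Space N))),
      ← integral_sub_left_eq_self (fun y => (φ i).normed volume y) volume x]
    refine integral_congr_ae (Eventually.of_forall fun y => ?_)
    exact Real.norm_of_nonneg ((φ i).nonneg_normed _)
  rw [h2, mul_one] at h1
  rw [convolution_eq_swap]
  simpa only [hψ, ContinuousLinearMap.lsmul_apply, Complex.real_smul] using h1

theorem locallyIntegrable_L2 (f : L2 N) : LocallyIntegrable f volume :=
  (Lp.memLp f).locallyIntegrable (by norm_num)

theorem memLp_of_test {F : Space N → ℂ} (hF : LocallyIntegrable F volume) (ℓ : Test N →ₗ[ℂ] ℂ)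
    (hℓ : ∀ ψ, ℓ ψ = ∫ x, ψ x * F x) {C : ℝ} (hC : 0 ≤ C) (h : ∀ ψ, ‖ℓ ψ‖ ≤ C * n2 ψ) :
    MemLp F 2 volume ∧ eLpNorm F 2 volume ≤ ENNReal.ofReal C := by
  obtain ⟨f, hf, hf'⟩ := exists_pair_eq ℓ hC h
  have : f =ᵐ[volume] F := ae_eq_of_test (locallyIntegrable_L2 f) hF fun ψ => by
    rw [← pair_eq, hf', hℓ]
  refine ⟨(memLp_congr_ae this).mp (Lp.memLp f), ?_⟩
  rw [← eLpNorm_congr_ae this, ← Lp.enorm_def, ← ofReal_norm]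
  exact ENNReal.ofReal_le_ofReal hf

/-! ### Monomial weights -/

/-- The monomial `x^γ`. -/
def mono (γ : List (Fin N)) (x : Space N) : ℂ := (γ.map fun i => coord i x).prod

theorem Xl_apply (γ : List (Fin N)) (ψ : Test N) (x : Space N) : Xl γ ψ x = mono γ x * ψ x := by
  induction γ with
  | nil => simp [mono]
  | cons i γ ih => rw [Xl_cons, Xop_apply, ih]; simp [mono, mul_assoc]

theorem continuous_mono (γ : List (Fin N)) : Continuous (mono γ) := by
  induction γ with
  | nil => exact continuous_const (y := (1 : ℂ))
  | cons i γ ih =>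
    have : mono (i :: γ) = fun x => coord i x * mono γ x := by funext x; simp [mono]
    rw [this]
    exact (hasTemperateGrowth_coord i).1.continuous.mul ih

theorem norm_mono_le (γ : List (Fin N)) (x : Space N) : ‖mono γ x‖ ≤ bracket x ^ γ.length := by
  induction γ with
  | nil => simp [mono]
  | cons i γ ih =>
    have : mono (i :: γ) x = coord i x * mono γ x := by simp [mono]
    rw [this, norm_mul, List.length_cons, pow_succ']
    have := (abs_coord_le i x).trans (norm_le_bracket x)
    have := (bracket_pos x).le
    gcongr

theorem norm_mono_replicate (w : ℕ) (j : Fin N) (x : Space N) :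
    ‖mono (List.replicate w j) x‖ = ‖coord j x‖ ^ w := by
  simp [mono]

theorem bracket_le_sum (x : Space N) : bracket x ≤ 1 + ∑ j, ‖coord j x‖ := by
  have h0 : 0 ≤ ∑ j, ‖coord j x‖ := Finset.sum_nonneg fun _ _ => norm_nonneg _
  refine Real.sqrt_le_iff.mpr ⟨by linarith, ?_⟩
  have : ‖x‖ ^ 2 ≤ (∑ j, ‖coord j x‖) ^ 2 := by
    rw [EuclideanSpace.real_norm_sq_eq]
    refine le_trans (le_of_eq ?_) (Finset.sum_sq_le_sq_sum_of_nonneg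
      (s := Finset.univ) (f := fun j => ‖coord j x‖) fun _ _ => norm_nonneg _)
    simp [coord]
  nlinarith

/-- Pure powers of single coordinates suffice: `⟨x⟩` is at most `1 + N` times the larger of `1` and
the largest `|x_j|`. Bounds on monomials are thereby converted to bounds with the weight `⟨x⟩^w`. -/
theorem bracket_pow_le (w : ℕ) (x : Space N) :
    bracket x ^ w ≤ (1 + N) ^ w * (1 + ∑ j, ‖mono (List.replicate w j) x‖) := by
  simp_rw [norm_mono_replicate]
  have hsum : 0 ≤ ∑ j, ‖coord j x‖ ^ w := Finset.sum_nonneg fun _ _ => by positivity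
  obtain ⟨t, ht0, ht1, ht2⟩ : ∃ t : ℝ, 0 ≤ t ∧ bracket x ≤ (1 + N) * t ∧ t ^ w ≤ 1 + ∑ j, ‖coord j x‖ ^ w := by
    by_cases hall : ∀ j, ‖coord j x‖ ≤ 1
    · refine ⟨1, zero_le_one, (bracket_le_sum x).trans ?_, by simpa using hsum⟩
      have := Finset.sum_le_sum (s := Finset.univ) fun j _ => hall j
      simp at this
      linarith
    · push Not at hall
      obtain ⟨j₀, hj₀⟩ := hall
      have : Nonempty (Fin N) := ⟨j₀⟩
      obtain ⟨j, hj⟩ := Finite.exists_max fun j => ‖coord j x‖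
      refine ⟨‖coord j x‖, norm_nonneg _, (bracket_le_sum x).trans ?_, ?_⟩
      · have h1 := Finset.sum_le_sum (s := Finset.univ) fun i _ => hj i
        simp only [Finset.sum_const, Finset.card_univ, Fintype.card_fin, nsmul_eq_mul] at h1
        have h2 := hj j₀
        linarith
      · have := Finset.single_le_sum (s := Finset.univ) (f := fun j => ‖coord j x‖ ^ w)
          (fun _ _ => by positivity) (Finset.mem_univ j)
        linarith
  calc bracket x ^ w ≤ ((1 + N) * t) ^ w := pow_le_pow_left₀ (bracket_pos x).le ht1 w
    _ = (1 + N) ^ w * t ^ w := mul_pow _ _ _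
    _ ≤ _ := by gcongr

theorem pair_Xl (f : L2 N) (γ : List (Fin N)) (ψ : Test N) :
    pair f (Xl γ ψ) = ∫ x, ψ x * (mono γ x * f x) := by
  rw [pair_eq]
  refine integral_congr_ae (Eventually.of_forall fun x => ?_)
  simp only [Xl_apply]
  ring

theorem ae_bracket_le {m : ℕ} {C : ℝ} {f : L2 N}
    (h : ∀ γ : List (Fin N), γ.length ≤ m → ∀ ψ, ‖pair f (Xl γ ψ)‖ ≤ C * n1 ψ) :
    ∀ᵐ x ∂volume, bracket x ^ m * ‖f x‖ ≤ (1 + N) ^ (m + 1) * C := by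
  have key : ∀ γ : List (Fin N), γ.length ≤ m → ∀ᵐ x ∂volume, ‖mono γ x * f x‖ ≤ C := fun γ hγ =>
    ae_norm_le_of_test ((locallyIntegrable_L2 f).continuous_mul (continuous_mono γ))
      fun ψ => by rw [← pair_Xl]; exact h γ hγ ψ
  have k0 := key [] (by simp)
  have k1 : ∀ᵐ x ∂volume, ∀ j : Fin N, ‖mono (List.replicate m j) x * f x‖ ≤ C :=
    ae_all_iff.mpr fun j => key _ (by simp)
  filter_upwards [k0, k1] with x h0 h1
  have h0' : ‖f x‖ ≤ C := by simpa [mono] using h0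
  calc bracket x ^ m * ‖f x‖
      ≤ ((1 + N) ^ m * (1 + ∑ j, ‖mono (List.replicate m j) x‖)) * ‖f x‖ := by
        gcongr; exact bracket_pow_le m x
    _ = (1 + N) ^ m * (‖f x‖ + ∑ j, ‖mono (List.replicate m j) x * f x‖) := by
        simp_rw [norm_mul]; rw [← Finset.sum_mul]; ring
    _ ≤ (1 + N) ^ m * (C + ∑ _j : Fin N, C) := by gcongr with j; exact h1 j
    _ = _ := by simp; ring

/-! ### Partial derivatives of functions and integration by parts -/

/-- The iterated partial derivative `∂_{i 0} ∂_{i 1} ⋯ F` along a list of directions. -/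
def pd : List (Fin N) → (Space N → ℂ) → Space N → ℂ
  | [], F => F
  | i :: β, F => fun x => fderiv ℝ (pd β F) x (bvec i)

theorem pd_eq {F : Space N → ℂ} (hF : ContDiff ℝ ∞ F) (β : List (Fin N)) (x : Space N) :
    pd β F x = iteratedFDeriv ℝ β.length F x fun r => bvec (β.get r) := by
  induction β generalizing x with
  | nil => simp [pd]
  | cons i β ih =>
    have h : pd β F = fun x => iteratedFDeriv ℝ β.length F x fun r => bvec (β.get r) := funext ih
    have hd : DifferentiableAt ℝ (iteratedFDeriv ℝ β.length F) x :=
      (hF.differentiable_iteratedFDeriv (by exact_mod_cast WithTop.coe_lt_top _)) x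
    simp only [pd]
    rw [h, fderiv_continuousMultilinear_apply_const_apply hd]
    rfl

theorem contDiff_pd {F : Space N → ℂ} (hF : ContDiff ℝ ∞ F) (β : List (Fin N)) :
    ContDiff ℝ ∞ (pd β F) := by
  induction β with
  | nil => exact hF
  | cons i β ih => exact (ih.fderiv_right (m := ∞) (by simp)).clm_apply contDiff_const

theorem norm_pd_le {F : Space N → ℂ} (hF : ContDiff ℝ ∞ F) (β : List (Fin N)) (x : Space N) :
    ‖pd β F x‖ ≤ ‖iteratedFDeriv ℝ β.length F x‖ := by
  rw [pd_eq hF]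
  refine (ContinuousMultilinearMap.le_opNorm _ _).trans_eq ?_
  simp

theorem norm_iteratedFDeriv_le_sum {F : Space N → ℂ} (hF : ContDiff ℝ ∞ F) (j : ℕ) (x : Space N) :
    ‖iteratedFDeriv ℝ j F x‖ ≤ ∑ r : Fin j → Fin N, ‖pd (List.ofFn r) F x‖ := by
  have hpd : ∀ r : Fin j → Fin N, pd (List.ofFn r) F x = iteratedFDeriv ℝ j F x fun l => bvec (r l) := by
    intro r
    rw [pd_eq hF]
    have : ∀ (l : ℕ) (h : l = j), (iteratedFDeriv ℝ l F x fun s => bvec (r (Fin.cast h s))) =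
      iteratedFDeriv ℝ j F x fun l => bvec (r l) := by
      rintro l rfl; rfl
    rw [← this _ (List.length_ofFn (f := r))]
    congr 1
    funext s
    rw [List.get_ofFn]
  refine ContinuousMultilinearMap.opNorm_le_bound (Finset.sum_nonneg fun _ _ => norm_nonneg _) fun v => ?_
  have hv : v = fun l => ∑ i : Fin N, (v l i) • bvec i := by
    funext l
    have := (EuclideanSpace.basisFun (Fin N) ℝ).sum_repr (v l)
    simpa using this.symm
  conv_lhs => rw [hv]
  rw [ContinuousMultilinearMap.map_sum, Finset.sum_mul]
  refine (norm_sum_le _ _).trans (Finset.sum_le_sum fun r _ => ?_)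
  rw [ContinuousMultilinearMap.map_smul_univ, norm_smul, hpd, mul_comm]
  gcongr
  rw [norm_prod]
  refine Finset.prod_le_prod (fun _ _ => norm_nonneg _) fun l _ => ?_
  exact PiLp.norm_apply_le (v l) (r l)

/-- Transposition reverses the order of the derivatives. Keeping track of `β.reverse` makes the
symmetry of mixed derivatives unnecessary. The bounds on the derivatives of `F` make every product
with a Schwartz function integrable. -/
theorem integral_Dl_eq {F : Space N → ℂ} (hF : ContDiff ℝ ∞ F) (J : ℕ)
    (hB : ∀ j ≤ J, ∃ B, ∀ x, ‖iteratedFDeriv ℝ j F x‖ ≤ B) (β : List (Fin N)) (hβ : β.length ≤ J)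
    (ψ : Test N) :
    ∫ x, (Dl β.reverse ψ) x * F x = (-1) ^ β.length * ∫ x, ψ x * pd β F x := by
  have hint : ∀ β : List (Fin N), β.length ≤ J → ∀ ψ : Test N, Integrable (fun x => pd β F x * ψ x) volume := by
    intro β hβ ψ
    obtain ⟨B, hB⟩ := hB _ hβ
    exact ψ.integrable.bdd_mul (c := B) (contDiff_pd hF β).continuous.aestronglyMeasurable
      (Eventually.of_forall fun x => (norm_pd_le hF β x).trans (hB x))
  induction β generalizing ψ with
  | nil => simp [pd]
  | cons i β ih =>
    rw [List.reverse_cons, Dl_append, ih (by simp at hβ; lia)]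
    have := integral_mul_fderiv_eq_neg_fderiv_mul_of_integrable (μ := (volume : Measure (Space N)))
      (f := pd β F) (g := ψ) (v := bvec i) (hint (i :: β) hβ ψ)
      (by simpa only [Dop_apply] using hint β (by simp at hβ; lia) (Dop i ψ))
      (hint β (by simp at hβ; lia) ψ)
      (fun x _ => (contDiff_pd hF β).differentiable (by simp) x)
      (fun x _ => ψ.differentiableAt)
    simp only [Dl_cons, Dl_nil, Dop_apply, pd, List.length_cons, pow_succ]
    simp only [mul_comm (fderiv ℝ ψ _ _), mul_comm (ψ _), this]
    ring

/-! ### The heat regularization -/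

theorem integral_fourier_mul_eq_of_integrable {F G : Space N → ℂ} (hF : Integrable F volume)
    (hG : Integrable G volume) : ∫ ξ, 𝓕 F ξ * G ξ = ∫ x, F x * 𝓕 G x := by
  simpa using! VectorFourier.integral_bilin_fourierIntegral_eq_flip (ContinuousLinearMap.mul ℂ ℂ)
    (L := innerₗ (Space N)) Real.continuous_fourierChar continuous_inner hF hG

/-- From `y^q / q! ≤ e^y` at `y = c(1 + ‖ξ‖²)`, where `e^{-c‖ξ‖²}` is the modulus of the symbol. -/
theorem bracket_pow_mul_symb_le (q : ℕ) {ε : ℝ} (hε : 0 < ε) : ∃ C : ℝ, 0 ≤ C ∧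
    ∀ ξ : Space N, bracket ξ ^ (2 * q) * ‖symb ε ξ‖ ≤ C := by
  set c : ℝ := 4 * Real.pi ^ 2 * ε with hc
  have hc0 : 0 < c := by have := Real.pi_pos; positivity
  refine ⟨q.factorial * c⁻¹ ^ q * Real.exp c, by positivity, fun ξ => ?_⟩
  rw [norm_symb, pow_mul, bracket_sq, Complex.ofReal_re, max_eq_left hε.le, ← hc]
  have h1 := Real.pow_div_factorial_le_exp (c * (1 + ‖ξ‖ ^ 2)) (by positivity) q
  rw [div_le_iff₀ (by positivity), mul_pow] at h1
  have h2 : Real.exp (c * (1 + ‖ξ‖ ^ 2)) * Real.exp (-(c * ‖ξ‖ ^ 2)) = Real.exp c := by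
    rw [← Real.exp_add]; congr 1; ring
  have h3 : (1 + ‖ξ‖ ^ 2) ^ q ≤ q.factorial * c⁻¹ ^ q * Real.exp (c * (1 + ‖ξ‖ ^ 2)) := by
    have : (1 + ‖ξ‖ ^ 2) ^ q = c⁻¹ ^ q * (c ^ q * (1 + ‖ξ‖ ^ 2) ^ q) := by
      rw [← mul_assoc, ← mul_pow, inv_mul_cancel₀ hc0.ne', one_pow, one_mul]
    rw [this]
    calc _ ≤ c⁻¹ ^ q * (Real.exp (c * (1 + ‖ξ‖ ^ 2)) * q.factorial) := by gcongr
      _ = _ := by ring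
  calc _ ≤ q.factorial * c⁻¹ ^ q * Real.exp (c * (1 + ‖ξ‖ ^ 2)) * Real.exp (-(c * ‖ξ‖ ^ 2)) := by gcongr
    _ = _ := by rw [mul_assoc, h2]

/-- The Gaussian factor gives the Fourier transform of `PL ε f` integrable moments of every order,
hence a representative whose derivatives are all bounded. The variable is reflected in `H` in order
to write the inverse transform as a forward one. -/
theorem exists_smooth_rep {ε : ℝ} (hε : 0 < ε) (f : L2 N) : ∃ F : Space N → ℂ, ContDiff ℝ ∞ F ∧
    PL ε f =ᵐ[volume] F ∧ ∀ j, ∃ B, ∀ x, ‖iteratedFDeriv ℝ j F x‖ ≤ B := by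
  set Fh : L2 N := 𝓕 f with hFh
  have hneg : MemLp (fun ξ => Fh (-ξ)) 2 volume :=
    (Lp.memLp Fh).comp_measurePreserving (Measure.measurePreserving_neg volume)
  set H : Space N → ℂ := fun ξ => symb ε ξ * Fh (-ξ) with hH
  have hHm : AEStronglyMeasurable H volume :=
    (hasTemperateGrowth_symb (N := N) _).1.continuous.aestronglyMeasurable.mul hneg.1
  have hint : ∀ p : ℕ, Integrable (fun ξ => ‖ξ‖ ^ p * ‖H ξ‖) volume := by
    intro p
    have hb := memLp_bracket_rpow (N := N) (r := N + 1) (by linarith [(Nat.cast_nonneg N : (0:ℝ) ≤ N)])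
    obtain ⟨C', hC', hCb'⟩ := bracket_pow_mul_symb_le (N := N) (p + N + 1) hε
    have hi : Integrable (fun ξ => bracket ξ ^ (-((N : ℝ) + 1)) * ‖Fh (-ξ)‖) volume :=
      hb.integrable_mul hneg.norm
    refine (hi.const_mul C').mono' ((by fun_prop : Continuous fun ξ : Space N => ‖ξ‖ ^ p).aestronglyMeasurable.mul hHm.norm) ?_
    refine Eventually.of_forall fun ξ => ?_
    rw [Real.norm_of_nonneg (by positivity), hH]
    simp only [norm_mul]
    have hb0 := bracket_pos ξ
    have hb1 := one_le_bracket ξ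
    have h1 : ‖ξ‖ ^ p ≤ bracket ξ ^ p := pow_le_pow_left₀ (norm_nonneg _) (norm_le_bracket ξ) _
    have h2 : bracket ξ ^ p * ‖symb ε ξ‖ ≤ C' * bracket ξ ^ (-((N : ℝ) + 1)) := by
      have h3 : bracket ξ ^ p * bracket ξ ^ (N + 1) ≤ bracket ξ ^ (2 * (p + N + 1)) := by
        rw [← pow_add]
        exact pow_le_pow_right₀ hb1 (by lia)
      have h4 : bracket ξ ^ (-((N : ℝ) + 1)) = (bracket ξ ^ (N + 1))⁻¹ := by
        rw [Real.rpow_neg hb0.le]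
        norm_cast
      rw [h4, ← div_eq_mul_inv, le_div_iff₀ (by positivity)]
      calc _ = bracket ξ ^ p * bracket ξ ^ (N + 1) * ‖symb ε ξ‖ := by ring
        _ ≤ bracket ξ ^ (2 * (p + N + 1)) * ‖symb ε ξ‖ := by gcongr
        _ ≤ C' := hCb' ξ
    calc ‖ξ‖ ^ p * (‖symb ε ξ‖ * ‖Fh (-ξ)‖) ≤ bracket ξ ^ p * (‖symb ε ξ‖ * ‖Fh (-ξ)‖) := by gcongr
      _ = (bracket ξ ^ p * ‖symb ε ξ‖) * ‖Fh (-ξ)‖ := by ring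
      _ ≤ (C' * bracket ξ ^ (-((N : ℝ) + 1))) * ‖Fh (-ξ)‖ := by gcongr
      _ = _ := by ring
  have hH1 : Integrable H volume := by
    have := hint 0
    simp only [pow_zero, one_mul] at this
    exact (integrable_norm_iff hHm).mp this
  have hsm : ContDiff ℝ ∞ (𝓕 H) := Real.contDiff_fourier fun p _ => hint p
  refine ⟨𝓕 H, hsm, ?_, fun j => ?_⟩
  · refine ae_eq_of_test (locallyIntegrable_L2 _) hsm.continuous.locallyIntegrable fun ψ => ?_
    rw [← pair_eq, pair_PL_eq_integral, ← integral_neg_eq_self]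
    have h2 := integral_fourier_mul_eq_of_integrable hH1 ψ.integrable
    have h3 : ∫ x, ψ x * 𝓕 H x = ∫ x, H x * (𝓕 ψ) x := by
      rw [SchwartzMap.fourier_coe, ← h2]
      exact integral_congr_ae (Eventually.of_forall fun x => mul_comm _ _)
    rw [h3]
    refine integral_congr_ae (Eventually.of_forall fun ξ => ?_)
    simp only [hH]
    have h4 : (𝓕⁻ ψ) (-ξ) = (𝓕 ψ) ξ := by
      rw [SchwartzMap.fourierInv_coe, SchwartzMap.fourier_coe, Real.fourierInv_eq_fourier_neg, neg_neg]
    have h5 : symb ε (-ξ) = symb ε ξ := by simp [symb]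
    rw [h4, h5, mul_assoc]
  · rw [Real.iteratedFDeriv_fourier (N := ⊤) (fun p _ => hint p) hHm (by exact_mod_cast le_top)]
    exact ⟨_, fun x => VectorFourier.norm_fourierIntegral_le_integral_norm _ _ _ _ _⟩

/-- The weight exponent of derivatives of order `j ≥ 2n + 1`. -/
def wt (k n m j : ℕ) : ℕ := min m (2 * n + 2 + k + m - j)

/-- The smooth function `F` satisfies the weighted pointwise and `L²` bounds. -/
structure SmoothBound (k n m : ℕ) (M : ℝ) (F : Space N → ℂ) : Prop where
  smooth : ContDiff ℝ ∞ F
  bounded : ∀ j ≤ 2 * n + 2 + k + m, ∃ B, ∀ x, ‖iteratedFDeriv ℝ j F x‖ ≤ B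
  low : ∀ j ≤ 2 * n, ∀ x, bracket x ^ m * ‖iteratedFDeriv ℝ j F x‖ ≤ M
  high_memLp : ∀ j, 2 * n + 1 ≤ j → j ≤ 2 * n + 2 + k + m →
    MemLp (fun x => bracket x ^ wt k n m j * ‖iteratedFDeriv ℝ j F x‖) 2 volume
  high : ∀ j, 2 * n + 1 ≤ j → j ≤ 2 * n + 2 + k + m →
    eLpNorm (fun x => bracket x ^ wt k n m j * ‖iteratedFDeriv ℝ j F x‖) 2 volume ≤ ENNReal.ofReal M

/-- The bridge between dual and classical bounds: for a function with a smooth representative, the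
dual quantity is, up to sign, the integral of `ψ` against `x^γ D^β F`. -/
theorem integral_mono_pd {F : Space N → ℂ} {f : L2 N} (hF : ContDiff ℝ ∞ F) (hfF : f =ᵐ[volume] F)
    (β γ : List (Fin N)) (hb : ∀ j ≤ β.length, ∃ B, ∀ x, ‖iteratedFDeriv ℝ j F x‖ ≤ B) (ψ : Test N) :
    pair f (Dl β.reverse (Xl γ ψ)) = (-1) ^ β.length * ∫ x, ψ x * (mono γ x * pd β F x) := by
  rw [pair_eq]
  have : ∫ x, (Dl β.reverse (Xl γ ψ)) x * f x = ∫ x, (Dl β.reverse (Xl γ ψ)) x * F x :=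
    integral_congr_ae (by filter_upwards [hfF] with x hx; rw [hx])
  rw [this, integral_Dl_eq hF β.length hb β le_rfl]
  congr 1
  refine integral_congr_ae (Eventually.of_forall fun x => ?_)
  simp only [Xl_apply]
  ring

theorem le_of_ae_le_of_continuous {F G : Space N → ℝ} (hF : Continuous F) (hG : Continuous G)
    (h : ∀ᵐ x, F x ≤ G x) (x : Space N) : F x ≤ G x := by
  have hcl : IsClosed {x | F x ≤ G x} := isClosed_le hF hG
  have := hcl.closure_eq ▸ (Measure.dense_of_ae h).closure_eq
  have hx : x ∈ {x | F x ≤ G x} := by rw [this]; trivial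
  exact hx

/-- Duality recovers the norms of `x^γ D^β F`. Almost everywhere bounds hold everywhere by
continuity. The constant collects the passage from monomials to `⟨x⟩` and the sum over the `N^j`
partial derivatives of order `j`. -/
theorem SmoothBound.of_bound {k n m : ℕ} {M : ℝ} (hM : 0 ≤ M) {F : Space N → ℂ} {f : L2 N}
    (hF : ContDiff ℝ ∞ F) (hfF : f =ᵐ[volume] F)
    (hb : ∀ j, ∃ B, ∀ x, ‖iteratedFDeriv ℝ j F x‖ ≤ B)
    (h2 : BoundTwo k n m M f) (hi : BoundInf n m M f) :
    SmoothBound k n m ((1 + N) ^ (m + 1) * (N + 1) ^ (2 * n + 2 + k + m) * M) F := by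
  have hlow : ∀ β : List (Fin N), β.length ≤ 2 * n → ∀ x, bracket x ^ m * ‖pd β F x‖ ≤ (1 + N) ^ (m + 1) * M := by
    intro β hβ
    have key : ∀ γ : List (Fin N), γ.length ≤ m → ∀ x, ‖mono γ x * pd β F x‖ ≤ M := by
      intro γ hγ
      have hc : Continuous fun x => mono γ x * pd β F x :=
        (continuous_mono γ).mul (contDiff_pd hF β).continuous
      have hae := ae_norm_le_of_test hc.locallyIntegrable (C := M) fun ψ => by
        have h1 := hi β.reverse γ (by simpa using hβ) hγ ψ
        rw [integral_mono_pd hF hfF _ _ fun j _ => hb j, norm_mul, norm_pow, norm_neg, norm_one, one_pow, one_mul] at h1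
        exact h1
      exact le_of_ae_le_of_continuous hc.norm continuous_const hae
    intro x
    have k0 : ‖pd β F x‖ ≤ M := by simpa [mono] using key [] (by simp) x
    calc bracket x ^ m * ‖pd β F x‖
        ≤ ((1 + N) ^ m * (1 + ∑ j, ‖mono (List.replicate m j) x‖)) * ‖pd β F x‖ := by
          gcongr; exact bracket_pow_le m x
      _ = (1 + N) ^ m * (‖pd β F x‖ + ∑ j, ‖mono (List.replicate m j) x * pd β F x‖) := by
          simp_rw [norm_mul]; rw [← Finset.sum_mul]; ring
      _ ≤ (1 + N) ^ m * (M + ∑ _j : Fin N, M) := by gcongr with j; exact key _ (by simp) x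
      _ = _ := by simp; ring
  have hhigh : ∀ β : List (Fin N), 2 * n + 1 ≤ β.length → β.length ≤ 2 * n + 2 + k + m →
      eLpNorm (fun x => bracket x ^ wt k n m β.length * ‖pd β F x‖) 2 volume ≤ ENNReal.ofReal ((1 + N) ^ (m + 1) * M) := by
    intro β hβ1 hβ2
    set w := wt k n m β.length with hw
    have hwm : w ≤ m := min_le_left _ _
    have hwJ : β.length + w ≤ 2 * n + 2 + k + m := by
      have : w ≤ 2 * n + 2 + k + m - β.length := min_le_right _ _
      lia
    have hc : ∀ γ : List (Fin N), Continuous fun x => mono γ x * pd β F x := fun γ =>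
      (continuous_mono γ).mul (contDiff_pd hF β).continuous
    have key : ∀ γ : List (Fin N), γ.length ≤ w →
        eLpNorm (fun x => mono γ x * pd β F x) 2 volume ≤ ENNReal.ofReal M := by
      intro γ hγ
      refine (memLp_of_test (hc γ).locallyIntegrable ((-1 : ℂ) ^ β.length • functional f β.reverse γ)
        (fun ψ => ?_) hM fun ψ => ?_).2
      · have : functional f β.reverse γ ψ = pair f (Dl β.reverse (Xl γ ψ)) := rfl
        rw [LinearMap.smul_apply, this, integral_mono_pd hF hfF _ _ fun j _ => hb j, smul_eq_mul, ← mul_assoc, ← mul_pow]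
        simp
      · rw [LinearMap.smul_apply, norm_smul, norm_pow, norm_neg, norm_one, one_pow, one_mul]
        exact h2 β.reverse γ (by simpa using hβ1) (by lia) (by simp; lia) ψ
    have hpt : ∀ x, ‖bracket x ^ w * ‖pd β F x‖‖ ≤ ((1 + N) ^ w) * ‖‖pd β F x‖ + ∑ j, ‖mono (List.replicate w j) x * pd β F x‖‖ := by
      intro x
      have hb0 := bracket_pos x
      rw [Real.norm_of_nonneg (by positivity), Real.norm_of_nonneg (by positivity)]
      calc bracket x ^ w * ‖pd β F x‖
          ≤ ((1 + N) ^ w * (1 + ∑ j, ‖mono (List.replicate w j) x‖)) * ‖pd β F x‖ := by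
            gcongr; exact bracket_pow_le w x
        _ = _ := by
            simp_rw [norm_mul]; rw [← Finset.sum_mul]; ring
    refine (eLpNorm_le_mul_eLpNorm_of_ae_le_mul (Eventually.of_forall hpt) 2).trans ?_
    have hs : eLpNorm (fun x => ‖pd β F x‖ + ∑ j, ‖mono (List.replicate w j) x * pd β F x‖) 2 volume
        ≤ ENNReal.ofReal M + ∑ _j : Fin N, ENNReal.ofReal M := by
      refine (eLpNorm_add_le (contDiff_pd hF β).continuous.norm.aestronglyMeasurable
        (continuous_finsetSum _ fun j _ => (hc _).norm).aestronglyMeasurable (by norm_num)).trans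
        (add_le_add ?_ ?_)
      · have := key [] (by simp)
        rw [eLpNorm_norm]
        simpa [mono] using this
      · have := eLpNorm_sum_le (μ := (volume : Measure (Space N))) (p := 2) (s := Finset.univ)
          (f := fun (j : Fin N) x => ‖mono (List.replicate w j) x * pd β F x‖)
          (fun j _ => (hc _).norm.aestronglyMeasurable) (by norm_num)
        have e : (∑ j : Fin N, fun x => ‖mono (List.replicate w j) x * pd β F x‖) =
          fun x => ∑ j : Fin N, ‖mono (List.replicate w j) x * pd β F x‖ := by
          funext x; simp
        rw [e] at this
        refine this.trans (Finset.sum_le_sum fun j _ => ?_)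
        rw [eLpNorm_norm]
        exact key _ (by simp)
    have hsum : ENNReal.ofReal M + ∑ _j : Fin N, ENNReal.ofReal M = ENNReal.ofReal ((1 + N) * M) := by
      rw [← ENNReal.ofReal_sum_of_nonneg (fun _ _ => hM), ← ENNReal.ofReal_add hM (by positivity)]
      congr 1
      simp; ring
    rw [hsum] at hs
    refine (mul_le_mul_right hs _).trans ?_
    rw [← ENNReal.ofReal_mul (by positivity)]
    refine ENNReal.ofReal_le_ofReal ?_
    have : ((1 : ℝ) + N) ^ w ≤ (1 + N) ^ m := pow_le_pow_right₀ (by simp) hwm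
    calc ((1 : ℝ) + N) ^ w * ((1 + N) * M) ≤ (1 + N) ^ m * ((1 + N) * M) := by gcongr
      _ = _ := by ring
  have hN : (1 : ℝ) ≤ N + 1 := by simp
  have hcard : ∀ j, Fintype.card (Fin j → Fin N) = N ^ j := fun j => by simp
  have hpow : ∀ j ≤ 2 * n + 2 + k + m, ((N ^ j : ℕ) : ℝ) ≤ (N + 1) ^ (2 * n + 2 + k + m) := by
    intro j hj
    push_cast
    exact (pow_le_pow_left₀ (by positivity) (by linarith) j).trans (pow_le_pow_right₀ hN hj)
  have hhigh' : ∀ j, 2 * n + 1 ≤ j → j ≤ 2 * n + 2 + k + m →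
      eLpNorm (fun x => bracket x ^ wt k n m j * ‖iteratedFDeriv ℝ j F x‖) 2 volume ≤
        ENNReal.ofReal ((1 + N) ^ (m + 1) * (N + 1) ^ (2 * n + 2 + k + m) * M) := by
    intro j hj1 hj2
    have e1 : eLpNorm (fun x => bracket x ^ wt k n m j * ‖iteratedFDeriv ℝ j F x‖) 2 volume ≤
        eLpNorm (∑ r : Fin j → Fin N, fun x => bracket x ^ wt k n m j * ‖pd (List.ofFn r) F x‖) 2 volume := by
      refine eLpNorm_mono fun x => ?_
      have hb0 := bracket_pos x
      rw [Real.norm_of_nonneg (by positivity), Finset.sum_apply, ← Finset.mul_sum,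
        Real.norm_of_nonneg (by positivity)]
      gcongr
      exact norm_iteratedFDeriv_le_sum hF j x
    refine e1.trans ((eLpNorm_sum_le (fun r _ => Continuous.aestronglyMeasurable ?_) (by norm_num)).trans ?_)
    · have := (contDiff_pd hF (List.ofFn r)).continuous
      fun_prop
    · refine (Finset.sum_le_sum (g := fun _ => ENNReal.ofReal ((1 + N) ^ (m + 1) * M)) fun r _ => ?_).trans ?_
      · have := hhigh (List.ofFn r) (by simpa using hj1) (by simpa using hj2)
        rwa [List.length_ofFn] at this
      · rw [← ENNReal.ofReal_sum_of_nonneg (fun _ _ => by positivity)]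
        refine ENNReal.ofReal_le_ofReal ?_
        rw [Finset.sum_const, Finset.card_univ, hcard, nsmul_eq_mul]
        calc _ ≤ (N + 1 : ℝ) ^ (2 * n + 2 + k + m) * ((1 + N) ^ (m + 1) * M) := by gcongr; exact hpow j hj2
          _ = _ := by ring
  refine ⟨hF, fun j _ => hb j, fun j hj x => ?_, fun j hj1 hj2 => ⟨?_, (hhigh' j hj1 hj2).trans_lt ENNReal.ofReal_lt_top⟩, hhigh'⟩
  · have hb0 := bracket_pos x
    calc bracket x ^ m * ‖iteratedFDeriv ℝ j F x‖
        ≤ bracket x ^ m * ∑ r : Fin j → Fin N, ‖pd (List.ofFn r) F x‖ := by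
          gcongr; exact norm_iteratedFDeriv_le_sum hF j x
      _ = ∑ r : Fin j → Fin N, bracket x ^ m * ‖pd (List.ofFn r) F x‖ := Finset.mul_sum _ _ _
      _ ≤ ∑ _r : Fin j → Fin N, (1 + N) ^ (m + 1) * M := by
          refine Finset.sum_le_sum fun r _ => hlow _ (by simpa using hj) x
      _ = ((N ^ j : ℕ) : ℝ) * ((1 + N) ^ (m + 1) * M) := by
          rw [Finset.sum_const, Finset.card_univ, hcard, nsmul_eq_mul]
      _ ≤ (N + 1 : ℝ) ^ (2 * n + 2 + k + m) * ((1 + N) ^ (m + 1) * M) := by gcongr; exact hpow j (by lia)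
      _ = _ := by ring
  · have := (hF.continuous_iteratedFDeriv (m := j) (by exact_mod_cast le_top))
    exact (by fun_prop : Continuous fun x => bracket x ^ wt k n m j * ‖iteratedFDeriv ℝ j F x‖).aestronglyMeasurable

/-! ### The nonlinearity of smooth functions -/

/-- The map `z ↦ |z|^α z`. -/
def nl (α : ℝ) (z : ℂ) : ℂ := ((‖z‖ ^ α : ℝ) : ℂ) * z

theorem norm_nl (α : ℝ) (z : ℂ) : ‖nl α z‖ = ‖z‖ ^ α * ‖z‖ := by
  rw [nl, norm_mul, Complex.norm_real, Real.norm_of_nonneg (by positivity)]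

theorem contDiffOn_nl (α : ℝ) : ContDiffOn ℝ ∞ (nl α) {0}ᶜ := by
  unfold nl
  refine ContDiffOn.mul (Complex.ofRealCLM.contDiff.comp_contDiffOn ?_) contDiffOn_id
  exact (contDiffOn_id.norm ℝ fun x hx => hx).rpow_const_of_ne fun x hx => norm_ne_zero_iff.mpr hx

theorem nl_smul (α : ℝ) {r : ℝ} (hr : 0 < r) (z : ℂ) : nl α (r • z) = (r ^ α * r) • nl α z := by
  simp only [nl, Complex.real_smul, norm_mul, Complex.norm_real, Real.norm_of_nonneg hr.le]
  rw [Real.mul_rpow hr.le (norm_nonneg _)]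
  push_cast
  ring

theorem norm_iteratedFDerivWithin_nl_smul (α : ℝ) {r : ℝ} (hr : 0 < r) {z : ℂ} (hz : z ≠ 0) (l : ℕ) :
    r ^ l * ‖iteratedFDerivWithin ℝ l (nl α) {0}ᶜ (r • z)‖ =
      r ^ α * r * ‖iteratedFDerivWithin ℝ l (nl α) {0}ᶜ z‖ := by
  have hu : UniqueDiffOn ℝ ({0}ᶜ : Set ℂ) := isOpen_compl_singleton.uniqueDiffOn
  let g : ℂ ≃L[ℝ] ℂ := ContinuousLinearEquiv.smulLeft (Units.mk0 r hr.ne')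
  have hg : ∀ w : ℂ, g w = r • w := fun w => rfl
  have hpre : (g ⁻¹' ({0}ᶜ : Set ℂ)) = {0}ᶜ := by
    ext w
    simp [hg, hr.ne']
  have h1 := g.iteratedFDerivWithin_comp_right (nl α) hu (x := z) (by simpa [hg, hr.ne'] using hz) l
  rw [hpre] at h1
  have h2 : nl α ∘ g = (r ^ α * r) • nl α := by
    funext w
    rw [Function.comp_apply, hg, nl_smul α hr, Pi.smul_apply]
  have h3 : iteratedFDerivWithin ℝ l ((r ^ α * r) • nl α) {0}ᶜ z =
      (r ^ α * r) • iteratedFDerivWithin ℝ l (nl α) {0}ᶜ z :=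
    iteratedFDerivWithin_const_smul_apply (((contDiffOn_nl α).of_le (by exact_mod_cast le_top)) z hz) hu hz
  have h4 : ((iteratedFDerivWithin ℝ l (nl α) {0}ᶜ (g z)).compContinuousLinearMap fun _ => (g : ℂ →L[ℝ] ℂ)) =
      r ^ l • iteratedFDerivWithin ℝ l (nl α) {0}ᶜ (r • z) := by
    ext v
    have := (iteratedFDerivWithin ℝ l (nl α) {0}ᶜ (r • z)).map_smul_univ (fun _ => r) v
    simpa [hg] using this
  rw [h2, h3, h4] at h1
  have h5 := congrArg norm h1
  rw [norm_smul, norm_smul, Real.norm_of_nonneg (by positivity), Real.norm_of_nonneg (by positivity)] at h5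
  exact h5.symm

/-- The map `nl α` is positively homogeneous of degree `α + 1`, so its derivative of order `l` is
homogeneous of degree `α + 1 - l`. The constant is a bound on the unit circle, which is compact and
avoids the singularity at `0`. -/
theorem exists_norm_iteratedFDerivWithin_nl_le (α : ℝ) (l : ℕ) : ∃ C : ℝ, 0 ≤ C ∧ ∀ z : ℂ, z ≠ 0 →
    ‖iteratedFDerivWithin ℝ l (nl α) {0}ᶜ z‖ * ‖z‖ ^ l ≤ C * (‖z‖ ^ α * ‖z‖) := by
  have hu : UniqueDiffOn ℝ ({0}ᶜ : Set ℂ) := isOpen_compl_singleton.uniqueDiffOn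
  have hc : ContinuousOn (fun z => ‖iteratedFDerivWithin ℝ l (nl α) {0}ᶜ z‖) (Metric.sphere (0 : ℂ) 1) := by
    refine (((contDiffOn_nl α).continuousOn_iteratedFDerivWithin (m := l)
      (by exact_mod_cast le_top) hu).norm).mono fun z hz => ?_
    simp only [mem_sphere_iff_norm, sub_zero] at hz
    intro h
    simp [Set.mem_singleton_iff.mp h] at hz
  obtain ⟨C, hC⟩ := (isCompact_sphere (0 : ℂ) 1).bddAbove_image hc
  have hC' : ∀ z : ℂ, ‖z‖ = 1 → ‖iteratedFDerivWithin ℝ l (nl α) {0}ᶜ z‖ ≤ C := fun z hz =>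
    hC ⟨z, by simpa using hz, rfl⟩
  have hC0 : 0 ≤ C := (norm_nonneg _).trans (hC' 1 (by simp))
  refine ⟨C, hC0, fun z hz => ?_⟩
  have hr : 0 < ‖z‖ := norm_pos_iff.mpr hz
  set w : ℂ := ‖z‖⁻¹ • z with hw
  have hw1 : ‖w‖ = 1 := by rw [hw, norm_smul, norm_inv, norm_norm, inv_mul_cancel₀ hr.ne']
  have hzw : z = ‖z‖ • w := by rw [hw, smul_smul, mul_inv_cancel₀ hr.ne', one_smul]
  have h := norm_iteratedFDerivWithin_nl_smul α hr (z := w) (by rintro h; simp [h] at hw1) l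
  rw [← hzw] at h
  rw [mul_comm, h, mul_comm]
  gcongr
  exact hC' w hw1

theorem contDiff_nl_comp {α : ℝ} {F : Space N → ℂ} (hF : ContDiff ℝ ∞ F) (h0 : ∀ x, F x ≠ 0) :
    ContDiff ℝ ∞ (nl α ∘ F) :=
  contDiffOn_univ.mp ((contDiffOn_nl α).comp hF.contDiffOn fun x _ => h0 x)

theorem norm_iteratedFDeriv_nl_comp_le {α : ℝ} {F : Space N → ℂ} (hF : ContDiff ℝ ∞ F)
    (h0 : ∀ x, F x ≠ 0) (j : ℕ) (x : Space N) :
    ‖iteratedFDeriv ℝ j (nl α ∘ F) x‖ ≤ ∑ c : OrderedFinpartition j,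
      ‖iteratedFDerivWithin ℝ c.length (nl α) {0}ᶜ (F x)‖ *
        ∏ i, ‖iteratedFDeriv ℝ (c.partSize i) F x‖ := by
  have hu : UniqueDiffOn ℝ ({0}ᶜ : Set ℂ) := isOpen_compl_singleton.uniqueDiffOn
  have h1 := (contDiffOn_nl α).ftaylorSeriesWithin hu
  have h2 := (contDiffOn_univ.mpr hF).ftaylorSeriesWithin uniqueDiffOn_univ
  have h3 := h1.comp h2 fun x _ => h0 x
  have h4 := h3.eq_iteratedFDerivWithin_of_uniqueDiffOn (m := j) (by exact_mod_cast le_top)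
    uniqueDiffOn_univ (Set.mem_univ x)
  rw [← iteratedFDerivWithin_univ, ← h4]
  refine (norm_sum_le _ _).trans (Finset.sum_le_sum fun c _ => ?_)
  refine (c.norm_compAlongOrderedFinpartition_le _ _).trans_eq ?_
  simp [ftaylorSeriesWithin, iteratedFDerivWithin_univ]

/-- Since the orders `s i` add up to at most `2q + 1`, at most one of them exceeds `q`. All other
factors are bounded by `B`, and the exceptional one is a term of the sum. -/
theorem prod_le_pow_mul_add {l q : ℕ} (s : Fin l → ℕ) {d : ℕ → ℝ} (hd : ∀ i, 0 ≤ d i) {B : ℝ}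
    (hB : ∀ i ≤ q, d i ≤ B) (hs : ∑ i, s i ≤ 2 * q + 1) (hl : 0 < l) :
    ∏ i, d (s i) ≤ B ^ (l - 1) * (B + ∑ i ∈ Finset.Icc (q + 1) (∑ i, s i), d i) := by
  have hB0 : 0 ≤ B := (hd 0).trans (hB 0 (by simp))
  by_cases h : ∃ i₀, q < s i₀
  · obtain ⟨i₀, hi₀⟩ := h
    rw [← Finset.mul_prod_erase _ _ (Finset.mem_univ i₀)]
    have h1 : ∏ i ∈ Finset.univ.erase i₀, d (s i) ≤ B ^ (l - 1) := by
      refine (Finset.prod_le_prod (fun i _ => hd _) (g := fun _ => B) fun i hi => hB _ ?_).trans_eq ?_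
      · have hne : i ≠ i₀ := Finset.ne_of_mem_erase hi
        have h2 : s i + s i₀ ≤ ∑ i, s i := by
          rw [← Finset.sum_pair hne]
          exact Finset.sum_le_sum_of_subset (Finset.subset_univ _)
        lia
      · simp
    have h2 : d (s i₀) ≤ ∑ i ∈ Finset.Icc (q + 1) (∑ i, s i), d i :=
      Finset.single_le_sum (f := d) (fun i _ => hd i) (Finset.mem_Icc.mpr
        ⟨hi₀, Finset.single_le_sum (f := s) (fun i _ => Nat.zero_le _) (Finset.mem_univ i₀)⟩)
    calc _ ≤ d (s i₀) * B ^ (l - 1) := mul_le_mul_of_nonneg_left h1 (hd _)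
      _ = B ^ (l - 1) * d (s i₀) := mul_comm _ _
      _ ≤ _ := by gcongr; linarith
  · push Not at h
    have h1 : ∏ i, d (s i) ≤ B ^ l := by
      refine (Finset.prod_le_prod (fun i _ => hd _) (g := fun _ => B) fun i hi => hB _ (h i)).trans_eq ?_
      simp
    refine h1.trans ?_
    obtain ⟨p, rfl⟩ : ∃ p, l = p + 1 := ⟨l - 1, by lia⟩
    rw [pow_succ, Nat.add_sub_cancel]
    gcongr
    linarith [Finset.sum_nonneg fun i (_ : i ∈ Finset.Icc (q + 1) (∑ i, s i)) => hd i]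

theorem sum_partSize {j : ℕ} (c : OrderedFinpartition j) : ∑ i, c.partSize i = j := by
  have := c.sum_sigma_eq_sum (fun _ => (1 : ℕ))
  simpa using this

/-- In the Faà di Bruno formula a term with `l` blocks has size `|F|^{α+1-l}` times `l` derivatives
of `F`. The lower bound makes each low order derivative at most a multiple of `|F|`, so `l - 1` of
them cancel the negative powers and leave `|F|^α`, which supplies `⟨x⟩^{-mα}`. At most one
derivative has order above `2n`, because `J ≤ 4n + 1` by `hn`. -/
theorem SmoothBound.exists_nl_pointwise {k n m : ℕ} (hn : k + m + 1 ≤ 2 * n) {α : ℝ} (hα : 0 ≤ α)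
    {M η : ℝ} (hM : 0 ≤ M) (hη : 0 < η) : ∃ C : ℝ, 0 ≤ C ∧ ∀ F : Space N → ℂ,
      SmoothBound k n m M F → (∀ x, η ≤ bracket x ^ m * ‖F x‖) → ∀ j ≤ 2 * n + 2 + k + m, ∀ x,
        ‖iteratedFDeriv ℝ j (nl α ∘ F) x‖ ≤ C * bracket x ^ (-(m * α)) *
          ((bracket x ^ m)⁻¹ + ∑ i ∈ Finset.Icc (2 * n + 1) j, ‖iteratedFDeriv ℝ i F x‖) := by
  choose Cl hCl0 hCl using exists_norm_iteratedFDerivWithin_nl_le α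
  set J := 2 * n + 2 + k + m with hJ
  set S : ℝ := ∑ j ∈ Finset.range (J + 1), ∑ c : OrderedFinpartition j, Cl c.length with hS
  have hS0 : 0 ≤ S := Finset.sum_nonneg fun _ _ => Finset.sum_nonneg fun _ _ => hCl0 _
  have hR0 : 0 ≤ M / η := by positivity
  refine ⟨(1 + S) * (1 + M / η) ^ J * M ^ α * (1 + M), by positivity, fun F hF hlow j hj x => ?_⟩
  have hb := bracket_pos x
  set b := bracket x with hbdef
  have hbm : 0 < b ^ m := by positivity
  have hFpos : 0 < ‖F x‖ := by
    by_contra h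
    have : ‖F x‖ = 0 := le_antisymm (not_lt.mp h) (norm_nonneg _)
    have h1 := hlow x
    rw [this, mul_zero] at h1
    linarith
  have hne : ∀ x, F x ≠ 0 := fun y hy => by
    have h1 := hlow y
    rw [hy, norm_zero, mul_zero] at h1
    linarith
  set B := M * (b ^ m)⁻¹ with hBdef
  have hB0 : 0 ≤ B := by positivity
  have hlowB : ∀ i ≤ 2 * n, ‖iteratedFDeriv ℝ i F x‖ ≤ B := fun i hi => by
    rw [hBdef, ← div_eq_mul_inv, le_div_iff₀ hbm, mul_comm]
    exact hF.low i hi x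
  have hFB : ‖F x‖ ≤ B := by simpa using hlowB 0 (by simp)
  -- The lower bound enters here: the pointwise size of the low order derivatives is comparable to
  -- `|F x|`.
  have hBR : B ≤ M / η * ‖F x‖ := by
    rw [hBdef, div_mul_eq_mul_div, mul_div_assoc]
    gcongr
    rw [le_div_iff₀ hη, inv_mul_le_iff₀ hbm]
    exact hlow x
  have hFα : ‖F x‖ ^ α ≤ M ^ α * b ^ (-(m * α)) := by
    refine (Real.rpow_le_rpow (norm_nonneg _) hFB hα).trans_eq ?_
    rw [hBdef, Real.mul_rpow hM (by positivity), ← Real.rpow_natCast, ← Real.rpow_neg hb.le,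
      ← Real.rpow_mul hb.le]
    congr 2
    ring
  set D := (b ^ m)⁻¹ + ∑ i ∈ Finset.Icc (2 * n + 1) j, ‖iteratedFDeriv ℝ i F x‖ with hD
  have hsum0 : 0 ≤ ∑ i ∈ Finset.Icc (2 * n + 1) j, ‖iteratedFDeriv ℝ i F x‖ :=
    Finset.sum_nonneg fun _ _ => norm_nonneg _
  have hD0 : 0 ≤ D := by positivity
  have hBD : B + ∑ i ∈ Finset.Icc (2 * n + 1) j, ‖iteratedFDeriv ℝ i F x‖ ≤ (1 + M) * D := by
    have : 0 ≤ (b ^ m)⁻¹ := by positivity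
    rw [hBdef, hD]
    nlinarith
  have hbα : 0 ≤ b ^ (-((m : ℝ) * α)) := by positivity
  rcases Nat.eq_zero_or_pos j with rfl | hj0
  · rw [norm_iteratedFDeriv_zero, Function.comp_apply, norm_nl]
    have h1 : ‖F x‖ ≤ (1 + M) * D := by
      refine (hFB.trans ?_).trans hBD
      linarith
    calc ‖F x‖ ^ α * ‖F x‖ ≤ (M ^ α * b ^ (-(m * α))) * ((1 + M) * D) := by gcongr
      _ = 1 * 1 * (M ^ α * b ^ (-(m * α)) * ((1 + M) * D)) := by ring
      _ ≤ (1 + S) * (1 + M / η) ^ J * (M ^ α * b ^ (-(m * α)) * ((1 + M) * D)) := by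
        gcongr
        · linarith
        · exact one_le_pow₀ (by linarith)
      _ = _ := by ring
  have hterm : ∀ c : OrderedFinpartition j,
      ‖iteratedFDerivWithin ℝ c.length (nl α) {0}ᶜ (F x)‖ * ∏ i, ‖iteratedFDeriv ℝ (c.partSize i) F x‖
        ≤ Cl c.length * ((1 + M / η) ^ J * (M ^ α * b ^ (-(m * α))) * ((1 + M) * D)) := by
    intro c
    have hl := c.length_pos hj0
    have hlj := c.length_le
    have h1 := prod_le_pow_mul_add c.partSize (d := fun i => ‖iteratedFDeriv ℝ i F x‖)
      (fun _ => norm_nonneg _) hlowB (by rw [sum_partSize]; lia) hl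
    rw [sum_partSize] at h1
    set T := ‖iteratedFDerivWithin ℝ c.length (nl α) {0}ᶜ (F x)‖ with hT
    have hT0 : 0 ≤ T := norm_nonneg _
    have h2 := hCl c.length (F x) (hne x)
    have h3 : T * ‖F x‖ ^ (c.length - 1) ≤ Cl c.length * ‖F x‖ ^ α := by
      have e : ‖F x‖ ^ c.length = ‖F x‖ ^ (c.length - 1) * ‖F x‖ := by
        rw [← pow_succ]; congr 1; lia
      rw [e, ← mul_assoc, ← mul_assoc] at h2
      exact le_of_mul_le_mul_right h2 hFpos
    have h4 : B ^ (c.length - 1) ≤ (1 + M / η) ^ J * ‖F x‖ ^ (c.length - 1) := by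
      calc B ^ (c.length - 1) ≤ (M / η * ‖F x‖) ^ (c.length - 1) := by gcongr
        _ = (M / η) ^ (c.length - 1) * ‖F x‖ ^ (c.length - 1) := mul_pow _ _ _
        _ ≤ (1 + M / η) ^ (c.length - 1) * ‖F x‖ ^ (c.length - 1) := by gcongr; linarith
        _ ≤ _ := by
          gcongr
          · linarith
          · lia
    calc T * ∏ i, ‖iteratedFDeriv ℝ (c.partSize i) F x‖
        ≤ T * (((1 + M / η) ^ J * ‖F x‖ ^ (c.length - 1)) * ((1 + M) * D)) := by
          gcongr
          exact h1.trans (mul_le_mul h4 hBD (by positivity) (by positivity))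
      _ = (1 + M / η) ^ J * (T * ‖F x‖ ^ (c.length - 1)) * ((1 + M) * D) := by ring
      _ ≤ (1 + M / η) ^ J * (Cl c.length * (M ^ α * b ^ (-(m * α)))) * ((1 + M) * D) := by
          refine mul_le_mul_of_nonneg_right (mul_le_mul_of_nonneg_left ?_ (by positivity)) (by positivity)
          exact h3.trans (mul_le_mul_of_nonneg_left hFα (hCl0 _))
      _ = _ := by ring
  refine (norm_iteratedFDeriv_nl_comp_le hF.smooth hne j x).trans
    ((Finset.sum_le_sum fun c _ => hterm c).trans ?_)
  rw [← Finset.sum_mul]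
  have h5 : ∑ c : OrderedFinpartition j, Cl c.length ≤ 1 + S := by
    have := Finset.single_le_sum (f := fun j => ∑ c : OrderedFinpartition j, Cl c.length)
      (fun _ _ => Finset.sum_nonneg fun _ _ => hCl0 _) (Finset.mem_range.mpr (Nat.lt_succ_of_le hj))
    linarith
  calc _ ≤ (1 + S) * ((1 + M / η) ^ J * (M ^ α * b ^ (-(m * α))) * ((1 + M) * D)) := by gcongr
    _ = _ := by ring

/-- At high order, the term without high derivatives is only bounded by `⟨x⟩^{-mα}` once the weight
`⟨x⟩^m` has been used up. It lies in `L²` precisely because `mα > N/2`. In the other terms the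
weights `wt` decrease with the order, so each derivative of `F` carries at least the weight
required. -/
theorem SmoothBound.exists_nl {k n m : ℕ} (hn : k + m + 1 ≤ 2 * n) {α : ℝ} (hα : 0 ≤ α)
    (hmα : (N : ℝ) / 2 < m * α) {M η : ℝ} (hM : 0 ≤ M) (hη : 0 < η) : ∃ K : ℝ, 0 ≤ K ∧
      ∀ F : Space N → ℂ, SmoothBound k n m M F → (∀ x, η ≤ bracket x ^ m * ‖F x‖) →
        SmoothBound k n m K (nl α ∘ F) := by
  obtain ⟨C, hC0, hC⟩ := SmoothBound.exists_nl_pointwise (N := N) hn hα hM hη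
  have hbr := memLp_bracket_rpow (N := N) hmα
  set L : ℝ := (eLpNorm (fun x : Space N => bracket x ^ (-(m * α))) 2 volume).toReal with hL
  set J := 2 * n + 2 + k + m with hJ
  have hbα : ∀ x : Space N, bracket x ^ (-((m : ℝ) * α)) ≤ 1 := fun x =>
    Real.rpow_le_one_of_one_le_of_nonpos (one_le_bracket x) (by simp; positivity)
  refine ⟨C * (1 + L + (J + 1) * M), by positivity, fun F hF hlow => ?_⟩
  have hne : ∀ x, F x ≠ 0 := fun y hy => by
    have h1 := hlow y
    rw [hy, norm_zero, mul_zero] at h1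
    linarith
  have hsm := contDiff_nl_comp (α := α) hF.smooth hne
  have hcont : ∀ j, Continuous fun x => bracket x ^ wt k n m j * ‖iteratedFDeriv ℝ j F x‖ := fun j => by
    have := hF.smooth.continuous_iteratedFDeriv (m := j) (by exact_mod_cast le_top)
    fun_prop
  have hhigh : ∀ j, 2 * n + 1 ≤ j → j ≤ J →
      eLpNorm (fun x => bracket x ^ wt k n m j * ‖iteratedFDeriv ℝ j (nl α ∘ F) x‖) 2 volume ≤
        ENNReal.ofReal (C * (1 + L + (J + 1) * M)) := by
    intro j hj1 hj2
    have hpt : ∀ x, ‖bracket x ^ wt k n m j * ‖iteratedFDeriv ℝ j (nl α ∘ F) x‖‖ ≤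
        C * ‖bracket x ^ (-((m : ℝ) * α)) + ∑ i ∈ Finset.Icc (2 * n + 1) j,
          bracket x ^ wt k n m i * ‖iteratedFDeriv ℝ i F x‖‖ := by
      intro x
      have hb := bracket_pos x
      have hs0 : 0 ≤ ∑ i ∈ Finset.Icc (2 * n + 1) j, bracket x ^ wt k n m i * ‖iteratedFDeriv ℝ i F x‖ :=
        Finset.sum_nonneg fun _ _ => by positivity
      rw [Real.norm_of_nonneg (by positivity), Real.norm_of_nonneg (by positivity)]
      have h1 : bracket x ^ wt k n m j * (bracket x ^ m)⁻¹ ≤ 1 := by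
        rw [← div_eq_mul_inv, div_le_one (by positivity)]
        exact pow_le_pow_right₀ (one_le_bracket x) (min_le_left _ _)
      have h2 : bracket x ^ wt k n m j * ∑ i ∈ Finset.Icc (2 * n + 1) j, ‖iteratedFDeriv ℝ i F x‖ ≤
          ∑ i ∈ Finset.Icc (2 * n + 1) j, bracket x ^ wt k n m i * ‖iteratedFDeriv ℝ i F x‖ := by
        rw [Finset.mul_sum]
        refine Finset.sum_le_sum fun i hi => ?_
        gcongr
        · exact one_le_bracket x
        · have := (Finset.mem_Icc.mp hi).2
          exact min_le_min le_rfl (by lia)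
      have hα0 : 0 ≤ bracket x ^ (-((m : ℝ) * α)) := by positivity
      calc bracket x ^ wt k n m j * ‖iteratedFDeriv ℝ j (nl α ∘ F) x‖
          ≤ bracket x ^ wt k n m j * (C * bracket x ^ (-(m * α)) *
            ((bracket x ^ m)⁻¹ + ∑ i ∈ Finset.Icc (2 * n + 1) j, ‖iteratedFDeriv ℝ i F x‖)) := by
            gcongr; exact hC F hF hlow j hj2 x
        _ = C * (bracket x ^ (-(m * α)) * (bracket x ^ wt k n m j * (bracket x ^ m)⁻¹) +
            bracket x ^ (-(m * α)) * (bracket x ^ wt k n m j *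
              ∑ i ∈ Finset.Icc (2 * n + 1) j, ‖iteratedFDeriv ℝ i F x‖)) := by ring
        _ ≤ C * (bracket x ^ (-(m * α)) * 1 + 1 *
              ∑ i ∈ Finset.Icc (2 * n + 1) j, bracket x ^ wt k n m i * ‖iteratedFDeriv ℝ i F x‖) := by
            gcongr
            exact hbα x
        _ = _ := by ring
    refine (eLpNorm_le_mul_eLpNorm_of_ae_le_mul (Eventually.of_forall hpt) 2).trans ?_
    rw [ENNReal.ofReal_mul hC0]
    gcongr
    have hs := eLpNorm_sum_le (μ := (volume : Measure (Space N))) (p := 2)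
      (s := Finset.Icc (2 * n + 1) j)
      (f := fun i x => bracket x ^ wt k n m i * ‖iteratedFDeriv ℝ i F x‖)
      (fun i _ => (hcont i).aestronglyMeasurable) (by norm_num)
    have e : (∑ i ∈ Finset.Icc (2 * n + 1) j, fun x => bracket x ^ wt k n m i * ‖iteratedFDeriv ℝ i F x‖) =
        fun x => ∑ i ∈ Finset.Icc (2 * n + 1) j, bracket x ^ wt k n m i * ‖iteratedFDeriv ℝ i F x‖ := by
      funext x; simp
    rw [e] at hs
    refine (eLpNorm_add_le hbr.1 (continuous_finsetSum _ fun i _ => hcont i).aestronglyMeasurable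
      (by norm_num)).trans ?_
    have hs2 : ∑ i ∈ Finset.Icc (2 * n + 1) j,
        eLpNorm (fun x => bracket x ^ wt k n m i * ‖iteratedFDeriv ℝ i F x‖) 2 volume ≤
          ENNReal.ofReal ((J + 1) * M) := by
      refine (Finset.sum_le_sum (g := fun _ => ENNReal.ofReal M) fun i hi => ?_).trans ?_
      · have := Finset.mem_Icc.mp hi
        exact hF.high i this.1 (this.2.trans hj2)
      · rw [← ENNReal.ofReal_sum_of_nonneg (fun _ _ => hM)]
        refine ENNReal.ofReal_le_ofReal ?_
        rw [Finset.sum_const, nsmul_eq_mul, Nat.card_Icc]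
        gcongr
        have : j + 1 - (2 * n + 1) ≤ J + 1 := by lia
        exact_mod_cast this
    have hL' : eLpNorm (fun x : Space N => bracket x ^ (-((m : ℝ) * α))) 2 volume = ENNReal.ofReal L :=
      (ENNReal.ofReal_toReal hbr.2.ne).symm
    rw [hL']
    refine (add_le_add le_rfl (hs.trans hs2)).trans ?_
    rw [← ENNReal.ofReal_add (by positivity) (by positivity)]
    exact ENNReal.ofReal_le_ofReal (by linarith)
  refine ⟨hsm, fun j hj => ?_, fun j hj x => ?_, fun j hj1 hj2 =>
    ⟨?_, (hhigh j hj1 hj2).trans_lt ENNReal.ofReal_lt_top⟩, hhigh⟩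
  · choose! B hB using hF.bounded
    refine ⟨C * 1 * (1 + ∑ i ∈ Finset.Icc (2 * n + 1) j, B i), fun x => (hC F hF hlow j hj x).trans ?_⟩
    have hb := bracket_pos x
    have h0 : 0 ≤ ∑ i ∈ Finset.Icc (2 * n + 1) j, ‖iteratedFDeriv ℝ i F x‖ :=
      Finset.sum_nonneg fun _ _ => norm_nonneg _
    gcongr with i hi
    · exact hbα x
    · exact inv_le_one_of_one_le₀ (one_le_pow₀ (one_le_bracket x))
    · exact hB i ((Finset.mem_Icc.mp hi).2.trans hj) x
  · have hb := bracket_pos x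
    have h1 := hC F hF hlow j (by lia) x
    rw [Finset.Icc_eq_empty (by lia), Finset.sum_empty, add_zero] at h1
    calc bracket x ^ m * ‖iteratedFDeriv ℝ j (nl α ∘ F) x‖
        ≤ bracket x ^ m * (C * bracket x ^ (-(m * α)) * (bracket x ^ m)⁻¹) := by gcongr
      _ = C * bracket x ^ (-(m * α)) := by field_simp
      _ ≤ C * 1 := by gcongr; exact hbα x
      _ ≤ C * (1 + L + (J + 1) * M) := by
          gcongr
          have : 0 ≤ L := ENNReal.toReal_nonneg
          have : 0 ≤ (J + 1) * M := by positivity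
          linarith
  · have := hsm.continuous_iteratedFDeriv (m := j) (by exact_mod_cast le_top)
    exact (by fun_prop : Continuous fun x =>
      bracket x ^ wt k n m j * ‖iteratedFDeriv ℝ j (nl α ∘ F) x‖).aestronglyMeasurable

/-! ### From classical bounds back to dual bounds. -/

theorem norm_integral_mul_le_of_memLp {G : Space N → ℝ} (hG : MemLp G 2 volume) {H : Space N → ℂ}
    (ψ : Test N) (h : ∀ᵐ x, ‖H x‖ ≤ G x) :
    ‖∫ x, ψ x * H x‖ ≤ (eLpNorm G 2 volume).toReal * n2 ψ := by
  set P : Lp (α := Space N) ℝ 2 volume := (ψ.memLp 2 volume).norm.toLp _ with hP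
  have hPn : ‖P‖ = n2 ψ := by
    rw [hP, Lp.norm_toLp, eLpNorm_norm, n2, SchwartzMap.norm_toLp]
  have hin : ∫ x, ‖ψ x‖ * G x = inner ℝ P (hG.toLp G) := by
    rw [L2.inner_def]
    refine integral_congr_ae ?_
    filter_upwards [hG.coeFn_toLp, (ψ.memLp 2 volume).norm.coeFn_toLp] with x hx1 hx2
    rw [hP, hx1, hx2]
    simp [mul_comm]
  calc ‖∫ x, ψ x * H x‖ ≤ ∫ x, ‖ψ x‖ * G x := by
        refine norm_integral_le_of_norm_le ((ψ.memLp 2 volume).norm.integrable_mul hG) ?_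
        filter_upwards [h] with x hx
        rw [norm_mul]
        gcongr
    _ = inner ℝ P (hG.toLp G) := hin
    _ ≤ ‖P‖ * ‖hG.toLp G‖ := real_inner_le_norm _ _
    _ = _ := by rw [hPn, mul_comm, Lp.norm_toLp]

theorem SmoothBound.boundTwo {k n m : ℕ} {M : ℝ} (hM : 0 ≤ M) {F : Space N → ℂ} {f : L2 N}
    (h : SmoothBound k n m M F) (hfF : f =ᵐ[volume] F) : BoundTwo k n m M f := by
  intro β γ h1 h2 h3 ψ
  set j := β.length with hj
  have hmem := h.high_memLp j h1 (by lia)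
  have e := integral_mono_pd h.smooth hfF β.reverse γ
    (fun i hi => h.bounded i (by simp at hi; lia)) ψ
  rw [List.reverse_reverse] at e
  rw [e, norm_mul, norm_pow, norm_neg, norm_one, one_pow, one_mul]
  refine (norm_integral_mul_le_of_memLp hmem ψ (Eventually.of_forall fun x => ?_)).trans
    (mul_le_mul_of_nonneg_right (ENNReal.toReal_le_of_le_ofReal hM (h.high j h1 (by lia))) (n2_nonneg ψ))
  rw [norm_mul]
  have := bracket_pos x
  gcongr
  · refine (norm_mono_le γ x).trans (pow_le_pow_right₀ (one_le_bracket x) (le_min h2 ?_))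
    lia
  · have := norm_pd_le h.smooth β.reverse x
    rwa [List.length_reverse] at this

theorem SmoothBound.boundInf {k n m : ℕ} {M : ℝ} {F : Space N → ℂ} {f : L2 N}
    (h : SmoothBound k n m M F) (hfF : f =ᵐ[volume] F) : BoundInf n m M f := by
  intro β γ h1 h2 ψ
  have e := integral_mono_pd h.smooth hfF β.reverse γ
    (fun i hi => h.bounded i (by simp at hi; lia)) ψ
  rw [List.reverse_reverse] at e
  rw [e, norm_mul, norm_pow, norm_neg, norm_one, one_pow, one_mul]
  rw [n1, ← integral_const_mul]
  refine norm_integral_le_of_norm_le (ψ.integrable.norm.const_mul M) (Eventually.of_forall fun x => ?_)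
  rw [norm_mul, mul_comm]
  gcongr
  rw [norm_mul]
  refine le_trans ?_ (h.low β.length h1 x)
  have := bracket_pos x
  gcongr
  · exact (norm_mono_le γ x).trans (pow_le_pow_right₀ (one_le_bracket x) h2)
  · have := norm_pd_le h.smooth β.reverse x
    rwa [List.length_reverse] at this

/-! ### The nonlinearity on `L²` -/

theorem norm_nl_sub_le {α R : ℝ} (hα : 0 < α) {z w : ℂ} (hz : ‖z‖ ≤ R) (hw : ‖w‖ ≤ R) :
    ‖nl α z - nl α w‖ ≤ (α + 1) * R ^ α * ‖z - w‖ := by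
  wlog hwz : ‖w‖ ≤ ‖z‖ generalizing z w
  · rw [norm_sub_rev, norm_sub_rev z]
    exact this hw hz (le_of_not_ge hwz)
  -- Bernoulli's inequality for `(‖w‖/‖z‖)^{α+1}`: this is the convexity of `r ↦ r^{α+1}`, and it
  -- also covers `α < 1`.
  have hb : ‖z‖ ^ α * ‖w‖ - ‖w‖ ^ α * ‖w‖ ≤ α * ‖z‖ ^ α * (‖z‖ - ‖w‖) := by
    rcases (norm_nonneg z).eq_or_lt with h0 | h0
    · have : ‖w‖ = 0 := le_antisymm (hwz.trans h0.ge) (norm_nonneg _)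
      rw [this, ← h0]
      simp
    · have h1 := one_add_mul_self_le_rpow_one_add (s := ‖w‖ / ‖z‖ - 1) (p := α + 1)
        (by linarith [div_nonneg (norm_nonneg w) h0.le]) (by linarith)
      rw [add_sub_cancel, Real.div_rpow (norm_nonneg _) h0.le, le_div_iff₀ (by positivity),
        Real.rpow_add_one h0.ne'] at h1
      have h2 : ‖w‖ ^ (α + 1) = ‖w‖ ^ α * ‖w‖ := by
        rcases (norm_nonneg w).eq_or_lt with h | h
        · rw [← h, mul_zero, Real.zero_rpow (by linarith)]
        · exact Real.rpow_add_one h.ne' α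
      rw [h2] at h1
      have h3 : (1 + (α + 1) * (‖w‖ / ‖z‖ - 1)) * (‖z‖ ^ α * ‖z‖) =
          ‖z‖ ^ α * (‖z‖ + (α + 1) * (‖w‖ - ‖z‖)) := by field_simp
      rw [h3] at h1
      linarith
  have hmono : ‖w‖ ^ α ≤ ‖z‖ ^ α := Real.rpow_le_rpow (norm_nonneg _) hwz hα.le
  have e : nl α z - nl α w = ((‖z‖ ^ α : ℝ) : ℂ) * (z - w) + ((‖z‖ ^ α - ‖w‖ ^ α : ℝ) : ℂ) * w := by
    simp only [nl]; push_cast; ring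
  have hzα : ‖z‖ ^ α ≤ R ^ α := Real.rpow_le_rpow (norm_nonneg _) hz hα.le
  have h0 : 0 ≤ ‖z‖ ^ α := by positivity
  have htri : ‖z‖ - ‖w‖ ≤ ‖z - w‖ := norm_sub_norm_le z w
  calc ‖nl α z - nl α w‖ ≤ ‖z‖ ^ α * ‖z - w‖ + (‖z‖ ^ α - ‖w‖ ^ α) * ‖w‖ := by
        rw [e]
        refine (norm_add_le _ _).trans_eq ?_
        rw [norm_mul, norm_mul, Complex.norm_real, Complex.norm_real, Real.norm_of_nonneg h0,
          Real.norm_of_nonneg (by linarith)]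
    _ ≤ ‖z‖ ^ α * ‖z - w‖ + α * ‖z‖ ^ α * ‖z - w‖ := by
        have : α * ‖z‖ ^ α * (‖z‖ - ‖w‖) ≤ α * ‖z‖ ^ α * ‖z - w‖ := by gcongr
        linarith
    _ = (α + 1) * ‖z‖ ^ α * ‖z - w‖ := by ring
    _ ≤ _ := by gcongr

theorem nonlinearity_ae {α R : ℝ} (hα : 0 < α) {f : L2 N} (hf : ∀ᵐ x, ‖f x‖ ≤ R) :
    nonlinearity α f =ᵐ[volume] fun x => nl α (f x) := by
  have hmem : MemLp (fun x => ((‖f x‖ ^ α : ℝ) : ℂ) * f x) 2 volume := by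
    refine (Lp.memLp f).of_le_mul (c := R ^ α) ?_ ?_
    · have h1 : AEStronglyMeasurable (fun x => ‖f x‖ ^ α) volume :=
        ((Real.continuous_rpow_const hα.le).comp continuous_norm).comp_aestronglyMeasurable
          (Lp.aestronglyMeasurable f)
      exact (Complex.continuous_ofReal.comp_aestronglyMeasurable h1).mul (Lp.aestronglyMeasurable f)
    · filter_upwards [hf] with x hx
      rw [norm_mul, Complex.norm_real, Real.norm_of_nonneg (by positivity)]
      gcongr
  rw [nonlinearity, dif_pos hmem]
  exact hmem.coeFn_toLp

theorem norm_nonlinearity_sub_le {α R : ℝ} (hα : 0 < α) {f g : L2 N} (hf : ∀ᵐ x, ‖f x‖ ≤ R)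
    (hg : ∀ᵐ x, ‖g x‖ ≤ R) :
    ‖nonlinearity α f - nonlinearity α g‖ ≤ (α + 1) * R ^ α * ‖f - g‖ := by
  refine Lp.norm_le_mul_norm_of_ae_le_mul ?_
  filter_upwards [Lp.coeFn_sub (nonlinearity α f) (nonlinearity α g), Lp.coeFn_sub f g,
    nonlinearity_ae hα hf, nonlinearity_ae hα hg, hf, hg] with x h1 h2 h3 h4 h5 h6
  rw [h1, h2, Pi.sub_apply, Pi.sub_apply, h3, h4]
  exact norm_nl_sub_le hα h5 h6

/-- Each condition is a closed one on a continuous functional of `f` in `L²`. This is the benefit of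
the dual form: `L²` convergence alone transports weighted bounds on high derivatives to the limit.
-/
theorem isClosed_boundTwo (k n m : ℕ) (M : ℝ) : IsClosed {f : L2 N | BoundTwo k n m M f} := by
  simp only [BoundTwo, Set.ofPred_forall]
  refine isClosed_iInter fun β => isClosed_iInter fun γ => isClosed_iInter fun _ =>
    isClosed_iInter fun _ => isClosed_iInter fun _ => isClosed_iInter fun ψ => ?_
  exact isClosed_le (continuous_pair_left _).norm continuous_const

theorem isClosed_boundInf (n m : ℕ) (M : ℝ) : IsClosed {f : L2 N | BoundInf n m M f} := by
  simp only [BoundInf, Set.ofPred_forall]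
  refine isClosed_iInter fun β => isClosed_iInter fun γ => isClosed_iInter fun _ =>
    isClosed_iInter fun _ => isClosed_iInter fun ψ => ?_
  exact isClosed_le (continuous_pair_left _).norm continuous_const

theorem BoundInf.ae_bracket {n m : ℕ} {M : ℝ} {f : L2 N} (h : BoundInf n m M f) :
    ∀ᵐ x, bracket x ^ m * ‖f x‖ ≤ (1 + N) ^ (m + 1) * M :=
  ae_bracket_le fun γ hγ ψ => h [] γ (by simp) hγ ψ

theorem BoundInf.ae_norm_le {n m : ℕ} {M : ℝ} {f : L2 N} (h : BoundInf n m M f) :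
    ∀ᵐ x, ‖f x‖ ≤ (1 + N) ^ (m + 1) * M := by
  filter_upwards [h.ae_bracket] with x hx
  refine le_trans ?_ hx
  exact le_mul_of_one_le_left (norm_nonneg _) (one_le_pow₀ (one_le_bracket x))

/-- The heat regularization of a bounded function satisfies classical bounds and stays close. -/
theorem exists_regularization (k n m : ℕ) (hk : (N : ℝ) / 2 < k) : ∃ K : ℝ, 1 ≤ K ∧ ∀ (f : L2 N) (M : ℝ),
    0 ≤ M → BoundTwo k n m M f → BoundInf n m M f → ∀ ε : ℝ, 0 < ε → ε ≤ 1 → ∃ F : Space N → ℂ,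
      PL ε f =ᵐ[volume] F ∧ SmoothBound k n m (K * M) F ∧
        ∀ᵐ x, bracket x ^ m * ‖f x - F x‖ ≤ K * M * ε := by
  obtain ⟨K, hK1, hK⟩ := exists_PL_bound (N := N) k n m hk
  have hc : (1 : ℝ) ≤ (1 + N) ^ (m + 1) * (N + 1) ^ (2 * n + 2 + k + m) :=
    one_le_mul_of_one_le_of_one_le (one_le_pow₀ (by simp)) (one_le_pow₀ (by simp))
  have hc' : (1 + N : ℝ) ^ (m + 1) ≤ (1 + N) ^ (m + 1) * (N + 1) ^ (2 * n + 2 + k + m) :=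
    le_mul_of_one_le_right (by positivity) (one_le_pow₀ (by simp))
  refine ⟨(1 + N) ^ (m + 1) * (N + 1) ^ (2 * n + 2 + k + m) * K,
    one_le_mul_of_one_le_of_one_le hc hK1, fun f M hM h2 hi ε hε hε1 => ?_⟩
  -- Real `z = ε` is the heat semigroup, covered by the same estimates as the Schrödinger group.
  obtain ⟨g2, gi, gd⟩ := hK f M hM h2 hi (ε : ℂ) (by simpa using hε.le)
    (by simpa [abs_of_pos hε] using hε1)
  obtain ⟨F, hF, hfF, hb⟩ := exists_smooth_rep hε f
  refine ⟨F, hfF, ?_, ?_⟩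
  · have := SmoothBound.of_bound (by positivity) hF hfF hb g2 gi
    rwa [← mul_assoc] at this
  · have h := ae_bracket_le gd
    filter_upwards [h, Lp.coeFn_sub (PL ε f) f, hfF] with x h1 h3 h4
    rw [h3, Pi.sub_apply, h4, norm_sub_rev] at h1
    refine h1.trans ?_
    have : ‖(ε : ℂ)‖ = ε := by simp [abs_of_pos hε]
    rw [this, mul_assoc K, mul_assoc _ K, mul_assoc _ _ ε, mul_assoc K]
    gcongr

theorem tendsto_PL_zero (f : L2 N) : Tendsto (fun ε : ℝ => PL ε f) (𝓝[>] 0) (𝓝 f) := by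
  have h : Continuous fun ε : ℝ => PL ε f := (continuous_PL f).comp Complex.continuous_ofReal
  have := h.tendsto 0
  simp only [Complex.ofReal_zero, PL_zero] at this
  exact this.mono_left nhdsWithin_le_nhds

/-- The dual bounds do not provide a smooth representative for `f`, so the chain rule is applied to
the heat regularizations. They satisfy the classical bounds and half the lower bound uniformly in
`ε`, and the resulting estimates survive the limit `ε → 0` by closedness. -/
theorem exists_nonlinearity_bound {k n m : ℕ} (hk : (N : ℝ) / 2 < k) (hn : k + m + 1 ≤ 2 * n) {α : ℝ}
    (hα : 0 < α) (hmα : (N : ℝ) / 2 < m * α) {M η : ℝ} (hM : 0 ≤ M) (hη : 0 < η) : ∃ K : ℝ, 0 ≤ K ∧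
      ∀ f : L2 N, BoundTwo k n m M f → BoundInf n m M f → (∀ᵐ x, η ≤ bracket x ^ m * ‖f x‖) →
        BoundTwo k n m K (nonlinearity α f) ∧ BoundInf n m K (nonlinearity α f) := by
  obtain ⟨K₁, hK1, hK₁⟩ := exists_regularization (N := N) k n m hk
  obtain ⟨K, hK0, hK⟩ := SmoothBound.exists_nl (N := N) (k := k) hn hα.le hmα (M := K₁ * M) (η := η / 2)
    (by positivity) (by positivity)
  refine ⟨K, hK0, fun f h2 hi hlow => ?_⟩
  set R : ℝ := (1 + N) ^ (m + 1) * (K₁ * M) with hR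
  have hfR : ∀ᵐ x, ‖f x‖ ≤ R := by
    filter_upwards [hi.ae_norm_le] with x hx
    refine hx.trans ?_
    rw [hR]
    gcongr
    exact le_mul_of_one_le_left hM hK1
  have hKM : 0 ≤ K₁ * M := by positivity
  -- For `ε ≤ ε₀` the regularization changes `⟨x⟩^m f` by at most `η/2`, so half of the lower bound
  -- remains.
  set ε₀ : ℝ := min 1 (η / 2 / (K₁ * M + 1)) with hε₀
  have hε₀' : 0 < ε₀ := lt_min one_pos (by positivity)
  have key : ∀ ε : ℝ, 0 < ε → ε ≤ ε₀ → (∀ᵐ x, ‖PL ε f x‖ ≤ R) ∧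
      BoundTwo k n m K (nonlinearity α (PL ε f)) ∧ BoundInf n m K (nonlinearity α (PL ε f)) := by
    intro ε hε hεε
    obtain ⟨F, hfF, hF, hclose⟩ := hK₁ f M hM h2 hi ε hε (hεε.trans (min_le_left _ _))
    have hsmall : K₁ * M * ε ≤ η / 2 := by
      have h1 : ε * (K₁ * M + 1) ≤ η / 2 := by
        rw [← le_div_iff₀ (by positivity)]
        exact hεε.trans (min_le_right _ _)
      nlinarith
    have hFlow : ∀ x, η / 2 ≤ bracket x ^ m * ‖F x‖ := by
      have hcF := hF.smooth.continuous
      refine le_of_ae_le_of_continuous continuous_const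
        ((continuous_bracket.pow m).mul hcF.norm) ?_
      filter_upwards [hclose, hlow] with x h1 h3
      have h4 : ‖f x‖ ≤ ‖f x - F x‖ + ‖F x‖ := by
        simpa using norm_add_le (f x - F x) (F x)
      have h5 := mul_le_mul_of_nonneg_left h4 (by have := bracket_pos x; positivity : 0 ≤ bracket x ^ m)
      rw [mul_add] at h5
      linarith
    have hR' : ∀ᵐ x, ‖PL ε f x‖ ≤ R := by
      filter_upwards [(hF.boundInf hfF).ae_norm_le] with x hx using hx
    have hS := hK F hF hFlow
    have hae : nonlinearity α (PL ε f) =ᵐ[volume] nl α ∘ F := by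
      filter_upwards [nonlinearity_ae hα hR', hfF] with x h1 h3
      rw [h1, h3, Function.comp_apply]
    exact ⟨hR', hS.boundTwo hK0 hae, hS.boundInf hae⟩
  have hlim : Tendsto (fun ε : ℝ => nonlinearity α (PL ε f)) (𝓝[>] 0) (𝓝 (nonlinearity α f)) := by
    rw [tendsto_iff_norm_sub_tendsto_zero]
    have h0 : Tendsto (fun ε : ℝ => (α + 1) * R ^ α * ‖PL ε f - f‖) (𝓝[>] 0) (𝓝 0) := by
      have := (tendsto_iff_norm_sub_tendsto_zero.mp (tendsto_PL_zero f)).const_mul ((α + 1) * R ^ α)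
      rwa [mul_zero] at this
    refine squeeze_zero' (Eventually.of_forall fun _ => norm_nonneg _) ?_ h0
    filter_upwards [Ioc_mem_nhdsGT hε₀'] with ε hε
    exact norm_nonlinearity_sub_le hα (key ε hε.1 hε.2).1 hfR
  have hev : ∀ᶠ ε : ℝ in 𝓝[>] 0, ε ∈ Set.Ioc 0 ε₀ := Ioc_mem_nhdsGT hε₀'
  exact ⟨(isClosed_boundTwo k n m K).mem_of_tendsto hlim (hev.mono fun ε hε => (key ε hε.1 hε.2).2.1),
    (isClosed_boundInf n m K).mem_of_tendsto hlim (hev.mono fun ε hε => (key ε hε.1 hε.2).2.2)⟩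

/-! ### Bounds in `Σ` in dual form. -/

/-- The bound `‖f‖ ≤ C` in `Σ`, in dual form. -/
structure SigmaBound (C : ℝ) (f : L2 N) : Prop where
  norm : ‖f‖ ≤ C
  deriv : ∀ j ψ, ‖pair f (Dop j ψ)‖ ≤ C * n2 ψ
  weight : ∀ j ψ, ‖pair f (Xop j ψ)‖ ≤ C * n2 ψ

theorem isClosed_sigmaBound (C : ℝ) : IsClosed {f : L2 N | SigmaBound C f} := by
  have : {f : L2 N | SigmaBound C f} = {f | ‖f‖ ≤ C} ∩
      ((⋂ j, ⋂ ψ, {f | ‖pair f (Dop j ψ)‖ ≤ C * n2 ψ}) ∩ ⋂ j, ⋂ ψ, {f | ‖pair f (Xop j ψ)‖ ≤ C * n2 ψ}) := by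
    ext f
    simp only [Set.mem_inter_iff, Set.mem_iInter, Set.mem_ofPred_eq]
    exact ⟨fun h => ⟨h.1, h.2, h.3⟩, fun h => ⟨h.1, h.2.1, h.2.2⟩⟩
  rw [this]
  exact (isClosed_le continuous_norm continuous_const).inter
    ((isClosed_iInter fun j => isClosed_iInter fun ψ =>
      isClosed_le (continuous_pair_left _).norm continuous_const).inter
    (isClosed_iInter fun j => isClosed_iInter fun ψ =>
      isClosed_le (continuous_pair_left _).norm continuous_const))

/-- One power of the weight is spent on the factor `x_j`. What is left of the weighted `L^∞` bounds
is `⟨x⟩^{-(m-1)}`, square integrable because `m > N/2 + 1`. -/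
theorem SmoothBound.sigmaBound {k n m : ℕ} (hm : (N : ℝ) / 2 + 1 < m) (hn : 1 ≤ 2 * n) {M : ℝ}
    (hM : 0 ≤ M) {F : Space N → ℂ} {f : L2 N} (h : SmoothBound k n m M F) (hfF : f =ᵐ[volume] F) :
    SigmaBound ((eLpNorm (fun x : Space N => bracket x ^ (-((m : ℝ) - 1))) 2 volume).toReal * M) f := by
  have hG := memLp_bracket_rpow (N := N) (r := (m : ℝ) - 1) (by linarith)
  have hGM := hG.const_mul M
  have hnorm : (eLpNorm (fun x : Space N => M * bracket x ^ (-((m : ℝ) - 1))) 2 volume).toReal =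
      (eLpNorm (fun x : Space N => bracket x ^ (-((m : ℝ) - 1))) 2 volume).toReal * M := by
    have := eLpNorm_const_smul (M : ℝ) (fun x : Space N => bracket x ^ (-((m : ℝ) - 1))) 2 volume
    have e : (M • fun x : Space N => bracket x ^ (-((m : ℝ) - 1))) =
      fun x => M * bracket x ^ (-((m : ℝ) - 1)) := by funext x; simp
    rw [e] at this
    rw [this, ENNReal.toReal_mul, toReal_enorm, Real.norm_of_nonneg hM, mul_comm]
  have hpt : ∀ (a : ℝ) (x : Space N), bracket x ^ m * a ≤ M → bracket x * a ≤ M * bracket x ^ (-((m : ℝ) - 1)) := by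
    intro a x ha
    have hb := bracket_pos x
    rw [Real.rpow_neg hb.le, Real.rpow_sub_one hb.ne', Real.rpow_natCast, inv_div, ← mul_div_assoc,
      le_div_iff₀ (by positivity)]
    calc bracket x * a * bracket x ^ m = (bracket x ^ m * a) * bracket x := by ring
      _ ≤ _ := by gcongr
  have hpt' : ∀ (a : ℝ) (x : Space N), 0 ≤ a → bracket x ^ m * a ≤ M → a ≤ M * bracket x ^ (-((m : ℝ) - 1)) :=
    fun a x ha h => (le_mul_of_one_le_left ha (one_le_bracket x)).trans (hpt a x h)
  have h0 : ∀ x, bracket x ^ m * ‖F x‖ ≤ M := fun x => by simpa using h.low 0 (by simp) x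
  refine ⟨?_, fun j ψ => ?_, fun j ψ => ?_⟩
  · rw [← hnorm, Lp.norm_def]
    refine ENNReal.toReal_mono hGM.2.ne (eLpNorm_mono_ae ?_)
    filter_upwards [hfF] with x hx
    rw [hx]
    exact (hpt' _ x (norm_nonneg _) (h0 x)).trans (le_abs_self _)
  · have e := integral_mono_pd h.smooth hfF [j] [] (fun i hi => h.bounded i (by simp at hi; lia)) ψ
    have e2 : pair f (Dop j ψ) = pair f (Dl [j].reverse (Xl [] ψ)) := rfl
    rw [e2, e, ← hnorm, norm_mul, norm_pow, norm_neg, norm_one, one_pow, one_mul]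
    refine norm_integral_mul_le_of_memLp hGM ψ (Eventually.of_forall fun x => ?_)
    refine hpt' _ x (norm_nonneg _) (le_trans ?_ (h.low 1 hn x))
    have := bracket_pos x
    gcongr
    simpa [mono] using norm_pd_le h.smooth [j] x
  · rw [← hnorm, pair_eq]
    have e : ∫ x, (Xop j ψ) x * f x = ∫ x, ψ x * (coord j x * F x) := by
      refine integral_congr_ae ?_
      filter_upwards [hfF] with x hx
      rw [hx, Xop_apply]
      ring
    rw [e]
    refine norm_integral_mul_le_of_memLp hGM ψ (Eventually.of_forall fun x => ?_)
    refine le_trans ?_ (hpt _ x (h0 x))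
    rw [norm_mul]
    gcongr
    exact (abs_coord_le j x).trans (norm_le_bracket x)

theorem exists_sigmaBound {k n m : ℕ} (hk : (N : ℝ) / 2 < k) (hm : (N : ℝ) / 2 + 1 < m)
    (hn : 1 ≤ 2 * n) : ∃ K : ℝ, 0 ≤ K ∧ ∀ (f : L2 N) (M : ℝ), 0 ≤ M → BoundTwo k n m M f →
      BoundInf n m M f → SigmaBound (K * M) f := by
  obtain ⟨K₁, hK1, hK₁⟩ := exists_regularization (N := N) k n m hk
  refine ⟨(eLpNorm (fun x : Space N => bracket x ^ (-((m : ℝ) - 1))) 2 volume).toReal * K₁,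
    by positivity, fun f M hM h2 hi => ?_⟩
  refine (isClosed_sigmaBound _).mem_of_tendsto (tendsto_PL_zero f) ?_
  filter_upwards [Ioc_mem_nhdsGT one_pos] with ε hε
  obtain ⟨F, hfF, hF, -⟩ := hK₁ f M hM h2 hi ε hε.1 hε.2
  rw [mul_assoc]
  exact hF.sigmaBound hm hn (by positivity) hfF

/-! ### Weak derivatives, the space `𝒳` and the norm of `Σ` in dual form -/

theorem iteratedLineDerivOp_apply (j : ℕ) (i : Fin j → Fin N) (T : 𝓢'(Space N, ℂ)) (ψ : Test N) :
    (LineDeriv.iteratedLineDerivOp (fun l => bvec (i l)) T : 𝓢'(Space N, ℂ)) ψ =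
      (-1) ^ j * T (Dl (List.ofFn i).reverse ψ) := by
  induction j generalizing ψ with
  | zero => simp [Dl]
  | succ j ih =>
    have e : (Fin.tail fun l => bvec (i l) : Fin j → Space N) = fun l => bvec (Fin.tail i l) := rfl
    rw [LineDeriv.iteratedLineDerivOp_succ_left, TemperedDistribution.lineDerivOp_apply_apply, e, ih,
      List.ofFn_succ, List.reverse_cons, Dl_append, map_neg, map_neg, pow_succ]
    simp [Dop, Dl]
    rfl

theorem isWeakDeriv_iff {j : ℕ} (i : Fin j → Fin N) (u v : L2 N) :
    IsWeakDeriv i u v ↔ ∀ ψ, pair v ψ = (-1) ^ j * pair u (Dl (List.ofFn i).reverse ψ) := by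
  constructor
  · intro h ψ
    exact (congrArg (fun T : 𝓢'(Space N, ℂ) => T ψ) h).symm.trans (iteratedLineDerivOp_apply j i _ ψ)
  · intro h
    ext ψ
    exact (iteratedLineDerivOp_apply j i _ ψ).trans (h ψ).symm

theorem MemX.exists_word_bound {k n m : ℕ} {φ : L2 N} (h : MemX k n m φ) (β : List (Fin N)) :
    ∃ M : ℝ, 0 ≤ M ∧ ∀ γ : List (Fin N), γ.length ≤ m →
      (β.length ≤ 2 * n → ∀ ψ, ‖pair φ (Dl β (Xl γ ψ))‖ ≤ M * n1 ψ) ∧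
      (2 * n + 1 ≤ β.length → β.length + γ.length ≤ 2 * n + 2 + k + m →
        ∀ ψ, ‖pair φ (Dl β (Xl γ ψ))‖ ≤ M * n2 ψ) := by
  by_cases hβ : β.length ≤ 2 * n + 2 + k + m
  swap
  · exact ⟨0, le_rfl, fun γ _ => ⟨fun h1 => by lia, fun _ h2 => by lia⟩⟩
  obtain ⟨v, hv, h1, h2, h3⟩ := h β.reverse.length (by simpa using hβ) β.reverse.get
  rw [List.length_reverse] at h1 h2 h3
  have hpair : ∀ γ ψ, ‖pair φ (Dl β (Xl γ ψ))‖ = ‖∫ x, ψ x * (mono γ x * v x)‖ := fun γ ψ => by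
    have := (isWeakDeriv_iff _ _ _).mp hv (Xl γ ψ)
    rw [List.ofFn_get, List.reverse_reverse] at this
    rw [← pair_Xl, this, norm_mul, norm_pow, norm_neg, norm_one, one_pow, one_mul]
  have hmono : ∀ (γ : List (Fin N)) (w : ℕ) (x : Space N), γ.length ≤ w →
      ‖mono γ x * v x‖ ≤ ‖((bracket x ^ w : ℝ) : ℂ) * v x‖ := fun γ w x hw => by
    have := bracket_pos x
    rw [norm_mul, norm_mul, Complex.norm_real, Real.norm_of_nonneg (by positivity)]
    gcongr
    exact (norm_mono_le γ x).trans (pow_le_pow_right₀ (one_le_bracket x) hw)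
  by_cases hlow : β.length ≤ 2 * n
  · have hL := h1 hlow
    refine ⟨(eLpNorm (fun x => ((bracket x ^ m : ℝ) : ℂ) * v x) ∞ volume).toReal, by positivity,
      fun γ hγ => ⟨fun _ ψ => ?_, fun _ => by lia⟩⟩
    rw [hpair, n1, ← integral_const_mul]
    refine norm_integral_le_of_norm_le (ψ.integrable.norm.const_mul _) ?_
    have hae := ae_le_eLpNormEssSup (f := fun x => ((bracket x ^ m : ℝ) : ℂ) * v x) (μ := volume)
    filter_upwards [hae] with x hx
    rw [norm_mul, mul_comm]
    gcongr
    refine (hmono γ m x hγ).trans ?_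
    rw [← eLpNorm_exponent_top] at hx
    have := ENNReal.toReal_mono hL.2.ne hx
    rwa [toReal_enorm] at this
  -- Up to order `2n + 2 + k` the available weight is `⟨x⟩^m`, beyond it `⟨x⟩^{J-|β|}`. In both
  -- cases the constraint on `γ` says exactly that `x^γ` is dominated by that weight.
  · have hw : ∃ w : ℕ, (∀ l : ℕ, l ≤ m → β.length + l ≤ 2 * n + 2 + k + m → l ≤ w) ∧
        MemLp (fun x => ((bracket x ^ w : ℝ) : ℂ) * v x) 2 volume := by
      by_cases hmid : β.length ≤ 2 * n + 2 + k
      · exact ⟨m, fun _ hl _ => hl, h2 (by lia) hmid⟩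
      · exact ⟨_, fun _ _ hl => by lia, h3 (by lia)⟩
    obtain ⟨w, hw, hL⟩ := hw
    refine ⟨(eLpNorm (fun x => ‖((bracket x ^ w : ℝ) : ℂ) * v x‖) 2 volume).toReal, by positivity,
      fun γ hγ => ⟨fun _ => by lia, fun _ hsum ψ => ?_⟩⟩
    rw [hpair]
    exact norm_integral_mul_le_of_memLp hL.norm ψ (Eventually.of_forall fun x => hmono γ w x (hw _ hγ hsum))

theorem MemX.exists_bound {k n m : ℕ} {φ : L2 N} (h : MemX k n m φ) :
    ∃ M : ℝ, 0 ≤ M ∧ BoundTwo k n m M φ ∧ BoundInf n m M φ := by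
  choose B hB0 hB using h.exists_word_bound
  obtain ⟨M, hM⟩ := ((List.finite_length_le (Fin N) (2 * n + 2 + k + m)).image B).bddAbove
  have hM' : ∀ β : List (Fin N), β.length ≤ 2 * n + 2 + k + m → B β ≤ M := fun β hβ => hM ⟨β, hβ, rfl⟩
  refine ⟨M, (hB0 []).trans (hM' [] (by simp)), fun β γ h1 h2 h3 ψ => ?_, fun β γ h1 h2 ψ => ?_⟩
  · exact ((hB β γ h2).2 h1 h3 ψ).trans (mul_le_mul_of_nonneg_right (hM' β (by lia)) (n2_nonneg ψ))
  · exact ((hB β γ h2).1 h1 ψ).trans (mul_le_mul_of_nonneg_right (hM' β (by lia)) (n1_nonneg ψ))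

/-- `d j` and `x j` represent `f` tested against `∂_j ψ` and `x_j ψ`. -/
structure SigmaRep (f : L2 N) (d x : Fin N → L2 N) : Prop where
  deriv : ∀ j ψ, pair f (Dop j ψ) = pair (d j) ψ
  weight : ∀ j ψ, pair f (Xop j ψ) = pair (x j) ψ

theorem SigmaRep.sub {f g : L2 N} {d x d' x' : Fin N → L2 N} (h : SigmaRep f d x)
    (h' : SigmaRep g d' x') : SigmaRep (f - g) (d - d') (x - x') :=
  ⟨fun j ψ => by rw [pair_sub_left, h.deriv, h'.deriv, Pi.sub_apply, pair_sub_left],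
    fun j ψ => by rw [pair_sub_left, h.weight, h'.weight, Pi.sub_apply, pair_sub_left]⟩

theorem SigmaRep.norm_le {f : L2 N} {d x : Fin N → L2 N} (h : SigmaRep f d x) {C : ℝ} (hC : 0 ≤ C)
    (hf : SigmaBound C f) (j : Fin N) : ‖d j‖ ≤ C ∧ ‖x j‖ ≤ C :=
  ⟨norm_le_of_pair_le hC fun ψ => by rw [← h.deriv]; exact hf.deriv j ψ,
    norm_le_of_pair_le hC fun ψ => by rw [← h.weight]; exact hf.weight j ψ⟩

theorem SigmaBound.exists_rep {C : ℝ} (hC : 0 ≤ C) {f : L2 N} (h : SigmaBound C f) :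
    ∃ d x : Fin N → L2 N, SigmaRep f d x := by
  have h1 : ∀ j, ∃ g : L2 N, ∀ ψ, pair g ψ = pair f (Dop j ψ) := fun j => by
    obtain ⟨g, -, hg⟩ := exists_pair_eq (functional f [j] []) hC fun ψ => h.deriv j ψ
    exact ⟨g, hg⟩
  have h2 : ∀ j, ∃ g : L2 N, ∀ ψ, pair g ψ = pair f (Xop j ψ) := fun j => by
    obtain ⟨g, -, hg⟩ := exists_pair_eq (functional f [] [j]) hC fun ψ => h.weight j ψ
    exact ⟨g, hg⟩
  choose d hd using h1
  choose x hx using h2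
  exact ⟨d, x, fun j ψ => (hd j ψ).symm, fun j ψ => (hx j ψ).symm⟩

theorem norm_le_sum_abs_coord (x : Space N) : ‖x‖ ≤ ∑ j, ‖coord j x‖ := by
  have h0 : 0 ≤ ∑ j, ‖coord j x‖ := Finset.sum_nonneg fun _ _ => norm_nonneg _
  rw [EuclideanSpace.norm_eq, Real.sqrt_le_left h0]
  refine le_of_eq_of_le ?_ (Finset.sum_sq_le_sq_sum_of_nonneg fun j _ => norm_nonneg _)
  simp [coord]

theorem SigmaRep.sigmaENorm_le {f : L2 N} {d x : Fin N → L2 N} (h : SigmaRep f d x) :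
    sigmaENorm f ≤ ‖f‖ₑ + ∑ j, ‖d j‖ₑ + ∑ j, ‖x j‖ₑ := by
  refine add_le_add (add_le_add le_rfl (Finset.sum_le_sum fun j _ => ?_)) ?_
  -- Since `d j` represents the transposed derivative, the weak derivative is `-d j`.
  · have hw : IsWeakDeriv (fun _ : Fin 1 => j) f (-d j) := by
      rw [isWeakDeriv_iff]
      intro ψ
      have e : Dl (List.ofFn fun _ : Fin 1 => j).reverse ψ = Dop j ψ := by simp [Dl]
      have e' : pair (-d j) ψ = -pair (d j) ψ := by
        rw [← neg_one_smul ℂ (d j), pair_smul_left, neg_one_mul]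
      rw [e, h.deriv, e', pow_one, neg_one_mul]
    refine (iInf₂_le (-d j) hw).trans_eq ?_
    rw [enorm_neg]
  · have hx : ∀ j, (fun y => coord j y * f y) =ᵐ[volume] x j := fun j => by
      refine ae_eq_of_test ?_ (locallyIntegrable_L2 _) fun ψ => ?_
      · exact (locallyIntegrable_L2 f).continuous_mul (hasTemperateGrowth_coord j).1.continuous
      · rw [← pair_eq, ← h.weight, pair_eq]
        refine integral_congr_ae (Eventually.of_forall fun y => ?_)
        simp only [Xop_apply]
        ring
    have hall : ∀ᵐ y, ∀ j, coord j y * f y = x j y := ae_all_iff.mpr hx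
    have e : ∀ᵐ y, ‖((‖y‖ : ℝ) : ℂ) * f y‖ ≤ ‖(∑ j, fun y => ‖x j y‖) y‖ := by
      filter_upwards [hall] with y hy
      rw [Finset.sum_apply, norm_mul, Complex.norm_real, norm_norm,
        Real.norm_of_nonneg (Finset.sum_nonneg fun _ _ => norm_nonneg _)]
      simp_rw [← hy, norm_mul]
      rw [← Finset.sum_mul]
      gcongr
      exact norm_le_sum_abs_coord y
    refine (eLpNorm_mono_ae e).trans ((eLpNorm_sum_le (fun j _ => (Lp.aestronglyMeasurable (x j)).norm)
      (by norm_num)).trans_eq ?_)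
    refine Finset.sum_congr rfl fun j _ => ?_
    rw [eLpNorm_norm, Lp.enorm_def]

theorem SigmaRep.memSigma {f : L2 N} {d x : Fin N → L2 N} (h : SigmaRep f d x) : MemSigma f := by
  refine h.sigmaENorm_le.trans_lt ?_
  simp [ENNReal.sum_lt_top, enorm_lt_top]

theorem tendsto_sigmaENorm_sub {X : Type*} {l : Filter X} {u : X → L2 N} {u₀ : L2 N}
    {d x : X → Fin N → L2 N} {d₀ x₀ : Fin N → L2 N} (h : ∀ᶠ s in l, SigmaRep (u s) (d s) (x s))
    (h₀ : SigmaRep u₀ d₀ x₀) (hu : Tendsto u l (𝓝 u₀)) (hd : ∀ j, Tendsto (fun s => d s j) l (𝓝 (d₀ j)))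
    (hx : ∀ j, Tendsto (fun s => x s j) l (𝓝 (x₀ j))) :
    Tendsto (fun s => sigmaENorm (u s - u₀)) l (𝓝 0) := by
  have key : ∀ {g : X → L2 N} {g₀ : L2 N}, Tendsto g l (𝓝 g₀) → Tendsto (fun s => ‖g s - g₀‖ₑ) l (𝓝 0) := by
    intro g g₀ hg
    have := (continuous_enorm.tendsto (0 : L2 N)).comp (tendsto_sub_nhds_zero_iff.mpr hg)
    simpa [Function.comp_def] using this
  have hsum : Tendsto (fun s => ‖u s - u₀‖ₑ + ∑ j, ‖(d s - d₀) j‖ₑ + ∑ j, ‖(x s - x₀) j‖ₑ) l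
      (𝓝 (0 + ∑ _j : Fin N, 0 + ∑ _j : Fin N, 0)) :=
    ((key hu).add (tendsto_finsetSum _ fun j _ => key (hd j))).add
      (tendsto_finsetSum _ fun j _ => key (hx j))
  simp only [Finset.sum_const_zero, add_zero] at hsum
  refine tendsto_of_tendsto_of_tendsto_of_le_of_le' tendsto_const_nhds hsum
    (Eventually.of_forall fun _ => bot_le) ?_
  filter_upwards [h] with s hs
  exact (hs.sub h₀).sigmaENorm_le

/-- The commutation `PS_Xop` shows that `e^{zΔ}` acts on `Σ`. Both components are explicit images
under `e^{zΔ}`, so continuity in `Σ` reduces to strong continuity on `L²`. -/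
theorem SigmaRep.PL {f : L2 N} {d x : Fin N → L2 N} (h : SigmaRep f d x) {z : ℂ} (hz : 0 ≤ z.re) :
    SigmaRep (PL z f) (fun j => NLS.PL z (d j)) fun j => NLS.PL z (x j + (2 * z) • d j) := by
  refine ⟨fun j ψ => ?_, fun j ψ => ?_⟩
  · rw [pair_PL, PS_Dop, h.deriv, pair_PL]
  · rw [pair_PL, PS_Xop hz, pair_add, pair_smul, h.deriv, h.weight, pair_PL, pair_add_left, pair_smul_left]

/-! ### Multiplication by the quadratic phase -/

/-- Multiplication by `e^{ib|x|²/4}` on `L²`. -/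
def phaseL (b : ℝ) (f : L2 N) : L2 N := phaseMul (fun x => b * ‖x‖ ^ 2 / 4) (by fun_prop) f

theorem phaseL_ae (b : ℝ) (f : L2 N) :
    phaseL b f =ᵐ[volume] fun x => Complex.exp (((b * ‖x‖ ^ 2 / 4 : ℝ) : ℂ) * Complex.I) * f x :=
  (memLp_phase (θ := fun x => b * ‖x‖ ^ 2 / 4) (by fun_prop) f).coeFn_toLp

theorem hasTemperateGrowth_phase (b : ℝ) : (fun x : Space N =>
    Complex.exp (((b * ‖x‖ ^ 2 / 4 : ℝ) : ℂ) * Complex.I)).HasTemperateGrowth := by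
  refine hasTemperateGrowth_cexp ?_ fun x => by rw [Complex.re_ofReal_mul]; simp
  have h1 : (fun x : Space N => ((b * ‖x‖ ^ 2 / 4 : ℝ) : ℂ) * Complex.I) =
      fun x => (((b / 4 : ℝ) : ℂ) * Complex.I) * ((‖x‖ ^ 2 : ℝ) : ℂ) := by
    funext x; push_cast; ring
  rw [h1]
  fun_prop

/-- Multiplication by `e^{ib|x|²/4}` on Schwartz functions. -/
def phaseS (b : ℝ) : Test N →L[ℂ] Test N := SchwartzMap.smulLeftCLM ℂ
  fun x => Complex.exp (((b * ‖x‖ ^ 2 / 4 : ℝ) : ℂ) * Complex.I)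

theorem phaseS_apply (b : ℝ) (ψ : Test N) (x : Space N) :
    phaseS b ψ x = Complex.exp (((b * ‖x‖ ^ 2 / 4 : ℝ) : ℂ) * Complex.I) * ψ x := by
  rw [phaseS, SchwartzMap.smulLeftCLM_apply_apply (hasTemperateGrowth_phase b)]
  rfl

theorem pair_phaseL (b : ℝ) (f : L2 N) (ψ : Test N) : pair (phaseL b f) ψ = pair f (phaseS b ψ) := by
  rw [pair_eq, pair_eq]
  refine integral_congr_ae ?_
  filter_upwards [phaseL_ae b f] with x hx
  rw [hx, phaseS_apply]
  ring

theorem phaseL_add (b : ℝ) (f g : L2 N) : phaseL b (f + g) = phaseL b f + phaseL b g :=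
  pair_ext fun ψ => by simp [pair_phaseL, pair_add_left]

theorem phaseL_smul (b : ℝ) (c : ℂ) (f : L2 N) : phaseL b (c • f) = c • phaseL b f :=
  pair_ext fun ψ => by simp [pair_phaseL, pair_smul_left]

theorem norm_phaseL (b : ℝ) (f : L2 N) : ‖phaseL b f‖ = ‖f‖ := by
  rw [Lp.norm_def, Lp.norm_def]
  congr 1
  refine eLpNorm_congr_norm_ae ?_
  filter_upwards [phaseL_ae b f] with x hx
  rw [hx, norm_mul, Complex.norm_exp_ofReal_mul_I, one_mul]

/-- Multiplication by `e^{ib|x|²/4}` as a bounded operator. -/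
def phaseC (b : ℝ) : L2 N →L[ℂ] L2 N :=
  LinearMap.mkContinuous ⟨⟨phaseL b, phaseL_add b⟩, phaseL_smul b⟩ 1 fun f => by
    simpa using (norm_phaseL b f).le

theorem phaseC_apply (b : ℝ) (f : L2 N) : phaseC b f = phaseL b f := rfl

theorem phaseS_Xop (b : ℝ) (j : Fin N) (ψ : Test N) : phaseS b (Xop j ψ) = Xop j (phaseS b ψ) := by
  ext x
  simp only [phaseS_apply, Xop_apply]
  ring

theorem Dop_phaseS (b : ℝ) (j : Fin N) (ψ : Test N) :
    Dop j (phaseS b ψ) = phaseS b (Dop j ψ) + (b / 2 * Complex.I) • phaseS b (Xop j ψ) := by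
  ext x
  rw [add_apply, smul_apply, smul_eq_mul, Dop_apply]
  have h1 : HasFDerivAt (fun x : Space N => ‖x‖ ^ 2) (2 • innerSL ℝ x) x :=
    (hasStrictFDerivAt_norm_sq x).hasFDerivAt
  have h2 : HasFDerivAt (fun x : Space N => b * ‖x‖ ^ 2 / 4) ((4 : ℝ)⁻¹ • b • (2 • innerSL ℝ x)) x := by
    have := (h1.const_mul b).const_mul (4 : ℝ)⁻¹
    refine this.congr_of_eventuallyEq (Eventually.of_forall fun y => ?_)
    simp only
    ring
  have h2' : HasFDerivAt (fun x : Space N => ((b * ‖x‖ ^ 2 / 4 : ℝ) : ℂ) * Complex.I)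
      (((4 : ℝ)⁻¹ • b • (2 • innerSL ℝ x)).smulRight Complex.I) x := by
    refine (h2.smul_const Complex.I).congr_of_eventuallyEq (Eventually.of_forall fun y => ?_)
    exact (Complex.real_smul).symm
  have h3 := h2'.cexp
  have h4 := h3.mul (ψ.differentiableAt (x := x) : DifferentiableAt ℝ ψ x).hasFDerivAt
  have h5 := h4.congr_of_eventuallyEq (f₁ := phaseS b ψ) (Eventually.of_forall (phaseS_apply b ψ))
  rw [h5.fderiv]
  simp [phaseS_apply, Dop_apply, Xop_apply, coord, EuclideanSpace.inner_single_right]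
  ring

theorem SigmaRep.phaseL {f : L2 N} {d x : Fin N → L2 N} (h : SigmaRep f d x) (b : ℝ) :
    SigmaRep (phaseL b f) (fun j => NLS.phaseL b (d j) - (b / 2 * Complex.I) • NLS.phaseL b (x j))
      fun j => NLS.phaseL b (x j) := by
  have hw : ∀ j ψ, pair (NLS.phaseL b f) (Xop j ψ) = pair (NLS.phaseL b (x j)) ψ := fun j ψ => by
    rw [pair_phaseL, phaseS_Xop, h.weight, pair_phaseL]
  refine ⟨fun j ψ => ?_, hw⟩
  have e : phaseS b (Dop j ψ) = Dop j (phaseS b ψ) - (b / 2 * Complex.I) • phaseS b (Xop j ψ) := by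
    rw [Dop_phaseS, add_sub_cancel_right]
  rw [pair_phaseL, e, pair_sub, h.deriv, pair_smul, ← pair_phaseL b f, hw, pair_sub_left, pair_smul_left,
    pair_phaseL b (d j)]

/-! ### The pseudo-conformal transformation -/

theorem PS_apply_eq_integral (z : ℂ) (ψ : Test N) (x : Space N) :
    PS z ψ x = ∫ ξ, Complex.exp (2 * Real.pi * Complex.I * (inner ℝ x ξ : ℝ)) * symb z ξ * (𝓕 ψ) ξ := by
  rw [PS, SchwartzMap.fourierMultiplierCLM_apply, SchwartzMap.fourierInv_coe, Real.fourierInv_eq']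
  refine integral_congr_ae (Eventually.of_forall fun ξ => ?_)
  simp only [SchwartzMap.smulLeftCLM_apply_apply (hasTemperateGrowth_symb z), smul_eq_mul]
  rw [← mul_assoc, real_inner_comm]
  congr 3
  push_cast
  ring

/-- The Fourier transform is moved from `ψ` to the Gaussian symbol times the character of `x`, whose
transform is known. Both functions are integrable because `Re z > 0`. -/
theorem PS_apply_eq_gaussian {z : ℂ} (hz : 0 < z.re) (ψ : Test N) (x : Space N) :
    PS z ψ x = ∫ y, (Real.pi / (4 * Real.pi ^ 2 * z)) ^ (N / 2 : ℂ) *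
      Complex.exp (-Real.pi ^ 2 * ‖x - y‖ ^ 2 / (4 * Real.pi ^ 2 * z)) * ψ y := by
  set b : ℂ := 4 * Real.pi ^ 2 * z with hb
  have hbre : 0 < b.re := by
    have : b = ((4 * Real.pi ^ 2 : ℝ) : ℂ) * z := by rw [hb]; push_cast; ring
    rw [this, Complex.re_ofReal_mul]
    have := Real.pi_pos
    positivity
  have hF := GaussianFourier.integrable_cexp_neg_mul_sq_norm_add hbre (2 * Real.pi * Complex.I) x
  have h := integral_fourier_mul_eq_of_integrable hF ψ.integrable
  rw [PS_apply_eq_integral]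
  have h1 := fun w => fourier_gaussian_innerProductSpace' hbre x w
  simp only [h1, finrank_euclideanSpace, Fintype.card_fin] at h
  rw [h]
  refine integral_congr_ae (Eventually.of_forall fun ξ => ?_)
  simp only [symb, rightHalf_of_nonneg hz.le, ← Complex.exp_add, SchwartzMap.fourier_coe]
  congr 2
  rw [hb]
  push_cast
  ring

theorem continuous_symb (ξ : Space N) : Continuous fun z : ℂ => symb z ξ := by
  have := continuous_rightHalf
  unfold symb
  fun_prop

/-- The kernel formula for the Schrödinger group. -/
theorem PS_apply_eq_kernel {t : ℝ} (ht : 0 < t) (ψ : Test N) (x : Space N) :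
    PS (t * Complex.I) ψ x = (Real.pi / (4 * Real.pi ^ 2 * (t * Complex.I))) ^ (N / 2 : ℂ) *
      ∫ y, Complex.exp (((‖x - y‖ ^ 2 / (4 * t) : ℝ) : ℂ) * Complex.I) * ψ y := by
  have hpi : (Real.pi : ℂ) ≠ 0 := by simp [Real.pi_ne_zero]
  have ht' : (t : ℂ) ≠ 0 := by exact_mod_cast ht.ne'
  -- The imaginary time is approached from inside the right half plane, where the Gaussian formula
  -- holds. Both sides converge by dominated convergence as `ε → 0`.
  set z : ℝ → ℂ := fun ε => ε + t * Complex.I with hz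
  have hzc : Continuous z := by fun_prop
  have hz0 : z 0 = t * Complex.I := by simp [hz]
  have hL : Tendsto (fun ε => PS (z ε) ψ x) (𝓝[>] 0) (𝓝 (PS (t * Complex.I) ψ x)) := by
    simp_rw [PS_apply_eq_integral]
    refine tendsto_integral_filter_of_dominated_convergence (fun ξ => ‖(𝓕 ψ) ξ‖) ?_ ?_
      (𝓕 ψ).integrable.norm ?_
    · refine Eventually.of_forall fun ε => Continuous.aestronglyMeasurable ?_
      have := (hasTemperateGrowth_symb (N := N) (z ε)).1.continuous
      have := (𝓕 ψ).continuous
      fun_prop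
    · refine Eventually.of_forall fun ε => Eventually.of_forall fun ξ => ?_
      rw [norm_mul, norm_mul]
      have h1 : ‖Complex.exp (2 * Real.pi * Complex.I * (inner ℝ x ξ : ℝ))‖ = 1 := by
        have : (2 * Real.pi * Complex.I * (inner ℝ x ξ : ℝ) : ℂ) =
          ((2 * Real.pi * inner ℝ x ξ : ℝ) : ℂ) * Complex.I := by push_cast; ring
        rw [this, Complex.norm_exp_ofReal_mul_I]
      rw [h1, one_mul]
      exact mul_le_of_le_one_left (norm_nonneg _) (norm_symb_le _ _)
    · refine Eventually.of_forall fun ξ => Tendsto.mono_left ?_ nhdsWithin_le_nhds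
      have hc : Continuous fun ε => Complex.exp (2 * Real.pi * Complex.I * (inner ℝ x ξ : ℝ)) *
          symb (z ε) ξ * (𝓕 ψ) ξ := by
        have := (continuous_symb ξ).comp hzc
        exact (continuous_const.mul this).mul continuous_const
      have := hc.tendsto 0
      rwa [hz0] at this
  have hne : ∀ ε, z ε ≠ 0 := fun ε h => by
    have := congrArg Complex.im h
    simp [hz] at this
    exact ht.ne' this
  have hne' : ∀ ε, 4 * (Real.pi : ℂ) ^ 2 * z ε ≠ 0 := fun ε => by
    exact mul_ne_zero (by simp [Real.pi_ne_zero]) (hne ε)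
  have hR : Tendsto (fun ε => ∫ y, (Real.pi / (4 * Real.pi ^ 2 * z ε)) ^ (N / 2 : ℂ) *
      Complex.exp (-Real.pi ^ 2 * ‖x - y‖ ^ 2 / (4 * Real.pi ^ 2 * z ε)) * ψ y) (𝓝[>] 0)
      (𝓝 ((Real.pi / (4 * Real.pi ^ 2 * (t * Complex.I))) ^ (N / 2 : ℂ) *
      ∫ y, Complex.exp (((‖x - y‖ ^ 2 / (4 * t) : ℝ) : ℂ) * Complex.I) * ψ y)) := by
    simp_rw [mul_assoc (_ ^ (N / 2 : ℂ)), integral_const_mul]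
    refine Tendsto.mul ?_ ?_
    · refine Tendsto.mono_left ?_ nhdsWithin_le_nhds
      -- The limiting base is a nonzero imaginary number, away from the cut of the power function,
      -- so the branch is continuous there.
      have hslit : (Real.pi : ℂ) / (4 * Real.pi ^ 2 * z 0) ∈ Complex.slitPlane := by
        have e : (Real.pi : ℂ) / (4 * Real.pi ^ 2 * z 0) = ((-(1 / (4 * Real.pi * t)) : ℝ) : ℂ) * Complex.I := by
          rw [hz0]
          push_cast
          field_simp
          rw [Complex.I_sq, neg_neg]
        rw [e, Complex.mem_slitPlane_iff]
        right
        have := Real.pi_pos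
        simp [ht.ne', Real.pi_ne_zero]
      have hc : ContinuousAt (fun ε => ((Real.pi : ℂ) / (4 * Real.pi ^ 2 * z ε)) ^ (N / 2 : ℂ)) 0 := by
        refine ContinuousAt.cpow ?_ continuousAt_const hslit
        exact continuousAt_const.div (by fun_prop) (hne' 0)
      have := hc.tendsto
      rwa [hz0] at this
    · refine tendsto_integral_filter_of_dominated_convergence (fun y => ‖ψ y‖) ?_ ?_
        ψ.integrable.norm ?_
      · refine Eventually.of_forall fun ε => Continuous.aestronglyMeasurable ?_
        have := ψ.continuous
        fun_prop
      · filter_upwards [self_mem_nhdsWithin] with ε hε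
        refine Eventually.of_forall fun y => ?_
        rw [norm_mul]
        refine mul_le_of_le_one_left (norm_nonneg _) ?_
        have e : -(Real.pi : ℂ) ^ 2 * ‖x - y‖ ^ 2 / (4 * Real.pi ^ 2 * z ε) =
            ((-(‖x - y‖ ^ 2 / 4) : ℝ) : ℂ) * (z ε)⁻¹ := by
          have := hne ε
          push_cast
          field_simp
        rw [Complex.norm_exp, Real.exp_le_one_iff, e, Complex.re_ofReal_mul, Complex.inv_re]
        refine mul_nonpos_of_nonpos_of_nonneg (by simp; positivity) (div_nonneg ?_ (Complex.normSq_nonneg _))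
        simpa [hz] using (Set.mem_Ioi.mp hε).le
      · refine Eventually.of_forall fun y => Tendsto.mono_left ?_ nhdsWithin_le_nhds
        have hc : Continuous fun ε =>
            Complex.exp (-Real.pi ^ 2 * ‖x - y‖ ^ 2 / (4 * Real.pi ^ 2 * z ε)) * ψ y := by
          refine Continuous.mul (Complex.continuous_exp.comp ?_) continuous_const
          exact continuous_const.div (by fun_prop) hne'
        have := hc.tendsto 0
        convert this using 4
        rw [hz0]
        push_cast
        field_simp
        rw [Complex.I_sq]
        ring
  have hEq : ∀ᶠ ε : ℝ in 𝓝[>] 0, PS (z ε) ψ x = ∫ y, (Real.pi / (4 * Real.pi ^ 2 * z ε)) ^ (N / 2 : ℂ) *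
      Complex.exp (-Real.pi ^ 2 * ‖x - y‖ ^ 2 / (4 * Real.pi ^ 2 * z ε)) * ψ y := by
    filter_upwards [self_mem_nhdsWithin] with ε hε
    exact PS_apply_eq_gaussian (by simpa [hz] using hε) ψ x
  exact tendsto_nhds_unique (hL.congr' hEq) hR

/-- The dilation `ψ ↦ ψ(τ ·)`. -/
def dilS {τ : ℝ} (hτ : τ ≠ 0) : Test N →L[ℂ] Test N :=
  SchwartzMap.compCLMOfContinuousLinearEquiv ℂ (ContinuousLinearEquiv.smulLeft (Units.mk0 τ hτ))

theorem dilS_apply {τ : ℝ} (hτ : τ ≠ 0) (ψ : Test N) (x : Space N) : dilS hτ ψ x = ψ (τ • x) := rfl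

/-- The pseudo-conformal identity. After the substitution `y ↦ y/τ` with `τ = 1 + bt`, the quadratic
phases on both sides coincide, as `τ/(4t) = b/4 + 1/(4t)`. The power of `τ` combines the kernel
normalization with the Jacobian. -/
theorem phaseS_PS {b t : ℝ} (ht : 0 < t) (hτ : 0 < 1 + b * t) (ψ : Test N) :
    phaseS b (PS (t * Complex.I) ψ) = PS ((t / (1 + b * t) : ℝ) * Complex.I)
      ((((1 + b * t) ^ ((N : ℝ) / 2) : ℝ) : ℂ) • phaseS (b * (1 + b * t)) (dilS hτ.ne' ψ)) := by
  set τ := 1 + b * t with hτd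
  ext x
  rw [phaseS_apply, PS_apply_eq_kernel ht, PS_apply_eq_kernel (by positivity)]
  have hc : ((Real.pi : ℂ) / (4 * Real.pi ^ 2 * ((t / τ : ℝ) * Complex.I))) ^ (N / 2 : ℂ) =
      ((τ ^ ((N : ℝ) / 2) : ℝ) : ℂ) * ((Real.pi : ℂ) / (4 * Real.pi ^ 2 * (t * Complex.I))) ^ (N / 2 : ℂ) := by
    have hpi : (Real.pi : ℂ) ≠ 0 := by simp [Real.pi_ne_zero]
    have ht' : (t : ℂ) ≠ 0 := by exact_mod_cast ht.ne'
    have hτ' : (τ : ℂ) ≠ 0 := by exact_mod_cast hτ.ne'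
    have hv : (Real.pi : ℂ) / (4 * Real.pi ^ 2 * (t * Complex.I)) ≠ 0 :=
      div_ne_zero hpi (by simp [Real.pi_ne_zero, ht.ne'])
    have e : (Real.pi : ℂ) / (4 * Real.pi ^ 2 * ((t / τ : ℝ) * Complex.I)) =
        τ * (Real.pi / (4 * Real.pi ^ 2 * (t * Complex.I))) := by
      push_cast
      field_simp
    -- Multiplying the base by the positive real `τ` does not change its argument, so the complex
    -- power factorizes.
    rw [e, Complex.cpow_def_of_ne_zero (mul_ne_zero hτ' hv), Complex.log_ofReal_mul hτ hv,
      Complex.ofReal_cpow hτ.le, Complex.cpow_def_of_ne_zero hτ', Complex.cpow_def_of_ne_zero hv,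
      ← Complex.exp_add, Complex.ofReal_log hτ.le]
    congr 1
    push_cast
    ring
  rw [hc]
  have hint : ∫ y, Complex.exp (((‖x - y‖ ^ 2 / (4 * (t / τ)) : ℝ) : ℂ) * Complex.I) *
      ((((τ ^ ((N : ℝ) / 2) : ℝ) : ℂ) • phaseS (b * τ) (dilS hτ.ne' ψ)) : Test N) y =
      ((τ ^ (-((N : ℝ) / 2)) : ℝ) : ℂ) * (Complex.exp (((b * ‖x‖ ^ 2 / 4 : ℝ) : ℂ) * Complex.I) *
        ∫ y, Complex.exp (((‖x - y‖ ^ 2 / (4 * t) : ℝ) : ℂ) * Complex.I) * ψ y) := by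
    have h1 := Measure.integral_comp_inv_smul_of_nonneg (volume : Measure (Space N))
      (fun y => Complex.exp (((‖x - y‖ ^ 2 / (4 * (t / τ)) : ℝ) : ℂ) * Complex.I) *
      ((((τ ^ ((N : ℝ) / 2) : ℝ) : ℂ) • phaseS (b * τ) (dilS hτ.ne' ψ)) : Test N) y) hτ.le
    rw [finrank_euclideanSpace, Fintype.card_fin] at h1
    have h2 : ∀ y : Space N, Complex.exp (((‖x - τ⁻¹ • y‖ ^ 2 / (4 * (t / τ)) : ℝ) : ℂ) * Complex.I) *
      ((((τ ^ ((N : ℝ) / 2) : ℝ) : ℂ) • phaseS (b * τ) (dilS hτ.ne' ψ)) : Test N) (τ⁻¹ • y) =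
      ((τ ^ ((N : ℝ) / 2) : ℝ) : ℂ) * (Complex.exp (((b * ‖x‖ ^ 2 / 4 : ℝ) : ℂ) * Complex.I) *
        (Complex.exp (((‖x - y‖ ^ 2 / (4 * t) : ℝ) : ℂ) * Complex.I) * ψ y)) := by
      intro y
      rw [smul_apply, smul_eq_mul, phaseS_apply, dilS_apply, smul_smul, mul_inv_cancel₀ hτ.ne',
        one_smul]
      have h3 : Complex.exp (((‖x - τ⁻¹ • y‖ ^ 2 / (4 * (t / τ)) : ℝ) : ℂ) * Complex.I) *
          Complex.exp (((b * τ * ‖τ⁻¹ • y‖ ^ 2 / 4 : ℝ) : ℂ) * Complex.I) =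
          Complex.exp (((b * ‖x‖ ^ 2 / 4 : ℝ) : ℂ) * Complex.I) *
          Complex.exp (((‖x - y‖ ^ 2 / (4 * t) : ℝ) : ℂ) * Complex.I) := by
        rw [← Complex.exp_add, ← Complex.exp_add, ← add_mul, ← add_mul, ← Complex.ofReal_add,
          ← Complex.ofReal_add]
        congr 3
        rw [norm_sub_sq_real, norm_sub_sq_real, norm_smul, inner_smul_right, norm_inv,
          Real.norm_of_nonneg hτ.le]
        field_simp
        rw [hτd]
        ring
      linear_combination ((τ ^ ((N : ℝ) / 2) : ℝ) : ℂ) * ψ y * h3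
    simp_rw [h2, integral_const_mul] at h1
    have h4 : ((τ ^ (-((N : ℝ) / 2)) : ℝ) : ℂ) * ((τ ^ N : ℝ) : ℂ) = ((τ ^ ((N : ℝ) / 2) : ℝ) : ℂ) := by
      rw [← Complex.ofReal_mul, ← Real.rpow_natCast, ← Real.rpow_add hτ]
      congr 2
      ring
    have h5 : ((τ ^ N : ℝ) : ℂ) ≠ 0 := by exact_mod_cast (pow_pos hτ N).ne'
    rw [Complex.real_smul] at h1
    refine mul_left_cancel₀ h5 (h1.symm.trans ?_)
    rw [← h4]
    ring
  rw [hint]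
  have h6 : ((τ ^ ((N : ℝ) / 2) : ℝ) : ℂ) * ((τ ^ (-((N : ℝ) / 2)) : ℝ) : ℂ) = 1 := by
    rw [← Complex.ofReal_mul, ← Real.rpow_add hτ, add_neg_cancel, Real.rpow_zero, Complex.ofReal_one]
  linear_combination (-(Complex.exp (((b * ‖x‖ ^ 2 / 4 : ℝ) : ℂ) * Complex.I) *
    ((Real.pi : ℂ) / (4 * Real.pi ^ 2 * (t * Complex.I))) ^ (N / 2 : ℂ) *
    ∫ y, Complex.exp (((‖x - y‖ ^ 2 / (4 * t) : ℝ) : ℂ) * Complex.I) * ψ y)) * h6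

/-- The transpose of `phaseS_PS`: the propagator at time `t/(1+bt)` cancels against the one on the
right, and only a phase and a dilation remain. -/
theorem PL_phaseL_PL_ae {b t : ℝ} (ht : 0 ≤ t) (hτ : 0 < 1 + b * t) (f : L2 N) :
    PL (t * Complex.I) (phaseL b (PL (-((t / (1 + b * t) : ℝ) * Complex.I)) f)) =ᵐ[volume] fun x =>
      (((1 + b * t) ^ (-((N : ℝ) / 2)) : ℝ) : ℂ) *
        (Complex.exp (((b / (1 + b * t) * ‖x‖ ^ 2 / 4 : ℝ) : ℂ) * Complex.I) * f ((1 + b * t)⁻¹ • x)) := by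
  rcases ht.eq_or_lt with rfl | ht
  · simp only [mul_zero, add_zero, Complex.ofReal_zero, zero_mul, neg_zero, PL_zero,
      Real.one_rpow, Complex.ofReal_one, one_mul, inv_one, one_smul, div_one]
    exact phaseL_ae b f
  set τ := 1 + b * t with hτd
  have hmem : MemLp (fun x => f (τ⁻¹ • x)) 2 volume := by
    refine MemLp.comp_of_map (g := f) ?_ (by fun_prop)
    rw [Measure.map_addHaar_smul _ (inv_ne_zero hτ.ne')]
    exact (Lp.memLp f).smul_measure ENNReal.ofReal_ne_top
  refine ae_eq_of_test (locallyIntegrable_L2 _) ?_ fun ψ => ?_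
  · exact ((hmem.locallyIntegrable (by norm_num)).continuous_mul (by fun_prop)).continuous_mul
      continuous_const
  · have hneg : 0 ≤ (-((t / τ : ℝ) * Complex.I)).re := by simp
    have hpos : 0 ≤ ((t / τ : ℝ) * Complex.I : ℂ).re := by simp
    rw [← pair_eq, pair_PL, pair_phaseL, pair_PL, phaseS_PS ht hτ, PS_PS hneg hpos, neg_add_cancel,
      PS_zero, pair_eq]
    have h1 := Measure.integral_comp_inv_smul_of_nonneg (volume : Measure (Space N))
      (fun y => ((((τ ^ ((N : ℝ) / 2) : ℝ) : ℂ) • phaseS (b * τ) (dilS hτ.ne' ψ)) : Test N) y * f y) hτ.le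
    rw [finrank_euclideanSpace, Fintype.card_fin] at h1
    have h4 : ((τ ^ ((N : ℝ) / 2) : ℝ) : ℂ) = ((τ ^ (-((N : ℝ) / 2)) : ℝ) : ℂ) * ((τ ^ N : ℝ) : ℂ) := by
      rw [← Complex.ofReal_mul, ← Real.rpow_natCast, ← Real.rpow_add hτ]
      congr 2
      ring
    have h5 : ((τ ^ N : ℝ) : ℂ) ≠ 0 := by exact_mod_cast (pow_pos hτ N).ne'
    rw [Complex.real_smul] at h1
    refine mul_left_cancel₀ h5 (h1.symm.trans ?_)
    rw [← integral_const_mul]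
    refine integral_congr_ae (Eventually.of_forall fun x => ?_)
    simp only [smul_apply, smul_eq_mul, phaseS_apply, dilS_apply, smul_smul, mul_inv_cancel₀ hτ.ne',
      one_smul, norm_smul, norm_inv, Real.norm_of_nonneg hτ.le]
    have h6 : b * τ * (τ⁻¹ * ‖x‖) ^ 2 / 4 = b / τ * ‖x‖ ^ 2 / 4 := by field_simp
    rw [h6, h4]
    ring

/-! ### The transformed equation -/

/-- The transformed time `t / (1 + bt)`, extended by `0` to negative times. -/
def sFun (b t : ℝ) : ℝ := max t 0 / (1 + b * max t 0)

/-- The weight `(1 + bt)^(-p)`, extended by `1` to negative times. -/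
def wFun (p b t : ℝ) : ℝ := (1 + b * max t 0) ^ (-p)

theorem one_le_one_add {b : ℝ} (hb : 0 < b) (t : ℝ) : 1 ≤ 1 + b * max t 0 := by
  have : 0 ≤ b * max t 0 := by positivity
  linarith

theorem continuous_sFun {b : ℝ} (hb : 0 < b) : Continuous (sFun b) := by
  have := fun t => (zero_lt_one.trans_le (one_le_one_add hb t)).ne'
  unfold sFun
  fun_prop (disch := assumption)

theorem continuous_wFun (p : ℝ) {b : ℝ} (hb : 0 < b) : Continuous (wFun p b) := by
  unfold wFun
  exact Continuous.rpow_const (by fun_prop) fun t =>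
    Or.inl (zero_lt_one.trans_le (one_le_one_add hb t)).ne'

theorem sFun_nonneg {b : ℝ} (hb : 0 < b) (t : ℝ) : 0 ≤ sFun b t := by
  unfold sFun; positivity

theorem sFun_le {b : ℝ} (hb : 0 < b) (t : ℝ) : sFun b t ≤ 1 / b := by
  have := one_le_one_add hb t
  rw [sFun, div_le_div_iff₀ (by linarith) hb]
  linarith

theorem wFun_nonneg (p : ℝ) {b : ℝ} (hb : 0 < b) (t : ℝ) : 0 ≤ wFun p b t := by
  unfold wFun; positivity

theorem integral_wFun {p : ℝ} (hp : 1 < p) {b : ℝ} (hb : 0 < b) {a c : ℝ} (ha : 0 ≤ a) (hac : a ≤ c) :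
    ∫ t in a..c, wFun p b t = ((1 + b * a) ^ (1 - p) - (1 + b * c) ^ (1 - p)) / (b * (p - 1)) := by
  have hp' : p - 1 ≠ 0 := by linarith
  rw [intervalIntegral.integral_eq_sub_of_hasDerivAt (f := fun t => -((1 + b * t) ^ (1 - p) / (b * (p - 1))))
    (fun t ht => ?_) ((continuous_wFun p hb).intervalIntegrable _ _)]
  · ring
  · rw [Set.uIcc_of_le hac] at ht
    have ht0 : 0 ≤ t := ha.trans ht.1
    have h1 : HasDerivAt (fun t => 1 + b * t) b t := by
      simpa using ((hasDerivAt_id t).const_mul b).const_add 1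
    have h2 := ((h1.rpow_const (p := 1 - p) (Or.inl (by positivity))).div_const (b * (p - 1))).neg
    refine h2.congr_deriv ?_
    rw [wFun, max_eq_left ht0, show 1 - p - 1 = -p by ring]
    field_simp
    ring

theorem integral_wFun_le {p : ℝ} (hp : 1 < p) {b : ℝ} (hb : 0 < b) {a c : ℝ} (ha : 0 ≤ a) (hac : a ≤ c) :
    ∫ t in a..c, wFun p b t ≤ (1 + b * a) ^ (1 - p) / (b * (p - 1)) := by
  rw [integral_wFun hp hb ha hac]
  have hc : 0 ≤ c := ha.trans hac
  have : 0 < p - 1 := by linarith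
  gcongr
  have : 0 ≤ (1 + b * c) ^ (1 - p) := by positivity
  linarith

/-- With `p = Nα/2 > 1` the bound is uniform in `c`, which makes the result global and gives
scattering, and it carries the factor `1/b`, which is the only source of smallness in the Duhamel
term. -/
theorem integral_wFun_le_inv {p : ℝ} (hp : 1 < p) {b : ℝ} (hb : 0 < b) {c : ℝ} (hc : 0 ≤ c) :
    ∫ t in (0 : ℝ)..c, wFun p b t ≤ (p - 1)⁻¹ / b := by
  refine (integral_wFun_le hp hb le_rfl hc).trans_eq ?_
  rw [mul_zero, add_zero, Real.one_rpow]
  field_simp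

/-- The pairing with a test function as a bounded functional. -/
def pairC (ψ : Test N) : L2 N →L[ℂ] ℂ :=
  ⟨⟨⟨fun f => pair f ψ, fun f g => pair_add_left f g ψ⟩, fun c f => pair_smul_left c f ψ⟩,
    continuous_pair_left ψ⟩

theorem norm_pair_integral_le {h : ℝ → L2 N} (hh : Continuous h) {w : ℝ → ℝ} (hw : Continuous w)
    {ψ : Test N} {C : ℝ} (hb : ∀ t, ‖pair (h t) ψ‖ ≤ w t * C) {a c : ℝ} (hac : a ≤ c) :
    ‖pair (∫ t in a..c, h t) ψ‖ ≤ (∫ t in a..c, w t) * C := by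
  have e : pair (∫ t in a..c, h t) ψ = ∫ t in a..c, pair (h t) ψ :=
    ((pairC ψ).intervalIntegral_comp_comm (hh.intervalIntegrable a c)).symm
  rw [e, ← intervalIntegral.integral_mul_const]
  exact intervalIntegral.norm_integral_le_of_norm_le hac (Eventually.of_forall fun t _ => hb t)
    ((hw.mul continuous_const).intervalIntegrable _ _)

theorem norm_integral_le_mul {h : ℝ → L2 N} {w : ℝ → ℝ} (hw : Continuous w)
    {C : ℝ} (hb : ∀ t, ‖h t‖ ≤ w t * C) {a c : ℝ} (hac : a ≤ c) :
    ‖∫ t in a..c, h t‖ ≤ (∫ t in a..c, w t) * C := by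
  rw [← intervalIntegral.integral_mul_const]
  exact intervalIntegral.norm_integral_le_of_norm_le hac (Eventually.of_forall fun t _ => hb t)
    ((hw.mul continuous_const).intervalIntegrable _ _)

theorem BoundTwo.add {k n m : ℕ} {M M' : ℝ} {f g : L2 N} (hf : BoundTwo k n m M f)
    (hg : BoundTwo k n m M' g) : BoundTwo k n m (M + M') (f + g) := fun β γ h1 h2 h3 ψ => by
  rw [pair_add_left, add_mul]
  exact (norm_add_le _ _).trans (add_le_add (hf β γ h1 h2 h3 ψ) (hg β γ h1 h2 h3 ψ))

theorem BoundInf.add {n m : ℕ} {M M' : ℝ} {f g : L2 N} (hf : BoundInf n m M f)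
    (hg : BoundInf n m M' g) : BoundInf n m (M + M') (f + g) := fun β γ h1 h2 ψ => by
  rw [pair_add_left, add_mul]
  exact (norm_add_le _ _).trans (add_le_add (hf β γ h1 h2 ψ) (hg β γ h1 h2 ψ))

theorem BoundTwo.smul {k n m : ℕ} {M : ℝ} {f : L2 N} (c : ℂ) (hf : BoundTwo k n m M f) :
    BoundTwo k n m (‖c‖ * M) (c • f) := fun β γ h1 h2 h3 ψ => by
  rw [pair_smul_left, norm_mul, mul_assoc]
  exact mul_le_mul_of_nonneg_left (hf β γ h1 h2 h3 ψ) (norm_nonneg c)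

theorem BoundInf.smul {n m : ℕ} {M : ℝ} {f : L2 N} (c : ℂ) (hf : BoundInf n m M f) :
    BoundInf n m (‖c‖ * M) (c • f) := fun β γ h1 h2 ψ => by
  rw [pair_smul_left, norm_mul, mul_assoc]
  exact mul_le_mul_of_nonneg_left (hf β γ h1 h2 ψ) (norm_nonneg c)

theorem BoundTwo.integral {k n m : ℕ} {C : ℝ} {h : ℝ → L2 N} (hh : Continuous h) {w : ℝ → ℝ}
    (hw : Continuous w) (hb : ∀ t, BoundTwo k n m (w t * C) (h t)) {a c : ℝ} (hac : a ≤ c) :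
    BoundTwo k n m ((∫ t in a..c, w t) * C) (∫ t in a..c, h t) := fun β γ h1 h2 h3 ψ => by
  rw [mul_assoc]
  exact norm_pair_integral_le hh hw (fun t => by rw [← mul_assoc]; exact hb t β γ h1 h2 h3 ψ) hac

theorem BoundInf.integral {n m : ℕ} {C : ℝ} {h : ℝ → L2 N} (hh : Continuous h) {w : ℝ → ℝ}
    (hw : Continuous w) (hb : ∀ t, BoundInf n m (w t * C) (h t)) {a c : ℝ} (hac : a ≤ c) :
    BoundInf n m ((∫ t in a..c, w t) * C) (∫ t in a..c, h t) := fun β γ h1 h2 ψ => by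
  rw [mul_assoc]
  exact norm_pair_integral_le hh hw (fun t => by rw [← mul_assoc]; exact hb t β γ h1 h2 ψ) hac

/-! ### The invariant set and the integral equation for the profile. -/

/-- The functions bounded by `M` in the weighted norms and `δ`-close to `φ`. -/
def profileSet (k n m : ℕ) (M δ : ℝ) (φ : L2 N) : Set (L2 N) :=
  {f | BoundTwo k n m M f ∧ BoundInf n m M f ∧
    ∀ γ : List (Fin N), γ.length ≤ m → ∀ ψ, ‖pair (f - φ) (Xl γ ψ)‖ ≤ δ * n1 ψ}

theorem isClosed_profileSet (k n m : ℕ) (M δ : ℝ) (φ : L2 N) : IsClosed (profileSet k n m M δ φ) := by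
  refine (isClosed_boundTwo k n m M).inter ((isClosed_boundInf n m M).inter ?_)
  change IsClosed {f : L2 N | ∀ γ : List (Fin N), γ.length ≤ m → ∀ ψ, ‖pair (f - φ) (Xl γ ψ)‖ ≤ δ * n1 ψ}
  simp only [Set.ofPred_forall]
  refine isClosed_iInter fun γ => isClosed_iInter fun _ => isClosed_iInter fun ψ => ?_
  exact isClosed_le ((continuous_pair_left _).comp (continuous_id.sub continuous_const)).norm continuous_const

theorem ae_lower_bound {k n m : ℕ} {M δ c : ℝ} {φ f : L2 N} (hf : f ∈ profileSet k n m M δ φ)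
    (hφ : ∀ᵐ x, c ≤ bracket x ^ m * ‖φ x‖) :
    ∀ᵐ x, c - (1 + N) ^ (m + 1) * δ ≤ bracket x ^ m * ‖f x‖ := by
  filter_upwards [ae_bracket_le hf.2.2, hφ, Lp.coeFn_sub f φ] with x h1 h2 h3
  rw [h3, Pi.sub_apply] at h1
  have h4 : ‖φ x‖ ≤ ‖f x - φ x‖ + ‖f x‖ := by
    have := norm_sub_le (f x) (f x - φ x)
    rw [sub_sub_cancel] at this
    linarith
  have h5 := mul_le_mul_of_nonneg_left h4 (by have := bracket_pos x; positivity : 0 ≤ bracket x ^ m)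
  rw [mul_add] at h5
  linarith

/-- The integrand of the transformed equation. -/
def source (α b : ℝ) (V : ℝ → L2 N) (t : ℝ) : L2 N :=
  ((wFun (N * α / 2) b t : ℝ) : ℂ) • PL (-((sFun b t : ℝ) * Complex.I)) (nonlinearity α (V t))

/-- The profile `φ + iλ ∫₀ᵗ w(s) e^{-is(s)Δ} |V|^α V ds`. -/
def profile (α b : ℝ) (lam : ℂ) (φ : L2 N) (V : ℝ → L2 N) (t : ℝ) : L2 N :=
  φ + (Complex.I * lam) • ∫ s in (0 : ℝ)..max t 0, source α b V s

theorem continuous_source {α b : ℝ} (hb : 0 < b) {V : ℝ → L2 N}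
    (hV : Continuous fun t => nonlinearity α (V t)) : Continuous (source α b V) := by
  unfold source
  have h1 := continuous_wFun (N * α / 2) hb
  have h2 := continuous_sFun hb
  exact (Complex.continuous_ofReal.comp h1).smul (continuous_PL_comp (by fun_prop) hV)

theorem continuous_profile {α b : ℝ} (hb : 0 < b) (lam : ℂ) (φ : L2 N) {V : ℝ → L2 N}
    (hV : Continuous fun t => nonlinearity α (V t)) : Continuous (profile α b lam φ V) := by
  have h1 := continuous_source hb hV
  have h2 : Continuous fun T => ∫ s in (0 : ℝ)..T, source α b V s :=
    intervalIntegral.continuous_primitive (fun a c => h1.intervalIntegrable a c) 0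
  have h3 : Continuous fun t : ℝ => ∫ s in (0 : ℝ)..max t 0, source α b V s :=
    h2.comp (continuous_id.max continuous_const)
  unfold profile
  fun_prop

theorem continuous_nonlinearity {α R : ℝ} (hα : 0 < α) {V : ℝ → L2 N} (hV : Continuous V)
    (hR : ∀ t, ∀ᵐ x, ‖V t x‖ ≤ R) : Continuous fun t => nonlinearity α (V t) := by
  rw [continuous_iff_continuousAt]
  intro t
  rw [ContinuousAt, tendsto_iff_norm_sub_tendsto_zero]
  have h0 := (tendsto_iff_norm_sub_tendsto_zero.mp (hV.tendsto t)).const_mul ((α + 1) * R ^ α)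
  rw [mul_zero] at h0
  exact squeeze_zero (fun _ => norm_nonneg _) (fun s => norm_nonlinearity_sub_le hα (hR s) (hR t)) h0

/-! ### The fixed point -/

theorem norm_profile_sub_le {α b D : ℝ} (hb : 0 < b) (hp : 1 < N * α / 2) (lam : ℂ) (φ : L2 N)
    {V W : ℝ → L2 N} (hV : Continuous fun t => nonlinearity α (V t))
    (hW : Continuous fun t => nonlinearity α (W t)) (hD : 0 ≤ D)
    (h : ∀ t, ‖nonlinearity α (V t) - nonlinearity α (W t)‖ ≤ D) (t : ℝ) :
    ‖profile α b lam φ V t - profile α b lam φ W t‖ ≤ ‖lam‖ * ((N * α / 2 - 1)⁻¹ / b * D) := by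
  rw [profile, profile, add_sub_add_left_eq_sub, ← smul_sub, norm_smul, norm_mul, Complex.norm_I, one_mul,
    ← intervalIntegral.integral_sub ((continuous_source hb hV).intervalIntegrable _ _)
      ((continuous_source hb hW).intervalIntegrable _ _)]
  gcongr
  refine (norm_integral_le_mul (continuous_wFun (N * α / 2) hb) (C := D) (fun s => ?_) (le_max_right _ _)).trans
    (mul_le_mul_of_nonneg_right (integral_wFun_le_inv hp hb (le_max_right _ _)) hD)
  rw [source, source, ← smul_sub, ← PL_sub, norm_smul, Complex.norm_real,
    Real.norm_of_nonneg (wFun_nonneg _ hb s)]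
  exact mul_le_mul_of_nonneg_left ((norm_PL_le _ _).trans (h s)) (wFun_nonneg _ hb s)

theorem norm_sFun_mul_I {b : ℝ} (hb : 0 < b) (t : ℝ) : ‖((sFun b t : ℝ) : ℂ) * Complex.I‖ = sFun b t := by
  rw [norm_mul, Complex.norm_I, mul_one, Complex.norm_real, Real.norm_of_nonneg (sFun_nonneg hb t)]

/-- Banach's theorem on the bounded continuous functions from `ℝ` to `S` with the supremum of the
`L²` distance. This space is complete because `S` is closed in `L²`, so a contraction in the
stronger norms that define `S` is not needed. -/
theorem exists_fixed_point {Φ : (ℝ → L2 N) → ℝ → L2 N} {S : Set (L2 N)} (hS : IsClosed S)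
    {φ : L2 N} (hφ : φ ∈ S) {B : ℝ} (hB : ∀ f ∈ S, ‖f‖ ≤ B)
    (hmem : ∀ V : ℝ → L2 N, Continuous V → (∀ t, V t ∈ S) → ∀ t, Φ V t ∈ S)
    (hcont : ∀ V : ℝ → L2 N, Continuous V → (∀ t, V t ∈ S) → Continuous (Φ V))
    (hlip : ∀ V W : ℝ → L2 N, Continuous V → Continuous W → (∀ t, V t ∈ S) → (∀ t, W t ∈ S) →
      ∀ D, (∀ t, ‖V t - W t‖ ≤ D) → ∀ t, ‖Φ V t - Φ W t‖ ≤ 1 / 2 * D) :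
    ∃ V : ℝ → L2 N, Continuous V ∧ (∀ t, V t ∈ S) ∧ ∀ t, V t = Φ V t := by
  have : CompleteSpace S := hS.completeSpace_coe
  have : Nonempty (BoundedContinuousFunction ℝ S) := ⟨BoundedContinuousFunction.const ℝ ⟨φ, hφ⟩⟩
  have hval : ∀ V : BoundedContinuousFunction ℝ S, Continuous fun t => (V t : L2 N) := fun V =>
    continuous_subtype_val.comp V.continuous
  obtain ⟨F, hF⟩ : ∃ F : BoundedContinuousFunction ℝ S → BoundedContinuousFunction ℝ S,
      ∀ V t, (F V t : L2 N) = Φ (fun t => V t) t :=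
    ⟨fun V => BoundedContinuousFunction.mkOfBound
      ⟨fun t => ⟨Φ (fun t => V t) t, hmem _ (hval V) (fun t => (V t).2) t⟩,
        (hcont _ (hval V) fun t => (V t).2).subtype_mk _⟩ (B + B) fun t s => by
      rw [Subtype.dist_eq, dist_eq_norm]
      exact (norm_sub_le _ _).trans (add_le_add (hB _ (Subtype.coe_prop _)) (hB _ (Subtype.coe_prop _))),
      fun V t => rfl⟩
  have hFc : ContractingWith (1 / 2) F := by
    refine ⟨by simp [← NNReal.coe_lt_coe]; norm_num, LipschitzWith.of_dist_le_mul fun V W => ?_⟩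
    refine (BoundedContinuousFunction.dist_le (by positivity)).mpr fun t => ?_
    rw [Subtype.dist_eq, dist_eq_norm, hF, hF]
    refine (hlip _ _ (hval V) (hval W) (fun t => (V t).2) (fun t => (W t).2) (dist V W)
      (fun s => ?_) t).trans_eq (by simp)
    rw [← dist_eq_norm]
    exact BoundedContinuousFunction.dist_coe_le_dist (f := V) (g := W) s
  obtain ⟨V, hV⟩ : ∃ V, F V = V := ⟨hFc.fixedPoint, hFc.fixedPoint_isFixedPt⟩
  refine ⟨fun t => V t, hval V, fun t => (V t).2, fun t => ?_⟩
  rw [← hF, hV]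

/-- The fixed point is sought in the set of functions bounded by `M` and `δ`-close to `φ` in
weighted `L^∞`. The closeness gives the lower bound required by the nonlinear estimate, and large
`b` makes the map preserve the set and contract. -/
theorem exists_profile_solution {k n m : ℕ} (hk : (N : ℝ) / 2 < k) (hm : (N : ℝ) / 2 + 1 < m)
    (hn : k + m + 1 ≤ 2 * n) {α : ℝ} (hα : 0 < α) (hmα : (N : ℝ) / 2 < m * α) (hp : 1 < N * α / 2)
    (lam : ℂ) {φ : L2 N} (hφ : MemX k n m φ)
    (hinf : ∃ c > 0, ∀ᵐ x ∂(volume : Measure (Space N)), c ≤ bracket x ^ m * ‖φ x‖) :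
    ∃ b₀ : ℝ, 1 ≤ b₀ ∧ ∀ b : ℝ, b₀ ≤ b → ∃ (V : ℝ → L2 N) (R C : ℝ), 0 ≤ C ∧ Continuous V ∧
      (∀ t, ∀ᵐ x, ‖V t x‖ ≤ R) ∧ (∀ t, BoundTwo k n m C (nonlinearity α (V t))) ∧
      (∀ t, BoundInf n m C (nonlinearity α (V t))) ∧
      ∀ t, V t = PL ((sFun b t : ℝ) * Complex.I) (profile α b lam φ V t) := by
  obtain ⟨M₀, hM₀, hφ2, hφi⟩ := hφ.exists_bound
  obtain ⟨c, hc, hφc⟩ := hinf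
  obtain ⟨K, hK1, hK⟩ := exists_PL_bound (N := N) k n m hk
  obtain ⟨Ks, hKs, hsig⟩ := exists_sigmaBound (N := N) hk hm (by lia : 1 ≤ 2 * n)
  -- `M₀` bounds `φ`, the summand `1` leaves room for the Duhamel term, and `K` is the cost of the
  -- propagator.
  set M := K * (M₀ + 1) with hM
  have hM0 : 0 ≤ M := by positivity
  obtain ⟨KN, hKN0, hKN⟩ := exists_nonlinearity_bound (N := N) hk hn hα hmα hM0 (half_pos hc)
  set A : ℝ := (1 + N) ^ (m + 1) with hA
  have hA0 : 0 < A := by positivity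
  -- With this `δ`, `ae_lower_bound` leaves `c - Aδ = c/2`, the lower bound for which `KN` was
  -- chosen.
  set δ := c / (2 * A) with hδ
  have hδ0 : 0 < δ := by positivity
  set R := A * M with hR
  set L := (α + 1) * R ^ α with hL
  have hL0 : 0 ≤ L := by positivity
  set Cw := (N * α / 2 - 1)⁻¹ with hCw
  have hCw0 : 0 ≤ Cw := inv_nonneg.mpr (by linarith)
  set T := ‖lam‖ * (Cw * (K * KN)) with hT
  have hT0 : 0 ≤ T := by positivity
  have hQ0 : 0 ≤ ‖lam‖ * (Cw * L) := by positivity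
  have hE0 : 0 ≤ (M + T) / δ := by positivity
  -- The summands serve four purposes: `1/b ≤ 1`, Duhamel term at most `1`, distance to `φ` at most
  -- `δ`, and contraction factor at most `1/2`.
  refine ⟨1 + T + (M + T) / δ + 2 * (‖lam‖ * (Cw * L)), by linarith, fun b hb => ?_⟩
  have hb1 : 1 ≤ b := by linarith
  have hb0 : 0 < b := by linarith
  have hTb : T / b ≤ 1 := by rw [div_le_one hb0]; linarith
  have hMb : (M + T) / b ≤ δ := by
    rw [div_le_iff₀ hb0, mul_comm, ← div_le_iff₀ hδ0]; linarith
  have hLb : ‖lam‖ * (Cw * L) / b ≤ 1 / 2 := by rw [div_le_iff₀ hb0]; linarith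
  set S := profileSet k n m M δ φ with hS
  have hsz : ∀ t, 0 ≤ (((sFun b t : ℝ) : ℂ) * Complex.I).re := fun t => by simp
  have hsz' : ∀ t, 0 ≤ (-(((sFun b t : ℝ) : ℂ) * Complex.I)).re := fun t => by simp
  have hs1 : ∀ t, ‖((sFun b t : ℝ) : ℂ) * Complex.I‖ ≤ 1 / b := fun t => by
    rw [norm_sFun_mul_I hb0]; exact sFun_le hb0 t
  have hs2 : ∀ t, ‖((sFun b t : ℝ) : ℂ) * Complex.I‖ ≤ 1 := fun t =>
    (hs1 t).trans (by rw [div_le_one hb0]; exact hb1)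
  have hSR : ∀ f ∈ S, ∀ᵐ x, ‖f x‖ ≤ R := fun f hf => hf.2.1.ae_norm_le
  have hSN : ∀ f ∈ S, BoundTwo k n m KN (nonlinearity α f) ∧ BoundInf n m KN (nonlinearity α f) := by
    intro f hf
    refine hKN f hf.1 hf.2.1 ?_
    filter_upwards [ae_lower_bound hf hφc] with x hx
    refine le_trans (le_of_eq ?_) hx
    rw [← hA, hδ]
    field_simp
    ring
  have hNc : ∀ V : ℝ → L2 N, Continuous V → (∀ t, V t ∈ S) → Continuous fun t => nonlinearity α (V t) :=
    fun V hV hVS => continuous_nonlinearity hα hV fun t => hSR _ (hVS t)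
  have hMM : M₀ ≤ M := by rw [hM]; nlinarith
  have hφS : φ ∈ S := ⟨hφ2.mono hMM, hφi.mono hMM, fun γ _ ψ => by
    have : pair (φ - φ) (Xl γ ψ) = 0 := by rw [pair_sub_left, sub_self]
    rw [this, norm_zero]
    exact mul_nonneg hδ0.le (n1_nonneg ψ)⟩
  have hsrc : ∀ V : ℝ → L2 N, (∀ t, V t ∈ S) → ∀ t,
      BoundTwo k n m (wFun (N * α / 2) b t * (K * KN)) (source α b V t) ∧
      BoundInf n m (wFun (N * α / 2) b t * (K * KN)) (source α b V t) := by
    intro V hVS t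
    obtain ⟨h1, h2⟩ := hSN _ (hVS t)
    obtain ⟨h3, h4, -⟩ := hK _ KN hKN0 h1 h2 _ (hsz' t) (by rw [norm_neg]; exact hs2 t)
    have e : ‖((wFun (N * α / 2) b t : ℝ) : ℂ)‖ = wFun (N * α / 2) b t := by
      rw [Complex.norm_real, Real.norm_of_nonneg (wFun_nonneg _ hb0 t)]
    have h5 := h3.smul ((wFun (N * α / 2) b t : ℝ) : ℂ)
    have h6 := h4.smul ((wFun (N * α / 2) b t : ℝ) : ℂ)
    rw [e] at h5 h6
    exact ⟨h5, h6⟩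
  have hmem : ∀ V : ℝ → L2 N, Continuous V → (∀ t, V t ∈ S) → ∀ t,
      PL ((sFun b t : ℝ) * Complex.I) (profile α b lam φ V t) ∈ S := by
    intro V hV hVS t
    have hsc := continuous_source hb0 (hNc V hV hVS)
    have hwc := continuous_wFun (N * α / 2) hb0
    have hle : ‖Complex.I * lam‖ * ((∫ s in (0 : ℝ)..max t 0, wFun (N * α / 2) b s) * (K * KN)) ≤ T / b := by
      rw [norm_mul, Complex.norm_I, one_mul]
      calc ‖lam‖ * ((∫ s in (0 : ℝ)..max t 0, wFun (N * α / 2) b s) * (K * KN))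
          ≤ ‖lam‖ * (Cw / b * (K * KN)) := by
            gcongr
            exact integral_wFun_le_inv hp hb0 (le_max_right _ _)
        _ = T / b := by rw [hT]; ring
    have i2 := ((BoundTwo.integral hsc hwc (fun s => (hsrc V hVS s).1) (le_max_right t 0)).smul
      (Complex.I * lam)).mono hle
    have ii := ((BoundInf.integral hsc hwc (fun s => (hsrc V hVS s).2) (le_max_right t 0)).smul
      (Complex.I * lam)).mono hle
    have g2 : BoundTwo k n m (M₀ + 1) (profile α b lam φ V t) := (hφ2.add i2).mono (by linarith)
    have gi : BoundInf n m (M₀ + 1) (profile α b lam φ V t) := (hφi.add ii).mono (by linarith)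
    obtain ⟨p2, pi, pc⟩ := hK _ (M₀ + 1) (by positivity) g2 gi _ (hsz t) (hs2 t)
    refine ⟨p2, pi, fun γ hγ ψ => ?_⟩
    -- The distance to `φ` splits into the displacement by the propagator, of order `s(t) ≤ 1/b`,
    -- and the Duhamel term, also of order `1/b`.
    have e : PL ((sFun b t : ℝ) * Complex.I) (profile α b lam φ V t) - φ =
        (PL ((sFun b t : ℝ) * Complex.I) (profile α b lam φ V t) - profile α b lam φ V t) +
          (Complex.I * lam) • ∫ s in (0 : ℝ)..max t 0, source α b V s := by
      nth_rw 3 [profile]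
      abel
    rw [e, pair_add_left]
    calc _ ≤ K * (M₀ + 1) * ‖((sFun b t : ℝ) : ℂ) * Complex.I‖ * n1 ψ + T / b * n1 ψ :=
          (norm_add_le _ _).trans (add_le_add (pc γ hγ ψ) (ii [] γ (by simp) hγ ψ))
      _ ≤ M * (1 / b) * n1 ψ + T / b * n1 ψ := by
          have := n1_nonneg ψ
          gcongr
          exact hs1 t
      _ = (M + T) / b * n1 ψ := by ring
      _ ≤ δ * n1 ψ := mul_le_mul_of_nonneg_right hMb (n1_nonneg ψ)
  obtain ⟨V, hV, hVS, hfix⟩ := exists_fixed_point (Φ := fun V t =>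
      PL ((sFun b t : ℝ) * Complex.I) (profile α b lam φ V t)) (isClosed_profileSet k n m M δ φ) hφS
    (B := Ks * M) (fun f hf => (hsig f M hM0 hf.1 hf.2.1).norm) hmem
    (fun V hV hVS => continuous_PL_comp (by have := continuous_sFun hb0; fun_prop)
      (continuous_profile hb0 lam φ (hNc V hV hVS))) (by
      intro V W hV hW hVS hWS D hD t
      have hD0 : 0 ≤ D := (norm_nonneg _).trans (hD 0)
      rw [← PL_sub]
      refine (norm_PL_le _ _).trans ((norm_profile_sub_le hb0 hp lam φ (hNc V hV hVS) (hNc W hW hWS)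
        (D := L * D) (by positivity) (fun s => ?_) t).trans ?_)
      · exact (norm_nonlinearity_sub_le hα (hSR _ (hVS s)) (hSR _ (hWS s))).trans
          (mul_le_mul_of_nonneg_left (hD s) hL0)
      · calc ‖lam‖ * (Cw / b * (L * D)) = ‖lam‖ * (Cw * L) / b * D := by ring
          _ ≤ 1 / 2 * D := by gcongr)
  exact ⟨V, R, KN, hKN0, hV, fun t => hSR _ (hVS t), fun t => (hSN _ (hVS t)).1,
    fun t => (hSN _ (hVS t)).2, hfix⟩

/-! ### Uniqueness -/

theorem eq_zero_of_le_integral {D : ℝ → ℝ} (hD : Continuous D) (h0 : ∀ t, 0 ≤ D t) {A : ℝ}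
    (h : ∀ t, 0 ≤ t → D t ≤ A * ∫ s in (0 : ℝ)..t, D s) {t : ℝ} (ht : 0 ≤ t) : D t = 0 := by
  have hpos : ∀ s, 0 ≤ s → 0 ≤ ∫ r in (0 : ℝ)..s, D r := fun s hs =>
    intervalIntegral.integral_nonneg hs fun r _ => h0 r
  have key := norm_le_gronwallBound_of_norm_deriv_right_le (f := fun s => ∫ r in (0 : ℝ)..s, D r)
    (f' := D) (δ := 0) (K := A) (ε := 0) (a := 0) (b := t)
    (intervalIntegral.continuous_primitive (fun a c => hD.intervalIntegrable a c) 0).continuousOn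
    (fun s _ => (intervalIntegral.integral_hasDerivAt_right (hD.intervalIntegrable _ _)
      (hD.stronglyMeasurableAtFilter _ _) hD.continuousAt).hasDerivWithinAt) (by simp)
    (fun s hs => by
      rw [Real.norm_of_nonneg (h0 s), Real.norm_of_nonneg (hpos s hs.1), add_zero]
      exact h s hs.1) t ⟨ht, le_rfl⟩
  have hz : gronwallBound 0 A 0 (t - 0) = 0 := by
    unfold gronwallBound
    split_ifs <;> simp
  rw [hz, norm_le_zero_iff] at key
  have := h t ht
  rw [key, mul_zero] at this
  exact le_antisymm this (h0 t)

theorem ContinuousSigma.continuous {u : ℝ → L2 N} (hu : ContinuousSigma u) :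
    Continuous fun t => u (max t 0) := by
  have hon : ContinuousOn u (Set.Ici 0) := fun t ht => by
    rw [ContinuousWithinAt, tendsto_iff_edist_tendsto_0]
    refine tendsto_of_tendsto_of_tendsto_of_le_of_le tendsto_const_nhds (hu.2 t ht)
      (fun _ => bot_le) fun s => ?_
    simp only
    rw [edist_eq_enorm_sub, sigmaENorm, add_assoc]
    exact le_self_add
  exact hon.comp_continuous (by fun_prop) fun t => Set.mem_Ici.mpr (le_max_right _ _)

/-- On functions bounded by `M` the nonlinearity is Lipschitz in `L²`, and the group is a
contraction there, so Gronwall's inequality applies to the `L²` distance. The space-time bound holds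
only for almost every time, which suffices under the integral. -/
theorem IsGlobalSolution.unique {α : ℝ} (hα : 0 < α) {lam : ℂ} {u₀ : L2 N} {u v : ℝ → L2 N}
    (hu : IsGlobalSolution α lam u₀ u) (hv : IsGlobalSolution α lam u₀ v) {t : ℝ} (ht : 0 ≤ t) :
    u t = v t := by
  obtain ⟨huc, ⟨M₁, hM₁⟩, hud⟩ := hu
  obtain ⟨hvc, ⟨M₂, hM₂⟩, hvd⟩ := hv
  set M := max M₁ M₂ with hM
  set D : ℝ → ℝ := fun t => ‖u (max t 0) - v (max t 0)‖ with hD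
  have hDc : Continuous D := (huc.continuous.sub hvc.continuous).norm
  have key : ∀ t, 0 ≤ t → D t ≤ ‖lam‖ * ((α + 1) * M ^ α) * ∫ s in (0 : ℝ)..t, D s := by
    intro t ht
    obtain ⟨iu, eu⟩ := hud t ht
    obtain ⟨iv, ev⟩ := hvd t ht
    have e : u t - v t = (Complex.I * lam) • ∫ s in (0 : ℝ)..t,
        (schrodingerGroup (t - s) (nonlinearity α (u s)) - schrodingerGroup (t - s) (nonlinearity α (v s))) := by
      rw [intervalIntegral.integral_sub iu iv, smul_sub, eu, ev]
      abel
    simp only [hD, max_eq_left ht]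
    rw [e, norm_smul, norm_mul, Complex.norm_I, one_mul, mul_assoc, ← intervalIntegral.integral_const_mul]
    refine mul_le_mul_of_nonneg_left ?_ (norm_nonneg _)
    refine intervalIntegral.norm_integral_le_of_norm_le ht ?_
      ((hDc.const_mul ((α + 1) * M ^ α)).intervalIntegrable _ _)
    have h1 := (ae_restrict_iff' measurableSet_Ioi).mp hM₁
    have h2 := (ae_restrict_iff' measurableSet_Ioi).mp hM₂
    filter_upwards [h1, h2] with s hs1 hs2 hs
    rw [schrodingerGroup_eq, schrodingerGroup_eq, ← PL_sub]
    refine (norm_PL_le _ _).trans ?_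
    rw [max_eq_left hs.1.le]
    refine norm_nonlinearity_sub_le hα ?_ ?_
    · filter_upwards [hs1 hs.1] with x hx using hx.trans (le_max_left _ _)
    · filter_upwards [hs2 hs.1] with x hx using hx.trans (le_max_right _ _)
  have h := eq_zero_of_le_integral hDc (fun _ => norm_nonneg _) key ht
  simp only [hD, max_eq_left ht] at h
  exact sub_eq_zero.mp (norm_eq_zero.mp h)

/-! ### The solution obtained from the profile -/

theorem sFun_of_nonneg (b : ℝ) {t : ℝ} (ht : 0 ≤ t) : sFun b t = t / (1 + b * t) := by
  rw [sFun, max_eq_left ht]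

/-- The solution `e^{itΔ} (e^{ib|x|²/4} g(t))` with profile `g`. -/
def solution (α b : ℝ) (lam : ℂ) (φ : L2 N) (V : ℝ → L2 N) (t : ℝ) : L2 N :=
  PL (t * Complex.I) (phaseL b (profile α b lam φ V t))

theorem solution_ae {α b : ℝ} (hb : 0 < b) {lam : ℂ} {φ : L2 N} {V : ℝ → L2 N}
    (hV : ∀ t, V t = PL ((sFun b t : ℝ) * Complex.I) (profile α b lam φ V t)) {t : ℝ} (ht : 0 ≤ t) :
    solution α b lam φ V t =ᵐ[volume] fun x => (((1 + b * t) ^ (-((N : ℝ) / 2)) : ℝ) : ℂ) *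
      (Complex.exp (((b / (1 + b * t) * ‖x‖ ^ 2 / 4 : ℝ) : ℂ) * Complex.I) * V t ((1 + b * t)⁻¹ • x)) := by
  have e : profile α b lam φ V t = PL (-((sFun b t : ℝ) * Complex.I)) (V t) := by
    conv_rhs => rw [hV t]
    rw [PL_PL (by simp) (by simp), neg_add_cancel, PL_zero]
  rw [solution, e, sFun_of_nonneg b ht]
  exact PL_phaseL_PL_ae ht (by positivity) (V t)

theorem norm_solution_ae {α b : ℝ} (hb : 0 < b) {lam : ℂ} {φ : L2 N} {V : ℝ → L2 N}
    (hV : ∀ t, V t = PL ((sFun b t : ℝ) * Complex.I) (profile α b lam φ V t)) {R : ℝ}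
    (hR : ∀ t, ∀ᵐ x, ‖V t x‖ ≤ R) {t : ℝ} (ht : 0 ≤ t) :
    ∀ᵐ x, ‖solution α b lam φ V t x‖ ≤ (1 + b * t) ^ (-((N : ℝ) / 2)) * R := by
  have hτ : 0 < 1 + b * t := by positivity
  have hq := Measure.quasiMeasurePreserving_smul (volume : Measure (Space N)) (inv_ne_zero hτ.ne')
  filter_upwards [solution_ae hb hV ht, hq.ae (hR t)] with x h1 h2
  rw [h1, norm_mul, norm_mul, Complex.norm_exp_ofReal_mul_I, one_mul, Complex.norm_real,
    Real.norm_of_nonneg (by positivity)]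
  gcongr

/-- The nonlinearity commutes with unimodular phases and dilations, and the amplitude
`(1+bt)^{-N/2}` contributes the additional factor `(1+bt)^{-Nα/2}`. This is the origin of the weight
in `source`. -/
theorem nonlinearity_solution {α b : ℝ} (hα : 0 < α) (hb : 0 < b) {lam : ℂ} {φ : L2 N} {V : ℝ → L2 N}
    (hV : ∀ t, V t = PL ((sFun b t : ℝ) * Complex.I) (profile α b lam φ V t)) {R : ℝ}
    (hR : ∀ t, ∀ᵐ x, ‖V t x‖ ≤ R) {t : ℝ} (ht : 0 ≤ t) :
    nonlinearity α (solution α b lam φ V t) = PL (t * Complex.I) (phaseL b (source α b V t)) := by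
  have hτ : 0 < 1 + b * t := by positivity
  have hq := Measure.quasiMeasurePreserving_smul (volume : Measure (Space N)) (inv_ne_zero hτ.ne')
  have h1 := PL_phaseL_PL_ae ht hτ (nonlinearity α (V t))
  rw [source, phaseL_smul, PL_smul, sFun_of_nonneg b ht, wFun, max_eq_left ht]
  apply Lp.ext
  filter_upwards [nonlinearity_ae hα (norm_solution_ae hb hV hR ht), solution_ae hb hV ht, h1,
    hq.ae (nonlinearity_ae hα (hR t)), Lp.coeFn_smul (((1 + b * t) ^ (-(N * α / 2)) : ℝ) : ℂ)
      (PL (t * Complex.I) (phaseL b (PL (-((t / (1 + b * t) : ℝ) * Complex.I)) (nonlinearity α (V t)))))]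
    with x h2 h3 h4 h5 h6
  rw [h2, h6, Pi.smul_apply, h4, h5, h3, smul_eq_mul, nl, nl, norm_mul, norm_mul,
    Complex.norm_exp_ofReal_mul_I, one_mul, Complex.norm_real, Real.norm_of_nonneg (by positivity),
    Real.mul_rpow (by positivity) (norm_nonneg _), ← Real.rpow_mul hτ.le]
  have e : -((N : ℝ) / 2) * α = -(N * α / 2) := by ring
  rw [e]
  push_cast
  ring

/-- By `nonlinearity_solution` the integrand is the fixed bounded operator `e^{itΔ} e^{ib|x|²/4}`
applied to `source`. It leaves the integral, and the profile equation remains. -/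
theorem satisfiesDuhamel_solution {α b : ℝ} (hα : 0 < α) (hb : 0 < b) {lam : ℂ} {φ : L2 N} {V : ℝ → L2 N}
    (hVc : Continuous V)
    (hV : ∀ t, V t = PL ((sFun b t : ℝ) * Complex.I) (profile α b lam φ V t)) {R : ℝ}
    (hR : ∀ t, ∀ᵐ x, ‖V t x‖ ≤ R) :
    SatisfiesDuhamel α lam (phaseL b φ) (solution α b lam φ V) := by
  intro t ht
  have hsc := continuous_source hb (continuous_nonlinearity hα hVc hR)
  have e : ∀ s ∈ Set.uIcc 0 t, schrodingerGroup (t - s) (nonlinearity α (solution α b lam φ V s)) =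
      (PLC (t * Complex.I)).comp (phaseC b) (source α b V s) := by
    intro s hs
    rw [Set.uIcc_of_le ht] at hs
    rw [schrodingerGroup_eq, nonlinearity_solution hα hb hV hR hs.1, PL_PL (by simp) (by simp)]
    rw [ContinuousLinearMap.comp_apply, PLC_apply, phaseC_apply]
    congr 1
    push_cast
    ring
  have hi : IntervalIntegrable (fun s => (PLC (t * Complex.I)).comp (phaseC b) (source α b V s)) volume 0 t :=
    (((PLC (t * Complex.I)).comp (phaseC b)).continuous.comp hsc).intervalIntegrable _ _
  refine ⟨(intervalIntegrable_congr fun s hs => e s (Set.uIoc_subset_uIcc hs)).mpr hi, ?_⟩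
  rw [intervalIntegral.integral_congr e,
    ContinuousLinearMap.intervalIntegral_comp_comm _ (hsc.intervalIntegrable _ _), solution, profile,
    max_eq_left ht, phaseL_add, PL_add, phaseL_smul, PL_smul, schrodingerGroup_eq]
  rfl

/-! ### Continuity and scattering in `Σ` -/

theorem tendsto_of_norm_sub_le {g : ℝ → L2 N} {W : ℝ → ℝ} {D l : ℝ} (hD : 0 ≤ D)
    (h : ∀ s t, ‖g t - g s‖ ≤ D * |W t - W s|) (hW : Tendsto W atTop (𝓝 l)) :
    ∃ g₀, Tendsto g atTop (𝓝 g₀) := by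
  refine cauchySeq_tendsto_of_complete (Metric.cauchySeq_iff'.mpr fun ε hε => ?_)
  obtain ⟨T, hT⟩ := Metric.cauchySeq_iff'.mp hW.cauchySeq (ε / (D + 1)) (by positivity)
  refine ⟨T, fun t ht => ?_⟩
  have h1 := hT t ht
  rw [Real.dist_eq, lt_div_iff₀ (by positivity)] at h1
  rw [dist_eq_norm]
  have h2 := h T t
  have := abs_nonneg (W t - W T)
  nlinarith

theorem continuous_of_norm_sub_le {g : ℝ → L2 N} {W : ℝ → ℝ} {D : ℝ}
    (h : ∀ s t, ‖g t - g s‖ ≤ D * |W t - W s|) (hW : Continuous W) : Continuous g := by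
  rw [continuous_iff_continuousAt]
  intro s
  rw [ContinuousAt, tendsto_iff_norm_sub_tendsto_zero]
  have h1 : Continuous fun t => D * |W t - W s| := by fun_prop
  have h2 := h1.tendsto s
  rw [sub_self, abs_zero, mul_zero] at h2
  exact squeeze_zero (fun _ => norm_nonneg _) (fun t => h s t) h2

theorem SigmaRep.add {f g : L2 N} {d x d' x' : Fin N → L2 N} (h : SigmaRep f d x)
    (h' : SigmaRep g d' x') : SigmaRep (f + g) (d + d') (x + x') :=
  ⟨fun j ψ => by rw [pair_add_left, h.deriv, h'.deriv, Pi.add_apply, pair_add_left],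
    fun j ψ => by rw [pair_add_left, h.weight, h'.weight, Pi.add_apply, pair_add_left]⟩

theorem SigmaBound.mono {C C' : ℝ} {f : L2 N} (h : SigmaBound C f) (hC : C ≤ C') : SigmaBound C' f :=
  ⟨h.norm.trans hC, fun j ψ => (h.deriv j ψ).trans (mul_le_mul_of_nonneg_right hC (n2_nonneg ψ)),
    fun j ψ => (h.weight j ψ).trans (mul_le_mul_of_nonneg_right hC (n2_nonneg ψ))⟩

theorem SigmaRep.of_tendsto {g : ℝ → L2 N} {d x : ℝ → Fin N → L2 N} {g₀ : L2 N} {d₀ x₀ : Fin N → L2 N}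
    (h : ∀ t, SigmaRep (g t) (d t) (x t)) (hg : Tendsto g atTop (𝓝 g₀))
    (hd : ∀ j, Tendsto (fun t => d t j) atTop (𝓝 (d₀ j)))
    (hx : ∀ j, Tendsto (fun t => x t j) atTop (𝓝 (x₀ j))) : SigmaRep g₀ d₀ x₀ := by
  refine ⟨fun j ψ => ?_, fun j ψ => ?_⟩
  · refine tendsto_nhds_unique (((continuous_pair_left (Dop j ψ)).tendsto _).comp hg) ?_
    refine (((continuous_pair_left ψ).tendsto _).comp (hd j)).congr fun t => ?_
    exact ((h t).deriv j ψ).symm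
  · refine tendsto_nhds_unique (((continuous_pair_left (Xop j ψ)).tendsto _).comp hg) ?_
    refine (((continuous_pair_left ψ).tendsto _).comp (hx j)).congr fun t => ?_
    exact ((h t).weight j ψ).symm

/-- The accumulated weight `∫₀ᵗ w`. -/
def weightPrim (p b t : ℝ) : ℝ := ∫ s in (0 : ℝ)..max t 0, wFun p b s

theorem weightPrim_sub (p : ℝ) {b : ℝ} (hb : 0 < b) (s t : ℝ) :
    weightPrim p b t - weightPrim p b s = ∫ r in max s 0..max t 0, wFun p b r :=
  intervalIntegral.integral_interval_sub_left ((continuous_wFun p hb).intervalIntegrable _ _)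
    ((continuous_wFun p hb).intervalIntegrable _ _)

theorem continuous_weightPrim (p : ℝ) {b : ℝ} (hb : 0 < b) : Continuous (weightPrim p b) := by
  have h : Continuous fun T => ∫ s in (0 : ℝ)..T, wFun p b s :=
    intervalIntegral.continuous_primitive (fun a c => (continuous_wFun p hb).intervalIntegrable a c) 0
  exact h.comp (continuous_id.max continuous_const)

theorem exists_tendsto_weightPrim {p : ℝ} (hp : 1 < p) {b : ℝ} (hb : 0 < b) :
    ∃ l, Tendsto (weightPrim p b) atTop (𝓝 l) := by
  refine ⟨_, tendsto_atTop_ciSup (fun s t hst => ?_) ⟨(p - 1)⁻¹ / b, ?_⟩⟩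
  · rw [← sub_nonneg, weightPrim_sub p hb]
    exact intervalIntegral.integral_nonneg (max_le_max_right 0 hst) fun r _ => wFun_nonneg p hb r
  · rintro _ ⟨t, rfl⟩
    exact integral_wFun_le_inv hp hb (le_max_right _ _)

/-- A profile whose increments are controlled in `Σ` by the accumulated weight yields a solution
that is continuous in `Σ` and scatters. -/
theorem sigma_of_increments {α b : ℝ} (hb : 0 < b) {lam : ℂ} {φ : L2 N} {V : ℝ → L2 N} {p D : ℝ}
    (hp : 1 < p) (hD : 0 ≤ D) (hφ : SigmaBound D φ)
    (h : ∀ s t, max s 0 ≤ max t 0 → SigmaBound (D * (weightPrim p b t - weightPrim p b s))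
      (profile α b lam φ V t - profile α b lam φ V s)) :
    ContinuousSigma (solution α b lam φ V) ∧ Scatters (solution α b lam φ V) := by
  set g := profile α b lam φ V with hg
  set W := weightPrim p b with hW
  have hg0 : g 0 = φ := by simp [hg, profile]
  have hmono : ∀ s t, max s 0 ≤ max t 0 → 0 ≤ W t - W s := fun s t hst => by
    rw [hW, weightPrim_sub p hb]
    exact intervalIntegral.integral_nonneg hst fun r _ => wFun_nonneg p hb r
  obtain ⟨dφ, xφ, hrφ⟩ := hφ.exists_rep hD
  have hrep : ∀ t, ∃ d x : Fin N → L2 N, SigmaRep (g t) d x := fun t => by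
    have h1 := h 0 t (by simp)
    obtain ⟨d, x, hr⟩ := h1.exists_rep (mul_nonneg hD (hmono 0 t (by simp)))
    rw [hg0] at hr
    have h2 := hr.add hrφ
    rw [sub_add_cancel] at h2
    exact ⟨_, _, h2⟩
  choose d x hr using hrep
  have hbound : ∀ s t, max s 0 ≤ max t 0 → ‖g t - g s‖ ≤ D * |W t - W s| ∧
      (∀ j, ‖d t j - d s j‖ ≤ D * |W t - W s|) ∧ ∀ j, ‖x t j - x s j‖ ≤ D * |W t - W s| := by
    intro s t hst
    have h0 := hmono s t hst
    have h1 := h s t hst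
    have h2 := fun j => ((hr t).sub (hr s)).norm_le (mul_nonneg hD h0) h1 j
    rw [abs_of_nonneg h0]
    exact ⟨h1.norm, fun j => (h2 j).1, fun j => (h2 j).2⟩
  have hboth : ∀ s t, ‖g t - g s‖ ≤ D * |W t - W s| ∧
      (∀ j, ‖d t j - d s j‖ ≤ D * |W t - W s|) ∧ ∀ j, ‖x t j - x s j‖ ≤ D * |W t - W s| := by
    intro s t
    rcases le_total (max s 0) (max t 0) with hst | hst
    · exact hbound s t hst
    · obtain ⟨h1, h2, h3⟩ := hbound t s hst
      rw [abs_sub_comm, norm_sub_rev]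
      exact ⟨h1, fun j => by rw [norm_sub_rev]; exact h2 j, fun j => by rw [norm_sub_rev]; exact h3 j⟩
  have hWc : Continuous W := continuous_weightPrim p hb
  have hgc : Continuous g := continuous_of_norm_sub_le (fun s t => (hboth s t).1) hWc
  have hdc : ∀ j, Continuous fun t => d t j := fun j =>
    continuous_of_norm_sub_le (fun s t => (hboth s t).2.1 j) hWc
  have hxc : ∀ j, Continuous fun t => x t j := fun j =>
    continuous_of_norm_sub_le (fun s t => (hboth s t).2.2 j) hWc
  have hph : ∀ {f : ℝ → L2 N}, Continuous f → Continuous fun t => phaseL b (f t) := fun hf =>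
    (phaseC b).continuous.comp hf
  have hzc : Continuous fun t : ℝ => (t : ℂ) * Complex.I := by fun_prop
  -- The components representing `u(t)` in `Σ` are continuous expressions in `t`, `g`, `d` and `x`.
  have hur : ∀ t : ℝ, SigmaRep (solution α b lam φ V t) _ _ := fun t =>
    ((hr t).phaseL b).PL (z := t * Complex.I) (by simp)
  obtain ⟨l, hl⟩ := exists_tendsto_weightPrim hp hb
  obtain ⟨g₀, hg₀⟩ := tendsto_of_norm_sub_le hD (fun s t => (hboth s t).1) hl
  choose d₀ hd₀ using fun j => tendsto_of_norm_sub_le hD (fun s t => (hboth s t).2.1 j) hl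
  choose x₀ hx₀ using fun j => tendsto_of_norm_sub_le hD (fun s t => (hboth s t).2.2 j) hl
  have hr₀ : SigmaRep g₀ d₀ x₀ := SigmaRep.of_tendsto hr hg₀ hd₀ hx₀
  have hdc' : ∀ j, Continuous fun t => phaseL b (d t j) - (b / 2 * Complex.I) • phaseL b (x t j) := fun j => by
    have h1 := hph (hdc j)
    have h2 := hph (hxc j)
    fun_prop
  refine ⟨⟨fun t _ => (hur t).memSigma, fun t _ => ?_⟩, phaseL b g₀, (hr₀.phaseL b).memSigma, ?_⟩
  · refine tendsto_sigmaENorm_sub (Eventually.of_forall hur) (hur t) ?_ (fun j => ?_) fun j => ?_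
    · exact ((continuous_PL_comp hzc (hph hgc)).tendsto t).mono_left nhdsWithin_le_nhds
    · exact ((continuous_PL_comp hzc (hdc' j)).tendsto t).mono_left nhdsWithin_le_nhds
    · have h1 := hph (hxc j)
      have h2 := hdc' j
      exact ((continuous_PL_comp hzc (h1.add ((by fun_prop : Continuous fun t : ℝ =>
        2 * ((t : ℂ) * Complex.I)).smul h2))).tendsto t).mono_left nhdsWithin_le_nhds
  -- The free evolution cancels exactly, so scattering is the convergence of the profile `g(t)` in
  -- `Σ`, with `u⁺ = e^{ib|x|²/4} g₀`.
  · have e : ∀ t : ℝ, schrodingerGroup (-t) (solution α b lam φ V t) = phaseL b (g t) := fun t => by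
      rw [schrodingerGroup_eq, solution, PL_PL (by simp) (by simp)]
      have : ((-t : ℝ) : ℂ) * Complex.I + t * Complex.I = 0 := by push_cast; ring
      rw [this, PL_zero]
    simp_rw [e]
    have hpt : ∀ {f : ℝ → L2 N} {f₀ : L2 N}, Tendsto f atTop (𝓝 f₀) →
        Tendsto (fun t => phaseL b (f t)) atTop (𝓝 (phaseL b f₀)) := fun hf =>
      ((phaseC b).continuous.tendsto _).comp hf
    exact tendsto_sigmaENorm_sub (Eventually.of_forall fun t => (hr t).phaseL b) (hr₀.phaseL b) (hpt hg₀)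
      (fun j => (hpt (hd₀ j)).sub ((hpt (hx₀ j)).const_smul _)) fun j => hpt (hx₀ j)

/-- An increment of the profile is an integral of `source`, whose weighted bounds are proportional
to `wFun`. They pass through the integral and dominate the `Σ` norm by `exists_sigmaBound`. -/
theorem sigmaBound_profile_sub {k n m : ℕ} (hk : (N : ℝ) / 2 < k) (hm : (N : ℝ) / 2 + 1 < m)
    (hn : 1 ≤ 2 * n) {α b : ℝ} (hb : 1 ≤ b) (lam : ℂ) (φ : L2 N) {V : ℝ → L2 N} {C : ℝ} (hC : 0 ≤ C)
    (hV : Continuous fun t => nonlinearity α (V t))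
    (h2 : ∀ t, BoundTwo k n m C (nonlinearity α (V t))) (hi : ∀ t, BoundInf n m C (nonlinearity α (V t))) :
    ∃ D : ℝ, 0 ≤ D ∧ ∀ s t, max s 0 ≤ max t 0 →
      SigmaBound (D * (weightPrim (N * α / 2) b t - weightPrim (N * α / 2) b s))
        (profile α b lam φ V t - profile α b lam φ V s) := by
  have hb0 : 0 < b := by linarith
  obtain ⟨K, hK1, hK⟩ := exists_PL_bound (N := N) k n m hk
  obtain ⟨Ks, hKs, hsig⟩ := exists_sigmaBound (N := N) hk hm hn
  have hsc := continuous_source hb0 hV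
  have hwc := continuous_wFun (N * α / 2) hb0
  have hsrc : ∀ t, BoundTwo k n m (wFun (N * α / 2) b t * (K * C)) (source α b V t) ∧
      BoundInf n m (wFun (N * α / 2) b t * (K * C)) (source α b V t) := by
    intro t
    obtain ⟨h3, h4, -⟩ := hK _ C hC (h2 t) (hi t) (-((sFun b t : ℝ) * Complex.I)) (by simp) (by
      rw [norm_neg, norm_sFun_mul_I hb0]
      exact (sFun_le hb0 t).trans (by rw [div_le_one hb0]; exact hb))
    have e : ‖((wFun (N * α / 2) b t : ℝ) : ℂ)‖ = wFun (N * α / 2) b t := by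
      rw [Complex.norm_real, Real.norm_of_nonneg (wFun_nonneg _ hb0 t)]
    have h5 := h3.smul ((wFun (N * α / 2) b t : ℝ) : ℂ)
    have h6 := h4.smul ((wFun (N * α / 2) b t : ℝ) : ℂ)
    rw [e] at h5 h6
    exact ⟨h5, h6⟩
  refine ⟨Ks * (‖Complex.I * lam‖ * (K * C)), by positivity, fun s t hst => ?_⟩
  have e : profile α b lam φ V t - profile α b lam φ V s =
      (Complex.I * lam) • ∫ r in max s 0..max t 0, source α b V r := by
    rw [profile, profile, add_sub_add_left_eq_sub, ← smul_sub, intervalIntegral.integral_interval_sub_left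
      (hsc.intervalIntegrable _ _) (hsc.intervalIntegrable _ _)]
  have h0 : 0 ≤ ∫ r in max s 0..max t 0, wFun (N * α / 2) b r :=
    intervalIntegral.integral_nonneg hst fun r _ => wFun_nonneg _ hb0 r
  rw [e, weightPrim_sub _ hb0]
  refine (hsig _ (‖Complex.I * lam‖ * ((∫ r in max s 0..max t 0, wFun (N * α / 2) b r) * (K * C)))
    (by positivity) ((BoundTwo.integral hsc hwc (fun r => (hsrc r).1) hst).smul _)
    ((BoundInf.integral hsc hwc (fun r => (hsrc r).2) hst).smul _)).mono (le_of_eq (by ring))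

end NLS

end

/-! ### Assembly of the main theorem. -/

theorem mainTheorem1 (N : ℕ) (hN : 1 ≤ N) (α : ℝ) (hα : 2 / (N : ℝ) < α) (lam : ℂ)
    (k n m : ℕ) (hk : (N : ℝ) / 2 < k)
    (hm : max ((N : ℝ) / 2 + 1) ((N : ℝ) / (2 * α)) < m)
    (hn : k + m + 1 ≤ 2 * n)
    (φ : NLS.L2 N) (hφ : NLS.MemX k n m φ)
    (hinf : ∃ c > 0, ∀ᵐ x ∂(volume : Measure (NLS.Space N)), c ≤ NLS.bracket x ^ m * ‖φ x‖) :
    ∃ b₀ > 0, ∀ b : ℝ, b₀ ≤ b →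
      ∃ u : ℝ → NLS.L2 N,
        NLS.IsGlobalSolution α lam
          (NLS.phaseMul (fun x => b * ‖x‖ ^ 2 / 4) (by fun_prop) φ) u ∧
        (∀ w : ℝ → NLS.L2 N,
          NLS.IsGlobalSolution α lam
            (NLS.phaseMul (fun x => b * ‖x‖ ^ 2 / 4) (by fun_prop) φ) w →
          ∀ t ≥ 0, w t = u t) ∧
        NLS.Scatters u ∧
        (⨆ t : Set.Ici (0 : ℝ), ENNReal.ofReal ((1 + (t : ℝ)) ^ ((N : ℝ) / 2)) *
          eLpNorm (u t) ∞ volume) < ∞ := by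
  have hN0 : (0 : ℝ) < N := by exact_mod_cast hN
  have hα0 : 0 < α := lt_trans (by positivity) hα
  have hp : 1 < N * α / 2 := by
    rw [div_lt_iff₀ hN0] at hα
    linarith
  have hm1 : (N : ℝ) / 2 + 1 < m := (le_max_left _ _).trans_lt hm
  have hmα : (N : ℝ) / 2 < m * α := by
    have h := (le_max_right _ _).trans_lt hm
    rw [div_lt_iff₀ (by positivity)] at h
    linarith
  obtain ⟨b₀, hb₀, H⟩ := NLS.exists_profile_solution hk hm1 hn hα0 hmα hp lam hφ hinf
  refine ⟨b₀, by linarith, fun b hb => ?_⟩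
  have hb1 : 1 ≤ b := hb₀.trans hb
  have hb0 : 0 < b := by linarith
  obtain ⟨V, R, C, hC, hVc, hR, h2, hi, hV⟩ := H b hb
  obtain ⟨M, hM, hφ2, hφi⟩ := hφ.exists_bound
  obtain ⟨Ks, hKs, hsig⟩ := NLS.exists_sigmaBound (N := N) hk hm1 (by lia : 1 ≤ 2 * n)
  obtain ⟨D, hD, hinc⟩ := NLS.sigmaBound_profile_sub hk hm1 (by lia : 1 ≤ 2 * n) hb1 lam φ hC
    (NLS.continuous_nonlinearity hα0 hVc hR) h2 hi
  have hKM : 0 ≤ Ks * M := by positivity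
  -- A single constant must bound both `φ` and the increments, hence the sum of the two.
  obtain ⟨hcs, hsc⟩ := NLS.sigma_of_increments (p := N * α / 2) (D := D + Ks * M) hb0 hp (by linarith)
    ((hsig φ M hM hφ2 hφi).mono (by linarith)) fun s t hst => (hinc s t hst).mono (by
      have : 0 ≤ NLS.weightPrim (N * α / 2) b t - NLS.weightPrim (N * α / 2) b s := by
        rw [NLS.weightPrim_sub _ hb0]
        exact intervalIntegral.integral_nonneg hst fun r _ => NLS.wFun_nonneg _ hb0 r
      gcongr
      linarith)
  -- No sign of `R` is given, so it is replaced by `max R 0`.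
  have hRpos : ∀ t : ℝ, 0 ≤ t → ∀ᵐ x, ‖NLS.solution α b lam φ V t x‖ ≤
      (1 + b * t) ^ (-((N : ℝ) / 2)) * max R 0 := fun t ht =>
    NLS.norm_solution_ae hb0 hV
      (fun s => (hR s).mono fun x hx => hx.trans (le_max_left R 0)) ht
  have hsol : NLS.IsGlobalSolution α lam (NLS.phaseL b φ) (NLS.solution α b lam φ V) := by
    refine ⟨hcs, ⟨max R 0, ?_⟩, NLS.satisfiesDuhamel_solution hα0 hb0 hVc hV hR⟩
    refine (ae_restrict_iff' measurableSet_Ioi).mpr (Eventually.of_forall fun t ht => ?_)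
    have ht0 : (0 : ℝ) ≤ t := (Set.mem_Ioi.mp ht).le
    filter_upwards [hRpos t ht0] with x hx
    refine hx.trans (mul_le_of_le_one_left (le_max_right _ _) ?_)
    exact Real.rpow_le_one_of_one_le_of_nonpos (le_add_of_nonneg_right (by positivity))
      (by rw [neg_nonpos]; positivity)
  refine ⟨NLS.solution α b lam φ V, hsol, fun w hw t ht => hw.unique hα0 hsol ht, hsc, ?_⟩
  refine (iSup_le fun t => ?_).trans_lt (ENNReal.ofReal_lt_top (r := max R 0))
  obtain ⟨t, ht⟩ := t
  have ht0 : (0 : ℝ) ≤ t := ht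
  have h1 := eLpNormEssSup_le_of_ae_bound (hRpos t ht0)
  rw [← eLpNorm_exponent_top] at h1
  refine (mul_le_mul_right h1 _).trans ?_
  rw [← ENNReal.ofReal_mul (by positivity)]
  refine ENNReal.ofReal_le_ofReal ?_
  rw [← mul_assoc]
  refine mul_le_of_le_one_left (le_max_right _ _) ?_
  -- The decay comes in powers of `1 + bt`, and `b ≥ 1` gives `1 + t ≤ 1 + bt`.
  rw [Real.rpow_neg (by positivity), ← div_eq_mul_inv, div_le_one (by positivity)]
  gcongr
  exact le_mul_of_one_le_left ht0 hb1
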